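/- Let $N\ge 0$, let $U\subset\mathbb R^N$ be a simply connected open set with coordinates $u=(u^1,\dots,u^N)$ (the domain of a local coordinate system), let $g^{ij}(u)$ and $b^{ij}_k(u)$ be real smooth functions on $U$, and let $K$ be a real constant. Summation over repeated indices is understood. Consider the nonlocal bracket of hydrodynamic type $$\{I,J\}_1=\int \frac{\delta I}{\delta u^i(x)}\Big(g^{ij}(u(x))\frac{d}{dx}+b^{ij}_k(u(x))\,u^k_x+K\,u^i_x\Big(\frac{d}{dx}\Big)^{-1}u^j_x\Big)\frac{\delta J}{\delta u^j(x)}\,dx \tag{1}$$ and, for a constant real symmetric matrix $(\eta^{ij})$ with $\det(\eta^{ij})\neq 0$ and inverse $(\eta_{ij})$, $\eta^{is}\eta_{sj}=\delta^i_j$, the constant bracket $$\{I,J\}_2=\int \frac{\delta I}{\delta u^i(x)}\,\eta^{ij}\frac{d}{dx}\,\frac{\delta J}{\delta u^j(x)}\,dx .$$ Conventions. The fields are the smooth maps $u:\mathbb R\to U$ that are equal to a constant $u(\infty)\in U$ (depending on the field) outside a compact set; $I$ and $J$ are arbitrary smooth functionals of the fields whose variational derivatives $\delta I/\delta u^i(x)$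 depend smoothly on $x$ and on parameters in two-parameter families $u+sh+tk$, with $h,k$ smooth and compactly supported, and are constant for large $|x|$ (with the same constant at both ends, and locally uniformly in $s,t$); and $\left(\frac{d}{dx}\right)^{-1}f(x)=\frac12\big(\int_{-\infty}^x f-\int_x^{\infty} f\big)$. A bracket is a Poisson bracket if it is skew-symmetric and satisfies the Jacobi identity on all such functionals (here $\{F,L\}$ is the derivative of $F$ in the direction of the vector field $P^{ij}\,\delta L/\delta u^j$, where $P^{ij}$ is the operator that defines the bracket). Two brackets are compatible if every linear combination of them with real constant coefficients is a Poisson bracket. The integral with density $f(u)$ is $\int \big(f(u(x))-f(u(\infty))\big)\,dx$, whose variational derivative is $\partial f/\partial u^i(u(x))$. Theorem. Suppose that the bracket (1) is a Poisson bracket (it may be degenerate, that is, no condition is imposed on $\det(g^{ij})$). Then (1) is compatible with the constant bracket $\{\cdot,\cdot\}_2$ if and only if the functions $u^i(x)$, $1\le i\le N$, and $\eta_{ij}u^i(x)u^j(x)$ are densities of integrals in involution with respect to (1), that is, $$\{U^i,U^j\}_1=0,\qquad 1\le i,j\le N+1,$$ where $U^i$, $1\le i\le N$, is the integral with density $u^i$,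 and $U^{N+1}$ is the integral with density $\eta_{ij}u^iu^j$. -/

import Mathlib

open MeasureTheory Filter Topology
open scoped ContDiff

noncomputable section

namespace HydroBracket

/-- The fields `u = (u¹, …, u^N)` of one variable `x` on which functionals are evaluated: smooth maps from
the line to the coordinate domain `U` that equal a constant vector (depending on `u`) outside a compact set. -/
structure IsField {N : ℕ} (U : Set (Fin N → ℝ)) (u : ℝ → Fin N → ℝ) : Prop where
  smooth : ContDiff ℝ ∞ u
  mem : ∀ x, u x ∈ U
  background : ∃ c : Fin N → ℝ, HasCompactSupport (fun x => u x - c)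

/-- Admissible variations of a field: smooth and compactly supported. -/
structure IsVariation {N : ℕ} (h : ℝ → Fin N → ℝ) : Prop where
  smooth : ContDiff ℝ ∞ h
  compact : HasCompactSupport h

/-- A (smooth) functional `I[u]` on the fields with values in `U`, together with its variational
derivative `δI/δu^i(x)`.  The latter depends smoothly on `x` and on the parameters of two-parameter
families `u + s h + t k`, and it is constant for large `|x|`, locally uniformly in `s, t`.
What `val` and `varDeriv` do on functions that are not fields is irrelevant. -/
structure Functional {N : ℕ} (U : Set (Fin N → ℝ)) where
  /-- the value `I[u]` -/
  val : (ℝ → Fin N → ℝ) → ℝ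
  /-- the variational derivative: `varDeriv u x i` is `δI/δu^i(x)` at `u` -/
  varDeriv : (ℝ → Fin N → ℝ) → ℝ → Fin N → ℝ
  hasVarDeriv : ∀ u h, IsField U u → IsVariation h →
    HasDerivAt (fun ε : ℝ => val (u + ε • h)) (∫ x, ∑ i, varDeriv u x i * h x i) 0
  smooth : ∀ u h k, IsField U u → IsVariation h → IsVariation k → ∀ x : ℝ,
    ContDiffAt ℝ ∞
      (fun q : (ℝ × ℝ) × ℝ => varDeriv (u + q.1.1 • h + q.1.2 • k) q.2) ((0, 0), x)
  const_at_infinity : ∀ u h k, IsField U u → IsVariation h → IsVariation k →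
    ∃ R : ℝ, ∀ᶠ p : ℝ × ℝ in 𝓝 (0, 0), ∀ x y : ℝ, R ≤ |x| → R ≤ |y| →
      varDeriv (u + p.1 • h + p.2 • k) x = varDeriv (u + p.1 • h + p.2 • k) y

/-- The skew-symmetric inverse of `d/dx`:
`(d/dx)⁻¹ f (x) = ½ (∫_{-∞}^x f - ∫_x^∞ f)`. -/
def invD (f : ℝ → ℝ) (x : ℝ) : ℝ :=
  (1 / 2) * ((∫ y in Set.Iic x, f y) - ∫ y in Set.Ioi x, f y)

/-- The coefficients `g^{ij}(u)`, `b^{ij}_k(u)`, `K` of the operator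
`g^{ij}(u) d/dx + b^{ij}_k(u) u^k_x + K u^i_x (d/dx)⁻¹ u^j_x`; here `b p i j k` is `b^{ij}_k(p)`. -/
structure Coeffs (N : ℕ) where
  g : (Fin N → ℝ) → Fin N → Fin N → ℝ
  b : (Fin N → ℝ) → Fin N → Fin N → Fin N → ℝ
  K : ℝ

namespace Coeffs

variable {N : ℕ}

/-- The coefficients are smooth functions of the coordinates on `U`. -/
structure SmoothOn (P : Coeffs N) (U : Set (Fin N → ℝ)) : Prop where
  g : ∀ i j, ContDiffOn ℝ ∞ (fun p => P.g p i j) U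
  b : ∀ i j k, ContDiffOn ℝ ∞ (fun p => P.b p i j k) U

/-- The linear combination `α A + β B`. -/
def lincomb (α : ℝ) (A : Coeffs N) (β : ℝ) (B : Coeffs N) : Coeffs N where
  g := fun p i j => α * A.g p i j + β * B.g p i j
  b := fun p i j k => α * A.b p i j k + β * B.b p i j k
  K := α * A.K + β * B.K

/-- The constant operator `η^{ij} d/dx`. -/
def const (η : Matrix (Fin N) (Fin N) ℝ) : Coeffs N where
  g := fun _ i j => η i j
  b := fun _ _ _ _ => 0
  K := 0

/-- The operator at the field `u`, applied to `v = (v_j(x))`: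
`g^{ij}(u) (v_j)_x + b^{ij}_k(u) u^k_x v_j + K u^i_x (d/dx)⁻¹ (u^j_x v_j)`. -/
def apply (P : Coeffs N) (u v : ℝ → Fin N → ℝ) (x : ℝ) (i : Fin N) : ℝ :=
  (∑ j, P.g (u x) i j * deriv (fun y => v y j) x)
    + (∑ j, ∑ k, P.b (u x) i j k * deriv (fun y => u y k) x * v x j)
    + P.K * deriv (fun y => u y i) x *
        invD (fun y => ∑ j, deriv (fun z => u z j) y * v y j) x

variable {U : Set (Fin N → ℝ)}

/-- The Hamiltonian vector field of `J`: `X_J^i(x) = P^{ij} δJ/δu^j(x)`. -/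
def hamField (P : Coeffs N) (J : Functional U) (u : ℝ → Fin N → ℝ) : ℝ → Fin N → ℝ :=
  P.apply u (J.varDeriv u)

/-- The bracket `{I, J}[u] = ∫ δI/δu^i(x) P^{ij} δJ/δu^j(x) dx`. -/
def bracket (P : Coeffs N) (I J : Functional U) (u : ℝ → Fin N → ℝ) : ℝ :=
  ∫ x, ∑ i, I.varDeriv u x i * P.hamField J u x i

/-- `a` is the value at `u` of the iterated bracket `{F, L}`, where `F` is a function of fields (itself a
bracket in the applications): since `∫ δF/δu^i X^i dx` is the derivative of `F` in the direction `X`,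
this value is the derivative of `F` along the Hamiltonian vector field of `L`. -/
def IsBracketWith (P : Coeffs N) (F : (ℝ → Fin N → ℝ) → ℝ) (L : Functional U)
    (u : ℝ → Fin N → ℝ) (a : ℝ) : Prop :=
  HasDerivAt (fun ε : ℝ => F (u + ε • P.hamField L u)) a 0

/-- The bracket is a Poisson bracket: it is skew-symmetric and satisfies the Jacobi identity
`{{I, J}, L} + {{J, L}, I} + {{L, I}, J} = 0`, for arbitrary functionals at arbitrary fields.
No nondegeneracy is required. -/
structure IsPoisson (U : Set (Fin N → ℝ)) (P : Coeffs N) : Prop where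
  skew : ∀ (I J : Functional U) (u : ℝ → Fin N → ℝ), IsField U u →
    P.bracket I J u = - P.bracket J I u
  jacobi : ∀ (I J L : Functional U) (u : ℝ → Fin N → ℝ), IsField U u →
    ∃ a b c : ℝ, P.IsBracketWith (P.bracket I J) L u a ∧
      P.IsBracketWith (P.bracket J L) I u b ∧
      P.IsBracketWith (P.bracket L I) J u c ∧ a + b + c = 0

/-- Two brackets are compatible: every linear combination of them is a Poisson bracket. -/
def Compatible (U : Set (Fin N → ℝ)) (A B : Coeffs N) : Prop :=
  ∀ α β : ℝ, (lincomb α A β B).IsPoisson U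

/-- The functionals of the set `S` are pairwise in involution with respect to the bracket. -/
def InInvolution (P : Coeffs N) (S : Set (Functional U)) : Prop :=
  ∀ I ∈ S, ∀ J ∈ S, ∀ u : ℝ → Fin N → ℝ, IsField U u → P.bracket I J u = 0

end Coeffs

/-- The constant value of a field near infinity. -/
def backgroundValue {N : ℕ} (u : ℝ → Fin N → ℝ) : Fin N → ℝ := limUnder atTop u

theorem backgroundValue_eq {N : ℕ} {u : ℝ → Fin N → ℝ} {c : Fin N → ℝ}
    (hc : HasCompactSupport (fun x => u x - c)) : backgroundValue u = c := by
  have h1 : ∀ᶠ x in atTop, u x = c := by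
    have h2 : ∀ᶠ x in cocompact ℝ, u x - c = 0 := by
      filter_upwards [hc.isCompact.compl_mem_cocompact] with x hx
      exact image_eq_zero_of_notMem_tsupport (f := fun x => u x - c) hx
    filter_upwards [atTop_le_cocompact h2] with x hx
    exact sub_eq_zero.mp hx
  exact (tendsto_const_nhds.congr' (h1.mono fun x hx => hx.symm)).limUnder_eq

theorem compact_add_smul {N : ℕ} {u h : ℝ → Fin N → ℝ} {c : Fin N → ℝ}
    (hc : HasCompactSupport (fun x => u x - c)) (hh : HasCompactSupport h) (ε : ℝ) :
    HasCompactSupport (fun x => (u + ε • h) x - c) := by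
  have h1 : HasCompactSupport (fun x => ε • h x) := hh.smul_left (f := fun _ => ε)
  have h2 := hc.add h1
  have h3 : (fun x => (u + ε • h) x - c) = (fun x => u x - c) + (fun x => ε • h x) := by
    funext x; simp only [Pi.add_apply, Pi.smul_apply]; abel
  rw [h3]; exact h2

/-- The integral `∫ f(u(x)) dx` with smooth density `f`.  If `f` does not vanish at the constant value
`u(∞)` of the field near infinity, the divergent constant is subtracted:
`∫ (f(u(x)) - f(u(∞))) dx`.  Its variational derivative is `∂f/∂u^i (u(x))`. -/
def ofDensity {N : ℕ} (U : Set (Fin N → ℝ)) (f : (Fin N → ℝ) → ℝ) (hf : ContDiff ℝ ∞ f) :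
    Functional U where
  val := fun u => ∫ x, (f (u x) - f (backgroundValue u))
  varDeriv := fun u x i => fderiv ℝ f (u x) (Pi.single i 1)
  hasVarDeriv := by
    intro u h hu hh
    obtain ⟨c, hc⟩ := hu.background
    have huc : Continuous u := hu.smooth.continuous
    have hhc : Continuous h := hh.smooth.continuous
    have hfc : Continuous f := hf.continuous
    have hdf : Continuous (fderiv ℝ f) := hf.continuous_fderiv (by simp)
    have hval : (fun ε : ℝ => ∫ x, (f ((u + ε • h) x) - f (backgroundValue (u + ε • h))))
        = fun ε : ℝ => ∫ x, (f (u x + ε • h x) - f c) := by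
      funext ε
      rw [backgroundValue_eq (compact_add_smul hc hh.compact ε)]
      rfl
    have hder : (∫ x, ∑ i, fderiv ℝ f (u x) (Pi.single i 1) * h x i)
        = ∫ x, fderiv ℝ f (u x + (0 : ℝ) • h x) (h x) := by
      congr 1
      funext x
      rw [zero_smul, add_zero]
      have h1 := LinearMap.pi_apply_eq_sum_univ (fderiv ℝ f (u x)).toLinearMap (h x)
      simp only [ContinuousLinearMap.coe_coe, smul_eq_mul] at h1
      rw [h1]
      refine Finset.sum_congr rfl fun i _ => ?_
      rw [mul_comm]
      congr 2
      funext j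
      simp [Pi.single_apply, eq_comm]
    rw [hval, hder]
    have hcomp : IsCompact (Metric.closedBall (0 : ℝ) 1 ×ˢ tsupport h) :=
      (isCompact_closedBall 0 1).prod hh.compact.isCompact
    have hF'c : Continuous
        (fun q : ℝ × ℝ => fderiv ℝ f (u q.2 + q.1 • h q.2) (h q.2)) := by
      fun_prop
    obtain ⟨C, hC⟩ := hcomp.exists_bound_of_continuousOn hF'c.continuousOn
    refine (hasDerivAt_integral_of_dominated_loc_of_deriv_le (μ := volume)
      (F := fun ε x => f (u x + ε • h x) - f c)
      (F' := fun ε x => fderiv ℝ f (u x + ε • h x) (h x))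
      (bound := (tsupport h).indicator fun _ => C)
      (Metric.ball_mem_nhds (0 : ℝ) one_pos) ?_ ?_ ?_ ?_ ?_ ?_).2
    · exact Eventually.of_forall fun ε =>
        (by fun_prop : Continuous fun x => f (u x + ε • h x) - f c).aestronglyMeasurable
    · refine Continuous.integrable_of_hasCompactSupport (by fun_prop) ?_
      refine HasCompactSupport.intro hc.isCompact fun x hx => ?_
      have : u x - c = 0 :=
        image_eq_zero_of_notMem_tsupport (f := fun x => u x - c) hx
      simp [sub_eq_zero.mp this]
    · exact (by fun_prop :
        Continuous fun x => fderiv ℝ f (u x + (0 : ℝ) • h x) (h x)).aestronglyMeasurable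
    · refine Eventually.of_forall fun x ε hε => ?_
      by_cases hx : x ∈ tsupport h
      · rw [Set.indicator_of_mem hx]
        exact hC (ε, x) ⟨Metric.ball_subset_closedBall hε, hx⟩
      · rw [Set.indicator_of_notMem hx, image_eq_zero_of_notMem_tsupport hx]
        simp
    · refine (integrable_indicator_iff (isClosed_tsupport h).measurableSet).2 ?_
      exact integrableOn_const hh.compact.isCompact.measure_lt_top.ne
    · refine Eventually.of_forall fun x ε _ => ?_
      have h1 : HasDerivAt (fun ε : ℝ => u x + ε • h x) (h x) ε := by
        simpa using ((hasDerivAt_id ε).smul_const (h x)).const_add (u x)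
      have h2 : HasFDerivAt f (fderiv ℝ f (u x + ε • h x)) (u x + ε • h x) :=
        ((hf.differentiable (by simp)) _).hasFDerivAt
      exact (h2.comp_hasDerivAt ε h1).sub_const (f c)
  smooth := by
    intro u h k hu hh hk x
    have h1 : ContDiff ℝ ∞ (fun q : (ℝ × ℝ) × ℝ => u q.2 + q.1.1 • h q.2 + q.1.2 • k q.2) :=
      ((hu.smooth.comp contDiff_snd).add
        ((contDiff_fst.comp contDiff_fst).smul (hh.smooth.comp contDiff_snd))).add
        ((contDiff_snd.comp contDiff_fst).smul (hk.smooth.comp contDiff_snd))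
    have h2 : ContDiff ℝ ∞ (fderiv ℝ f) := hf.fderiv_right (by simp)
    refine ContDiff.contDiffAt (contDiff_pi.2 fun i => ?_)
    exact (h2.comp h1).clm_apply contDiff_const
  const_at_infinity := by
    intro u h k hu hh hk
    obtain ⟨c, hc⟩ := hu.background
    have key : ∀ w : ℝ → Fin N → ℝ, HasCompactSupport w →
        ∃ R : ℝ, ∀ x, R ≤ |x| → w x = 0 := by
      intro w hw
      obtain ⟨R, hR⟩ := hw.isCompact.isBounded.exists_norm_le
      refine ⟨R + 1, fun x hx => image_eq_zero_of_notMem_tsupport fun hx' => ?_⟩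
      have := hR x hx'
      rw [Real.norm_eq_abs] at this
      linarith
    obtain ⟨R₁, hR₁⟩ := key _ hc
    obtain ⟨R₂, hR₂⟩ := key _ hh.compact
    obtain ⟨R₃, hR₃⟩ := key _ hk.compact
    refine ⟨max R₁ (max R₂ R₃), Eventually.of_forall fun p x y hx hy => ?_⟩
    have hfar : ∀ z, max R₁ (max R₂ R₃) ≤ |z| → (u + p.1 • h + p.2 • k) z = c := by
      intro z hz
      simp only [max_le_iff] at hz
      have e1 : u z = c := sub_eq_zero.mp (hR₁ z hz.1)
      simp [e1, hR₂ z hz.2.1, hR₃ z hz.2.2]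
    funext i
    simp only [hfar x hx, hfar y hy]

/-- The functional `U^i = ∫ u^i(x) dx`. -/
def coordFunctional {N : ℕ} (U : Set (Fin N → ℝ)) (i : Fin N) : Functional U :=
  ofDensity U (fun p => p i) (contDiff_apply ℝ ℝ i)

/-- The functional `∫ m_{ij} u^i(x) u^j(x) dx`. -/
def quadFunctional {N : ℕ} (U : Set (Fin N → ℝ)) (m : Matrix (Fin N) (Fin N) ℝ) :
    Functional U :=
  ofDensity U (fun p => ∑ i, ∑ j, m i j * p i * p j) (by fun_prop)

end HydroBracket

end

/-! Both sides of the equivalence come down to the same two identities for the coefficients.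

Let `bil` be the form ∫ a_i P^{ij} b_j dx on test functions and `tau` its derivative when the field
moves in a direction h. In the Jacobi sum the second variations of the functionals cancel, by their
symmetry and the skewness of P. What remains is the cyclic sum of `tau` of (a, b) along P c
(`jacobi_iff`). Linear functionals realise every test function as a variational derivative, so
nothing is lost. The constant operator has zero variation, so for αP + βη the sum is α(α jac(P, P) +
β jac(P, η)). Compatibility therefore means that jac(P, η), where P is varied along η c_x, vanishes
identically (`compatible_const_iff`).

Skewness of P, tested on small bumps, gives ∂_k g^{ij} = b^{ij}_k + b^{ji}_k without any condition
on det g (`fderiv_g_eq`). Integration by parts (`tau_eq`) splits `tau` into a local part in g and b,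
a curvature part and nonlocal terms. The nonlocal terms cancel in the cyclic sum because η is
symmetric. Hence jac(P, η) = 0 holds exactly when ∂_l b^{ij}_k - ∂_k b^{ij}_l + K(δ^i_k δ^j_l -
δ^i_l δ^j_k) = 0 and η^{ls} b^{ji}_l is symmetric in j and s (`curv_eq_zero`, `symmCond_of_jac`,
`jac_const_eq_zero`).

On the involution side (d/dx)⁻¹ meets only total derivatives, so {U^i, U^j} and, up to a factor 2,
{U^i, U^{N+1}} are integrals of 1-forms along the field. A field has equal ends and so traces a
loop. On a simply connected U these integrals vanish for all fields exactly when the forms are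
closed (`formInt_eq_zero`, `closedForm_of_formInt_eq_zero`). Closedness of the first forms is the
curvature identity. Given it, closedness of the others is the symmetry of η_{kj} b^{ji}_l in k and
l, which is the second identity with indices lowered (`symmCond_iff`). -/

noncomputable section

namespace HydroBracket

/-! ### Integrals depending on a parameter -/

section ParametricIntegral

variable {H X : Type*} [NormedAddCommGroup H] [NormedSpace ℝ H] [FiniteDimensional ℝ H]
  [NormedAddCommGroup X] [NormedSpace ℝ X] [MeasureSpace X] [BorelSpace X]
  [IsFiniteMeasureOnCompacts (volume : Measure X)]

/-- Differentiation under the integral sign for a `C¹` family of functions with a common compact support,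
multiplied by a fixed bounded measurable weight. -/
theorem hasFDerivAt_integral_of_contDiffOn {O : Set H} (hO : IsOpen O) {p₀ : H} (hp₀ : p₀ ∈ O)
    {Φ : H → X → ℝ} (hΦ : ContDiffOn ℝ 1 (fun q : H × X => Φ q.1 q.2) (O ×ˢ Set.univ))
    {A : Set X} (hA : IsCompact A) (h0 : ∀ p ∈ O, ∀ x ∉ A, Φ p x = 0)
    {w : X → ℝ} (hw : Measurable w) (hw1 : ∀ x, |w x| ≤ 1) :
    Integrable (fun x => w x • fderiv ℝ (fun p => Φ p x) p₀) ∧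
    HasFDerivAt (fun p => ∫ x, w x * Φ p x) (∫ x, w x • fderiv ℝ (fun p => Φ p x) p₀) p₀ := by
  have hOX : IsOpen (O ×ˢ (Set.univ : Set X)) := hO.prod isOpen_univ
  set F : H × X → ℝ := fun q => Φ q.1 q.2 with hF
  have hFd : ∀ p ∈ O, ∀ x, HasFDerivAt F (fderiv ℝ F (p, x)) (p, x) := fun p hp x =>
    ((hΦ.differentiableOn (by simp)).differentiableAt (hOX.mem_nhds ⟨hp, trivial⟩)).hasFDerivAt
  have hd : ∀ p ∈ O, ∀ x, HasFDerivAt (fun p => Φ p x)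
      ((fderiv ℝ F (p, x)).comp (ContinuousLinearMap.inl ℝ H X)) p := by
    intro p hp x
    exact HasFDerivAt.comp (g := F) (f := fun p => (p, x)) p (hFd p hp x)
      (hasFDerivAt_prodMk_left p x)
  have hcont : ContinuousOn (fun q : H × X =>
      (fderiv ℝ F q).comp (ContinuousLinearMap.inl ℝ H X)) (O ×ˢ Set.univ) :=
    (hΦ.continuousOn_fderiv_of_isOpen hOX (by simp)).clm_comp continuousOn_const
  have hzero : ∀ p ∈ O, ∀ x ∉ A, (fderiv ℝ F (p, x)).comp (ContinuousLinearMap.inl ℝ H X) = 0 := by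
    intro p hp x hx
    rw [← (hd p hp x).fderiv]
    have : (fun p => Φ p x) =ᶠ[𝓝 p] fun _ => 0 := by
      filter_upwards [hO.mem_nhds hp] with q hq using h0 q hq x hx
    rw [this.fderiv_eq]; simp
  obtain ⟨r, hr, hrO⟩ := Metric.isOpen_iff.1 hO p₀ hp₀
  have hball : Metric.closedBall p₀ (r / 2) ⊆ O :=
    (Metric.closedBall_subset_ball (by linarith)).trans hrO
  -- Halving the radius keeps the closed ball inside `O`. The constant `C` on `A` is the dominating
  -- function.
  obtain ⟨C, hC⟩ := ((isCompact_closedBall p₀ (r / 2)).prod hA).exists_bound_of_continuousOn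
    (hcont.mono (Set.prod_mono hball (Set.subset_univ _)))
  have hsl : ∀ p ∈ O, Continuous (fun x => Φ p x) := by
    intro p hp
    have h1 : ContinuousOn (fun x : X => F (p, x)) Set.univ :=
      hΦ.continuousOn.comp (by fun_prop) (fun x _ => ⟨hp, trivial⟩)
    exact continuousOn_univ.1 h1
  have hsl' : Continuous (fun x => fderiv ℝ (fun p => Φ p x) p₀) := by
    have h1 : ContinuousOn (fun x : X => (fderiv ℝ F (p₀, x)).comp
      (ContinuousLinearMap.inl ℝ H X)) Set.univ :=
      hcont.comp (f := fun x : X => (p₀, x)) (by fun_prop) (fun x _ => ⟨hp₀, trivial⟩)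
    refine (continuousOn_univ.1 h1).congr fun x => ?_
    rw [(hd p₀ hp₀ x).fderiv]
  have hbd : ∀ x, ∀ p ∈ Metric.ball p₀ (r / 2),
      ‖w x • fderiv ℝ (fun p => Φ p x) p‖ ≤ A.indicator (fun _ => C) x := by
    intro x p hp
    have hpO := hball (Metric.ball_subset_closedBall hp)
    rw [(hd p hpO x).fderiv, norm_smul]
    by_cases hx : x ∈ A
    · rw [Set.indicator_of_mem hx]
      calc _ ≤ 1 * _ := mul_le_mul_of_nonneg_right (hw1 x) (norm_nonneg _)
        _ ≤ C := by rw [one_mul]; exact hC (p, x) ⟨Metric.ball_subset_closedBall hp, hx⟩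
    · rw [Set.indicator_of_notMem hx, hzero p hpO x hx]; simp
  have hbi : Integrable (A.indicator (fun _ => C)) :=
    (integrable_indicator_iff hA.measurableSet).2 (integrableOn_const hA.measure_lt_top.ne)
  have hmeas : AEStronglyMeasurable (fun x => w x • fderiv ℝ (fun p => Φ p x) p₀) :=
    hw.aestronglyMeasurable.smul hsl'.aestronglyMeasurable
  have hint : ∀ p ∈ O, Integrable (fun x => w x * Φ p x) := fun p hp => by
    have h1 : Integrable (fun x => Φ p x) := (hsl p hp).integrable_of_hasCompactSupport
      (HasCompactSupport.intro hA fun x hx => h0 p hp x hx)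
    exact h1.bdd_mul hw.aestronglyMeasurable (Eventually.of_forall hw1)
  refine ⟨hbi.mono' hmeas (Eventually.of_forall fun x =>
    hbd x p₀ (Metric.mem_ball_self (by linarith))), ?_⟩
  refine hasFDerivAt_integral_of_dominated_of_fderiv_le (bound := A.indicator (fun _ => C))
    (F' := fun p x => w x • fderiv ℝ (fun p => Φ p x) p)
    (Metric.ball_mem_nhds p₀ (by linarith : 0 < r / 2)) ?_ (hint p₀ hp₀) hmeas
    (Eventually.of_forall hbd) hbi ?_
  · filter_upwards [hO.mem_nhds hp₀] with p hp
    exact (hint p hp).aestronglyMeasurable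
  · refine Eventually.of_forall fun x p hp => ?_
    have hpO := hball (Metric.ball_subset_closedBall hp)
    have h := (hd p hpO x).const_mul (w x)
    rwa [← (hd p hpO x).fderiv] at h

/-- Used with `X = ℝ` and weight 1 for local densities, and with `X = ℝ × ℝ` and weight sign(x - y)
for the nonlocal term. -/
theorem hasDerivAt_integral_of_contDiffOn {O : Set ℝ} (hO : IsOpen O) {t₀ : ℝ} (ht₀ : t₀ ∈ O)
    {Φ : ℝ → X → ℝ} (hΦ : ContDiffOn ℝ 1 (fun q : ℝ × X => Φ q.1 q.2) (O ×ˢ Set.univ))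
    {A : Set X} (hA : IsCompact A) (h0 : ∀ p ∈ O, ∀ x ∉ A, Φ p x = 0)
    {w : X → ℝ} (hw : Measurable w) (hw1 : ∀ x, |w x| ≤ 1)
    {Φ' : X → ℝ} (hΦ' : ∀ x, HasDerivAt (fun t => Φ t x) (Φ' x) t₀) :
    HasDerivAt (fun t => ∫ x, w x * Φ t x) (∫ x, w x * Φ' x) t₀ := by
  obtain ⟨h1, h2⟩ := hasFDerivAt_integral_of_contDiffOn hO ht₀ hΦ hA h0 hw hw1
  have h3 := h2.hasDerivAt
  rw [ContinuousLinearMap.integral_apply h1] at h3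
  have h4 : ∀ x, fderiv ℝ (fun t => Φ t x) t₀ 1 = Φ' x := fun x => (hΦ' x).deriv
  simpa [h4] using h3

end ParametricIntegral

/-! ### The skew-symmetric inverse of the derivative -/

/-- Continuous functions of one variable with compact support. -/
structure CC (f : ℝ → ℝ) : Prop where
  cont : Continuous f
  supp : HasCompactSupport f

theorem CC.integrable {f : ℝ → ℝ} (hf : CC f) : Integrable f :=
  hf.cont.integrable_of_hasCompactSupport hf.supp

theorem CC.add {f g : ℝ → ℝ} (hf : CC f) (hg : CC g) : CC (fun x => f x + g x) :=
  ⟨hf.cont.add hg.cont, hf.supp.add hg.supp⟩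

theorem CC.mul_left {f g : ℝ → ℝ} (hf : Continuous f) (hg : CC g) : CC (fun x => f x * g x) :=
  ⟨hf.mul hg.cont, hg.supp.mul_left⟩

theorem CC.mul_right {f g : ℝ → ℝ} (hf : CC f) (hg : Continuous g) : CC (fun x => f x * g x) :=
  ⟨hf.cont.mul hg, hf.supp.mul_right⟩

theorem CC.zero : CC (fun _ => 0) := ⟨continuous_const, HasCompactSupport.zero⟩

theorem CC.sub {f g : ℝ → ℝ} (hf : CC f) (hg : CC g) : CC (fun x => f x - g x) :=
  ⟨hf.cont.sub hg.cont, hf.supp.sub hg.supp⟩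

theorem CC.const_mul {f : ℝ → ℝ} (c : ℝ) (hf : CC f) : CC (fun x => c * f x) :=
  CC.mul_left continuous_const hf

theorem CC.sum {ι : Type*} (s : Finset ι) {f : ι → ℝ → ℝ} (hf : ∀ i ∈ s, CC (f i)) :
    CC (fun x => ∑ i ∈ s, f i x) := by
  classical
  induction s using Finset.induction_on with
  | empty => simpa using CC.zero
  | insert i s hi ih =>
    simp only [Finset.sum_insert hi]
    exact (hf i (Finset.mem_insert_self i s)).add
      (ih fun j hj => hf j (Finset.mem_insert_of_mem hj))

theorem CC.deriv {f : ℝ → ℝ} (hf : ContDiff ℝ 1 f) (hs : HasCompactSupport f) : CC (deriv f) :=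
  ⟨hf.continuous_deriv (by simp), hs.deriv⟩

/-- The pairing `∫ f (d/dx)⁻¹ g`. -/
def nl (f g : ℝ → ℝ) : ℝ := ∫ x, f x * invD g x

/-- A bounded kernel makes Fubini and differentiation under the integral available for the nonlocal
operator. -/
theorem invD_eq_integral_sign {g : ℝ → ℝ} (hg : Integrable g) (x : ℝ) :
    invD g x = (1 / 2) * ∫ y, Real.sign (x - y) * g y := by
  -- Since `Real.sign 0 = 0`, the half-line has to be open for the integrands to agree at y = x as
  -- well.
  have h1 : (∫ y in Set.Iic x, g y) = ∫ y in Set.Iio x, g y := integral_Iic_eq_integral_Iio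
  rw [invD, h1, ← integral_indicator measurableSet_Iio, ← integral_indicator measurableSet_Ioi,
    ← integral_sub (hg.indicator measurableSet_Iio) (hg.indicator measurableSet_Ioi)]
  congr 1
  refine integral_congr_ae (Eventually.of_forall fun y => ?_)
  rcases lt_trichotomy y x with h | h | h
  · have h2 : Real.sign (x - y) = 1 := Real.sign_of_pos (by linarith)
    simp [Set.indicator, h, h.not_gt, h2]
  · simp [Set.indicator, h]
  · have h2 : Real.sign (x - y) = -1 := Real.sign_of_neg (by linarith)
    simp [Set.indicator, h, h.not_gt, h2]

theorem measurable_sign_sub : Measurable (fun q : ℝ × ℝ => Real.sign (q.1 - q.2)) := by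
  have : Measurable Real.sign := by
    unfold Real.sign
    exact Measurable.ite measurableSet_Iio measurable_const
      (Measurable.ite measurableSet_Ioi measurable_const measurable_const)
  exact this.comp (measurable_fst.sub measurable_snd)

theorem abs_sign_le_one (r : ℝ) : |Real.sign r| ≤ 1 := by
  rcases Real.sign_apply_eq r with h | h | h <;> simp [h]

theorem nl_eq_integral_prod {f g : ℝ → ℝ} (hf : CC f) (hg : CC g) :
    nl f g = (1 / 2) * ∫ q : ℝ × ℝ, Real.sign (q.1 - q.2) * (f q.1 * g q.2) := by
  have hi : Integrable (fun q : ℝ × ℝ => Real.sign (q.1 - q.2) * (f q.1 * g q.2)) :=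
    (hf.integrable.mul_prod hg.integrable).bdd_mul
      measurable_sign_sub.aestronglyMeasurable (Eventually.of_forall fun q => abs_sign_le_one _)
  have h1 := integral_prod _ hi
  rw [show (volume : Measure (ℝ × ℝ)) = (volume : Measure ℝ).prod volume from rfl, h1, nl,
    ← integral_const_mul]
  refine integral_congr_ae (Eventually.of_forall fun x => ?_)
  simp only
  rw [invD_eq_integral_sign hg.integrable, ← mul_assoc, mul_comm (f x), mul_assoc,
    ← integral_const_mul]
  congr 2
  funext y
  ring

/-- The kernel sign(x - y) is odd under the exchange of x and y. -/
theorem nl_antisymm {f g : ℝ → ℝ} (hf : CC f) (hg : CC g) : nl f g = - nl g f := by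
  rw [nl_eq_integral_prod hf hg, nl_eq_integral_prod hg hf, ← mul_neg, ← integral_neg]
  congr 1
  rw [show (volume : Measure (ℝ × ℝ)) = (volume : Measure ℝ).prod volume from rfl,
    ← integral_prod_swap]
  refine integral_congr_ae (Eventually.of_forall fun q => ?_)
  simp only [Prod.fst_swap, Prod.snd_swap]
  rw [← neg_sub q.1 q.2, Real.sign_neg]
  ring

theorem hasDerivAt_invD {f : ℝ → ℝ} (hf : CC f) (x : ℝ) : HasDerivAt (invD f) (f x) x := by
  have h : ∀ z, invD f z = (∫ y in (0 : ℝ)..z, f y) + invD f 0 := by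
    intro z
    have h1 := intervalIntegral.integral_Iic_sub_Iic
      (hf.integrable.integrableOn (s := Set.Iic 0)) (hf.integrable.integrableOn (s := Set.Iic z))
    have h2 := intervalIntegral.integral_Iic_add_Ioi
      (hf.integrable.integrableOn (s := Set.Iic z)) (hf.integrable.integrableOn (s := Set.Ioi z))
    have h3 := intervalIntegral.integral_Iic_add_Ioi
      (hf.integrable.integrableOn (s := Set.Iic 0)) (hf.integrable.integrableOn (s := Set.Ioi 0))
    unfold invD
    linarith
  have h1 : HasDerivAt (fun z => (∫ y in (0 : ℝ)..z, f y) + invD f 0) (f x) x :=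
    (intervalIntegral.integral_hasDerivAt_right (hf.cont.intervalIntegrable _ _)
      hf.cont.stronglyMeasurable.stronglyMeasurableAtFilter hf.cont.continuousAt).add_const _
  exact h1.congr_of_eventuallyEq (Eventually.of_forall h)

theorem CC.contDiff_invD {f : ℝ → ℝ} (hf : CC f) (hs : ContDiff ℝ ∞ f) :
    ContDiff ℝ ∞ (invD f) := by
  rw [contDiff_infty_iff_deriv]
  refine ⟨fun x => (hasDerivAt_invD hf x).differentiableAt, ?_⟩
  rwa [show _root_.deriv (invD f) = f from funext fun x => (hasDerivAt_invD hf x).deriv]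

theorem CC.continuous_invD {f : ℝ → ℝ} (hf : CC f) : Continuous (invD f) :=
  continuous_iff_continuousAt.2 fun x => (hasDerivAt_invD hf x).continuousAt

/-- The two half-line integrals of f' are f(x) and -f(x). Compact support of f matters: a constant
background would be lost. -/
theorem invD_deriv {f : ℝ → ℝ} (hf : ContDiff ℝ 1 f) (hs : HasCompactSupport f) (x : ℝ) :
    invD (_root_.deriv f) x = f x := by
  rw [invD, hs.integral_Iic_deriv_eq hf, hs.integral_Ioi_deriv_eq hf]
  ring

theorem invD_const_mul (c : ℝ) (f : ℝ → ℝ) (x : ℝ) :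
    invD (fun y => c * f y) x = c * invD f x := by
  unfold invD
  rw [integral_const_mul, integral_const_mul]
  ring

theorem nl_integrable {f g : ℝ → ℝ} (hf : CC f) (hg : CC g) :
    Integrable (fun x => f x * invD g x) :=
  (hf.mul_right hg.continuous_invD).integrable

theorem nl_add_left {f f' g : ℝ → ℝ} (hf : CC f) (hf' : CC f') (hg : CC g) :
    nl (fun x => f x + f' x) g = nl f g + nl f' g := by
  unfold nl
  rw [← integral_add (nl_integrable hf hg) (nl_integrable hf' hg)]
  simp only [add_mul]

theorem nl_const_mul_left (c : ℝ) (f g : ℝ → ℝ) :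
    nl (fun x => c * f x) g = c * nl f g := by
  unfold nl
  rw [← integral_const_mul]
  simp only [mul_assoc]

theorem nl_add_right {f g g' : ℝ → ℝ} (hf : CC f) (hg : CC g) (hg' : CC g') :
    nl f (fun x => g x + g' x) = nl f g + nl f g' := by
  rw [nl_antisymm hf (hg.add hg'), nl_add_left hg hg' hf, nl_antisymm hf hg, nl_antisymm hf hg']
  ring

theorem nl_const_mul_right (c : ℝ) (f g : ℝ → ℝ) :
    nl f (fun x => c * g x) = c * nl f g := by
  unfold nl
  rw [← integral_const_mul]
  simp only [invD_const_mul]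
  congr 1; funext x; ring

theorem nl_deriv_right (f : ℝ → ℝ) {e : ℝ → ℝ} (he : ContDiff ℝ 1 e)
    (hs : HasCompactSupport e) : nl f (_root_.deriv e) = ∫ x, f x * e x := by
  simp only [nl, invD_deriv he hs]

theorem integral_deriv_eq_zero {e : ℝ → ℝ} (he : ContDiff ℝ 1 e) (hs : HasCompactSupport e) :
    ∫ x, _root_.deriv e x = 0 := by
  have h2 := intervalIntegral.integral_Iic_add_Ioi (b := 0)
      ((CC.deriv he hs).integrable.integrableOn) ((CC.deriv he hs).integrable.integrableOn)
  rw [hs.integral_Iic_deriv_eq he, hs.integral_Ioi_deriv_eq he] at h2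
  linarith

/-- Differentiation of `∫ f (d/dx)⁻¹ g` along smooth families with a common compact support. -/
theorem hasDerivAt_nl {O : Set ℝ} (hO : IsOpen O) {t₀ : ℝ} (ht₀ : t₀ ∈ O) {f g : ℝ → ℝ → ℝ}
    (hf : ContDiffOn ℝ 1 (fun q : ℝ × ℝ => f q.1 q.2) (O ×ˢ Set.univ))
    (hg : ContDiffOn ℝ 1 (fun q : ℝ × ℝ => g q.1 q.2) (O ×ˢ Set.univ))
    {A : Set ℝ} (hA : IsCompact A) (hf0 : ∀ t ∈ O, ∀ x ∉ A, f t x = 0)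
    (hg0 : ∀ t ∈ O, ∀ x ∉ A, g t x = 0) {f' g' : ℝ → ℝ} (hcf : CC f') (hcg : CC g')
    (hf' : ∀ x, HasDerivAt (fun t => f t x) (f' x) t₀)
    (hg' : ∀ x, HasDerivAt (fun t => g t x) (g' x) t₀) :
    HasDerivAt (fun t => nl (f t) (g t)) (nl f' (g t₀) + nl (f t₀) g') t₀ := by
  have hCC : ∀ {k : ℝ → ℝ → ℝ}, ContDiffOn ℝ 1 (fun q : ℝ × ℝ => k q.1 q.2) (O ×ˢ Set.univ) →
      (∀ t ∈ O, ∀ x ∉ A, k t x = 0) → ∀ t ∈ O, CC (k t) := by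
    intro k hk hk0 t ht
    refine ⟨continuousOn_univ.1 (hk.continuousOn.comp (f := fun x : ℝ => (t, x)) (by fun_prop)
      fun x _ => ⟨ht, trivial⟩), HasCompactSupport.intro hA fun x hx => hk0 t ht x hx⟩
  have hi : ∀ {f g : ℝ → ℝ}, CC f → CC g →
      Integrable (fun q : ℝ × ℝ => Real.sign (q.1 - q.2) * (f q.1 * g q.2)) := fun hf hg =>
    (hf.integrable.mul_prod hg.integrable).bdd_mul
      measurable_sign_sub.aestronglyMeasurable (Eventually.of_forall fun q => abs_sign_le_one _)
  -- The pairing is a double integral over `A ×ˢ A` with the kernel as weight, so the product rule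
  -- is applied under one integral sign.
  have h1 := hasDerivAt_integral_of_contDiffOn (X := ℝ × ℝ) (t₀ := t₀) hO ht₀
    (Φ := fun t q => f t q.1 * g t q.2) (w := fun q => Real.sign (q.1 - q.2))
    (A := A ×ˢ A) (Φ' := fun q => f' q.1 * g t₀ q.2 + f t₀ q.1 * g' q.2)
    ((hf.comp (f := fun q : ℝ × (ℝ × ℝ) => (q.1, q.2.1)) (by fun_prop)
      (fun q hq => ⟨hq.1, trivial⟩)).mul
     (hg.comp (f := fun q : ℝ × (ℝ × ℝ) => (q.1, q.2.2)) (by fun_prop)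
      (fun q hq => ⟨hq.1, trivial⟩)))
    (hA.prod hA) (by
      rintro t ht ⟨x, y⟩ hxy
      rw [Set.mem_prod, not_and_or] at hxy
      rcases hxy with h | h
      · simp [hf0 t ht x h]
      · simp [hg0 t ht y h]) measurable_sign_sub (fun q => abs_sign_le_one _)
      (fun q => (hf' q.1).mul (hg' q.2))
  have h2 := h1.const_mul (1 / 2 : ℝ)
  have hft := hCC hf hf0 t₀ ht₀
  have hgt := hCC hg hg0 t₀ ht₀
  have h3 : nl f' (g t₀) + nl (f t₀) g' = (1 / 2) * ∫ q : ℝ × ℝ,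
      Real.sign (q.1 - q.2) * (f' q.1 * g t₀ q.2 + f t₀ q.1 * g' q.2) := by
    rw [nl_eq_integral_prod hcf hgt, nl_eq_integral_prod hft hcg, ← mul_add,
      ← integral_add (hi hcf hgt) (hi hft hcg)]
    simp only [mul_add]
  rw [h3]
  refine h2.congr_of_eventuallyEq ?_
  filter_upwards [hO.mem_nhds ht₀] with t ht
  exact nl_eq_integral_prod (hCC hf hf0 t ht) (hCC hg hg0 t ht)

variable {N : ℕ}

/-! ### Test functions -/

/-- The componentwise derivative. -/
def dd (a : ℝ → Fin N → ℝ) (x : ℝ) (i : Fin N) : ℝ := deriv (fun y => a y i) x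

/-- The pointwise pairing. -/
def dot (f g : ℝ → Fin N → ℝ) (x : ℝ) : ℝ := ∑ i, f x i * g x i

/-- Smooth functions with the same constant value near both ends of the line. -/
structure IsTest (a : ℝ → Fin N → ℝ) : Prop where
  smooth : ContDiff ℝ ∞ a
  const : ∃ R : ℝ, ∀ x y, R ≤ |x| → R ≤ |y| → a x = a y

theorem IsTest.comp {a : ℝ → Fin N → ℝ} (ha : IsTest a) (i : Fin N) :
    ContDiff ℝ ∞ (fun x => a x i) := contDiff_pi.1 ha.smooth i

theorem IsTest.continuous {a : ℝ → Fin N → ℝ} (ha : IsTest a) (i : Fin N) :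
    Continuous (fun x => a x i) := (ha.comp i).continuous

theorem exists_eq_zero_of_hasCompactSupport {E : Type*} [Zero E] {w : ℝ → E}
    (hw : HasCompactSupport w) : ∃ R : ℝ, ∀ x, R ≤ |x| → w x = 0 := by
  obtain ⟨R, hR⟩ := hw.isCompact.isBounded.exists_norm_le
  refine ⟨R + 1, fun x hx => image_eq_zero_of_notMem_tsupport fun hx' => ?_⟩
  have := hR x hx'
  rw [Real.norm_eq_abs] at this
  linarith

theorem hasCompactSupport_of_abs {E : Type*} [Zero E] {w : ℝ → E} {R : ℝ}
    (h : ∀ x, R < |x| → w x = 0) : HasCompactSupport w := by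
  refine HasCompactSupport.intro (isCompact_Icc (a := -R) (b := R)) fun x hx => h x ?_
  by_contra hn
  exact hx (abs_le.1 (not_lt.1 hn))

theorem IsVariation.isTest {h : ℝ → Fin N → ℝ} (hh : IsVariation h) : IsTest h := by
  obtain ⟨R, hR⟩ := exists_eq_zero_of_hasCompactSupport hh.compact
  exact ⟨hh.smooth, R, fun x y hx hy => by rw [hR x hx, hR y hy]⟩

theorem IsField.isTest {U : Set (Fin N → ℝ)} {u : ℝ → Fin N → ℝ} (hu : IsField U u) :
    IsTest u := by
  obtain ⟨c, hc⟩ := hu.background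
  obtain ⟨R, hR⟩ := exists_eq_zero_of_hasCompactSupport hc
  exact ⟨hu.smooth, R, fun x y hx hy => by rw [sub_eq_zero.1 (hR x hx), sub_eq_zero.1 (hR y hy)]⟩

theorem IsTest.exists_background {a : ℝ → Fin N → ℝ} (ha : IsTest a) :
    ∃ c : Fin N → ℝ, HasCompactSupport (fun x => a x - c) := by
  obtain ⟨R, hR⟩ := ha.const
  -- The absolute value yields a point in the constant region even if `R` is negative.
  refine ⟨a (|R|), hasCompactSupport_of_abs (R := R) fun x hx => ?_⟩
  rw [hR x (|R|) hx.le (by rw [abs_abs]; exact le_abs_self R), sub_self]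

theorem IsTest.isField {U : Set (Fin N → ℝ)} {u : ℝ → Fin N → ℝ} (hu : IsTest u)
    (hU : ∀ x, u x ∈ U) : IsField U u := ⟨hu.smooth, hU, hu.exists_background⟩

theorem isTest_const (c : Fin N → ℝ) : IsTest (fun _ : ℝ => c) :=
  ⟨contDiff_const, 0, fun _ _ _ _ => rfl⟩

theorem dd_eq_zero_of_const {a : ℝ → Fin N → ℝ} {R : ℝ}
    (h : ∀ x y, R ≤ |x| → R ≤ |y| → a x = a y) {x : ℝ} (hx : R < |x|) : dd a x = 0 := by
  funext i
  have : (fun y => a y i) =ᶠ[𝓝 x] fun _ => a x i := by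
    -- The strict inequality is an open condition, so `a` is constant near `x` and not only at `x`.
    have h1 : ∀ᶠ y in 𝓝 x, R < |y| := continuous_abs.continuousAt.eventually (lt_mem_nhds hx)
    filter_upwards [h1] with y hy
    rw [h y x hy.le hx.le]
  simp [dd, this.deriv_eq]

theorem contDiff_dd {a : ℝ → Fin N → ℝ} (ha : ContDiff ℝ ∞ a) : ContDiff ℝ ∞ (dd a) :=
  contDiff_pi.2 fun i => (contDiff_infty_iff_deriv.1 (contDiff_pi.1 ha i)).2

theorem IsTest.isVariation_dd {a : ℝ → Fin N → ℝ} (ha : IsTest a) : IsVariation (dd a) := by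
  obtain ⟨R, hR⟩ := ha.const
  exact ⟨contDiff_dd ha.smooth, hasCompactSupport_of_abs fun x hx => dd_eq_zero_of_const hR hx⟩

theorem IsVariation.cc {h : ℝ → Fin N → ℝ} (hh : IsVariation h) (i : Fin N) :
    CC (fun x => h x i) :=
  ⟨hh.isTest.continuous i, hh.compact.comp_left (g := fun v : Fin N → ℝ => v i) rfl⟩

theorem IsTest.cc_dd {a : ℝ → Fin N → ℝ} (ha : IsTest a) (i : Fin N) :
    CC (fun x => dd a x i) := ha.isVariation_dd.cc i

theorem cc_dot_left {h a : ℝ → Fin N → ℝ} (hh : IsVariation h) (ha : IsTest a) :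
    CC (dot h a) := CC.sum _ fun i _ => (hh.cc i).mul_right (ha.continuous i)

theorem dot_comm (f g : ℝ → Fin N → ℝ) : dot f g = dot g f := by
  funext x; simp only [dot, mul_comm]

theorem dd_const (c : Fin N → ℝ) : dd (fun _ : ℝ => c) = 0 := by
  funext x i; simp [dd]

/-! ### The bilinear form of the operator and its variation -/

namespace Coeffs

/-- The bilinear form `∫ a_i P^{ij} b_j dx`. -/
def bil (P : Coeffs N) (u a b : ℝ → Fin N → ℝ) : ℝ := ∫ x, dot a (P.apply u b) x

/-- The local part of the integrand of `bil`. -/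
def loc (P : Coeffs N) (u a b : ℝ → Fin N → ℝ) (x : ℝ) : ℝ :=
  ∑ i, ∑ j, (P.g (u x) i j * (a x i * dd b x j)
    + ∑ k, P.b (u x) i j k * (dd u x k * (a x i * b x j)))

/-- The local part of the variation of `bil` in the direction `h` of the field. -/
def tauLoc (P : Coeffs N) (u h a b : ℝ → Fin N → ℝ) (x : ℝ) : ℝ :=
  ∑ i, ∑ j, (fderiv ℝ (fun p => P.g p i j) (u x) (h x) * (a x i * dd b x j)
    + ∑ k, (fderiv ℝ (fun p => P.b p i j k) (u x) (h x) * (dd u x k * (a x i * b x j))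
      + P.b (u x) i j k * (dd h x k * (a x i * b x j))))

/-- The variation of `bil P u a b` in the direction `h` of the field. -/
def tau (P : Coeffs N) (u h a b : ℝ → Fin N → ℝ) : ℝ :=
  (∫ x, P.tauLoc u h a b x) + P.K * (nl (dot (dd h) a) (dot (dd u) b)
    + nl (dot (dd u) a) (dot (dd h) b))

end Coeffs

section

variable {U : Set (Fin N → ℝ)} {P : Coeffs N}

theorem Coeffs.SmoothOn.continuous_g (hP : P.SmoothOn U) {u : ℝ → Fin N → ℝ} (hu : IsField U u)
    (i j : Fin N) : Continuous (fun x => P.g (u x) i j) :=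
  continuousOn_univ.1 ((hP.g i j).continuousOn.comp hu.smooth.continuous.continuousOn
    fun x _ => hu.mem x)

theorem Coeffs.SmoothOn.continuous_b (hP : P.SmoothOn U) {u : ℝ → Fin N → ℝ} (hu : IsField U u)
    (i j k : Fin N) : Continuous (fun x => P.b (u x) i j k) :=
  continuousOn_univ.1 ((hP.b i j k).continuousOn.comp hu.smooth.continuous.continuousOn
    fun x _ => hu.mem x)

theorem contDiff_comp_field {g : (Fin N → ℝ) → ℝ} (hg : ContDiffOn ℝ ∞ g U)
    {u : ℝ → Fin N → ℝ} (hu : IsField U u) : ContDiff ℝ ∞ (fun x => g (u x)) :=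
  contDiffOn_univ.1 (hg.comp hu.smooth.contDiffOn fun x _ => hu.mem x)

theorem continuous_fderiv_field (hUo : IsOpen U) {g : (Fin N → ℝ) → ℝ} (hg : ContDiffOn ℝ ∞ g U)
    {u h : ℝ → Fin N → ℝ} (hu : IsField U u) (hh : Continuous h) :
    Continuous (fun x => fderiv ℝ g (u x) (h x)) := by
  have h1 : ContinuousOn (fderiv ℝ g) U := hg.continuousOn_fderiv_of_isOpen hUo (by simp)
  exact (continuousOn_univ.1 (h1.comp hu.smooth.continuous.continuousOn
    fun x _ => hu.mem x)).clm_apply hh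

/-- Test functions need not vanish at infinity. Compact support comes from the derivative of u or of
b present in each term. -/
theorem cc_loc (hP : P.SmoothOn U) {u a b : ℝ → Fin N → ℝ} (hu : IsField U u) (ha : IsTest a)
    (hb : IsTest b) : CC (P.loc u a b) :=
  CC.sum _ fun i _ => CC.sum _ fun j _ =>
    (CC.mul_left (hP.continuous_g hu i j) (CC.mul_left (ha.continuous i) (hb.cc_dd j))).add
      (CC.sum _ fun k _ => CC.mul_left (hP.continuous_b hu i j k)
        ((hu.isTest.cc_dd k).mul_right ((ha.continuous i).mul (hb.continuous j))))

theorem cc_tauLoc (hUo : IsOpen U) (hP : P.SmoothOn U) {u h a b : ℝ → Fin N → ℝ}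
    (hu : IsField U u) (hh : IsTest h) (ha : IsTest a) (hb : IsTest b) :
    CC (P.tauLoc u h a b) :=
  CC.sum _ fun i _ => CC.sum _ fun j _ =>
    (CC.mul_left (continuous_fderiv_field hUo (hP.g i j) hu hh.smooth.continuous)
      (CC.mul_left (ha.continuous i) (hb.cc_dd j))).add
      (CC.sum _ fun k _ => (CC.mul_left
        (continuous_fderiv_field hUo (hP.b i j k) hu hh.smooth.continuous)
        ((hu.isTest.cc_dd k).mul_right ((ha.continuous i).mul (hb.continuous j)))).add
        (CC.mul_left (hP.continuous_b hu i j k)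
        ((hh.cc_dd k).mul_right ((ha.continuous i).mul (hb.continuous j)))))

theorem dot_apply_eq (P : Coeffs N) (u a b : ℝ → Fin N → ℝ) (x : ℝ) :
    dot a (P.apply u b) x
      = P.loc u a b x + P.K * (dot (dd u) a x * invD (dot (dd u) b) x) := by
  have h1 : ∀ i, a x i * P.apply u b x i
      = (∑ j, (P.g (u x) i j * (a x i * dd b x j)
        + ∑ k, P.b (u x) i j k * (dd u x k * (a x i * b x j))))
        + P.K * ((dd u x i * a x i) * invD (dot (dd u) b) x) := by
    intro i
    have h2 : ∀ j, a x i * (P.g (u x) i j * dd b x j + ∑ k, P.b (u x) i j k * dd u x k * b x j)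
        = P.g (u x) i j * (a x i * dd b x j)
          + ∑ k, P.b (u x) i j k * (dd u x k * (a x i * b x j)) := by
      intro j
      rw [mul_add, Finset.mul_sum]
      refine congrArg₂ _ (by ring) (Finset.sum_congr rfl fun k _ => by ring)
    simp only [← h2, ← Finset.mul_sum]
    rw [Finset.sum_add_distrib]
    unfold Coeffs.apply dot dd
    ring
  unfold dot Coeffs.loc
  simp only [h1]
  rw [Finset.sum_add_distrib, ← Finset.mul_sum, ← Finset.sum_mul]
  rfl

theorem bil_eq (hP : P.SmoothOn U) {u a b : ℝ → Fin N → ℝ} (hu : IsField U u) (ha : IsTest a)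
    (hb : IsTest b) :
    P.bil u a b = (∫ x, P.loc u a b x) + P.K * nl (dot (dd u) a) (dot (dd u) b) := by
  have hua := cc_dot_left hu.isTest.isVariation_dd ha
  have hub := cc_dot_left hu.isTest.isVariation_dd hb
  unfold Coeffs.bil nl
  simp only [dot_apply_eq]
  rw [integral_add (cc_loc hP hu ha hb).integrable ((nl_integrable hua hub).const_mul _),
    integral_const_mul]

/-! ### Smooth families -/

/-- Smooth one-parameter families of functions, with their derivative at the parameter `0`. -/
structure Fam (O : Set ℝ) (f : ℝ → ℝ → ℝ) (f' : ℝ → ℝ) : Prop where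
  smooth : ContDiffOn ℝ ∞ (fun q : ℝ × ℝ => f q.1 q.2) (O ×ˢ Set.univ)
  deriv : ∀ x, HasDerivAt (fun t => f t x) (f' x) 0

namespace Fam

variable {O : Set ℝ} {f g : ℝ → ℝ → ℝ} {f' g' : ℝ → ℝ}

theorem add (hf : Fam O f f') (hg : Fam O g g') :
    Fam O (fun t x => f t x + g t x) (fun x => f' x + g' x) :=
  ⟨hf.smooth.add hg.smooth, fun x => (hf.deriv x).add (hg.deriv x)⟩

theorem mul (hf : Fam O f f') (hg : Fam O g g') :
    Fam O (fun t x => f t x * g t x) (fun x => f' x * g 0 x + f 0 x * g' x) :=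
  ⟨hf.smooth.mul hg.smooth, fun x => (hf.deriv x).mul (hg.deriv x)⟩

theorem sum {ι : Type*} (s : Finset ι) {f : ι → ℝ → ℝ → ℝ} {f' : ι → ℝ → ℝ}
    (hf : ∀ i ∈ s, Fam O (f i) (f' i)) :
    Fam O (fun t x => ∑ i ∈ s, f i t x) (fun x => ∑ i ∈ s, f' i x) :=
  ⟨ContDiffOn.sum fun i hi => (hf i hi).smooth,
    fun x => HasDerivAt.fun_sum fun i hi => (hf i hi).deriv x⟩

theorem mono {O' : Set ℝ} (hf : Fam O f f') (h : O' ⊆ O) : Fam O' f f' :=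
  ⟨hf.smooth.mono (Set.prod_mono h subset_rfl), hf.deriv⟩

theorem slice (hf : Fam O f f') {t : ℝ} (ht : t ∈ O) : ContDiff ℝ ∞ (f t) :=
  contDiffOn_univ.1 (hf.smooth.comp (f := fun x : ℝ => (t, x)) (by fun_prop)
    fun x _ => ⟨ht, trivial⟩)

theorem deriv_eq_fderiv (hO : IsOpen O) (hf : Fam O f f') {t : ℝ} (ht : t ∈ O) (x : ℝ) :
    _root_.deriv (f t) x = fderiv ℝ (fun q : ℝ × ℝ => f q.1 q.2) (t, x) (0, 1) := by
  have h1 : HasFDerivAt (fun q : ℝ × ℝ => f q.1 q.2)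
      (fderiv ℝ (fun q : ℝ × ℝ => f q.1 q.2) (t, x)) (t, x) :=
    ((hf.smooth.differentiableOn (by simp)).differentiableAt
      ((hO.prod isOpen_univ).mem_nhds ⟨ht, trivial⟩)).hasFDerivAt
  have h2 : HasDerivAt (fun y : ℝ => (t, y)) ((0 : ℝ), (1 : ℝ)) x :=
    (hasDerivAt_const x t).prodMk (hasDerivAt_id x)
  exact (HasFDerivAt.comp_hasDerivAt (f := fun y : ℝ => (t, y)) x h1 h2).deriv

theorem deriv'_eq_fderiv (hO : IsOpen O) (h0 : 0 ∈ O) (hf : Fam O f f') (x : ℝ) :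
    f' x = fderiv ℝ (fun q : ℝ × ℝ => f q.1 q.2) (0, x) (1, 0) := by
  have h1 : HasFDerivAt (fun q : ℝ × ℝ => f q.1 q.2)
      (fderiv ℝ (fun q : ℝ × ℝ => f q.1 q.2) (0, x)) (0, x) :=
    ((hf.smooth.differentiableOn (by simp)).differentiableAt
      ((hO.prod isOpen_univ).mem_nhds ⟨h0, trivial⟩)).hasFDerivAt
  have h2 : HasDerivAt (fun t : ℝ => (t, x)) ((1 : ℝ), (0 : ℝ)) 0 :=
    (hasDerivAt_id (0 : ℝ)).prodMk (hasDerivAt_const 0 x)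
  exact (hf.deriv x).unique (HasFDerivAt.comp_hasDerivAt (f := fun t : ℝ => (t, x)) 0 h1 h2)

theorem smooth_fderiv (hO : IsOpen O) (hf : Fam O f f') :
    ContDiffOn ℝ ∞ (fderiv ℝ (fun q : ℝ × ℝ => f q.1 q.2)) (O ×ˢ Set.univ) :=
  hf.smooth.fderiv_of_isOpen (hO.prod isOpen_univ) (by simp)

theorem smooth_deriv' (hO : IsOpen O) (h0 : 0 ∈ O) (hf : Fam O f f') : ContDiff ℝ ∞ f' := by
  have h1 : ContDiff ℝ ∞ (fun x : ℝ => fderiv ℝ (fun q : ℝ × ℝ => f q.1 q.2) (0, x)) :=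
    contDiffOn_univ.1 ((hf.smooth_fderiv hO).comp (f := fun x : ℝ => ((0 : ℝ), x)) (by fun_prop)
      fun x _ => ⟨h0, trivial⟩)
  rw [show f' = _ from funext fun x => hf.deriv'_eq_fderiv hO h0 x]
  exact h1.clm_apply contDiff_const

/-- The derivative in `x` of a smooth family; the two derivatives commute. -/
theorem dx (hO : IsOpen O) (h0 : 0 ∈ O) (hf : Fam O f f') :
    Fam O (fun t x => _root_.deriv (f t) x) (fun x => _root_.deriv f' x) := by
  refine ⟨((hf.smooth_fderiv hO).clm_apply contDiffOn_const).congr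
    (fun q hq => hf.deriv_eq_fderiv hO hq.1 q.2), fun x => ?_⟩
  set F : ℝ × ℝ → ℝ := fun q => f q.1 q.2 with hF
  have hm : O ×ˢ (Set.univ : Set ℝ) ∈ 𝓝 ((0 : ℝ), x) :=
    (hO.prod isOpen_univ).mem_nhds ⟨h0, trivial⟩
  have h1 : HasFDerivAt (fderiv ℝ F) (fderiv ℝ (fderiv ℝ F) (0, x)) (0, x) :=
    (((hf.smooth_fderiv hO).differentiableOn (by simp)).differentiableAt hm).hasFDerivAt
  have ht : HasDerivAt (fun t : ℝ => (t, x)) ((1 : ℝ), (0 : ℝ)) 0 :=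
    (hasDerivAt_id (0 : ℝ)).prodMk (hasDerivAt_const 0 x)
  have hx : HasDerivAt (fun y : ℝ => ((0 : ℝ), y)) ((0 : ℝ), (1 : ℝ)) x :=
    (hasDerivAt_const x 0).prodMk (hasDerivAt_id x)
  have h2 : HasDerivAt (fun t : ℝ => fderiv ℝ F (t, x) (0, 1))
      (fderiv ℝ (fderiv ℝ F) (0, x) (1, 0) (0, 1)) 0 := by
    have h3 := HasFDerivAt.comp_hasDerivAt (f := fun t : ℝ => (t, x)) 0 h1 ht
    simpa using h3.clm_apply (hasDerivAt_const (0 : ℝ) ((0 : ℝ), (1 : ℝ)))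
  have h4 : HasDerivAt (fun y : ℝ => fderiv ℝ F (0, y) (1, 0))
      (fderiv ℝ (fderiv ℝ F) (0, x) (0, 1) (1, 0)) x := by
    have h3 := HasFDerivAt.comp_hasDerivAt (f := fun y : ℝ => ((0 : ℝ), y)) x h1 hx
    simpa using h3.clm_apply (hasDerivAt_const x ((1 : ℝ), (0 : ℝ)))
  -- Both mixed derivatives are values of the second derivative of `F`, whose symmetry exchanges
  -- them.
  have h5 : _root_.deriv f' x = fderiv ℝ (fderiv ℝ F) (0, x) (1, 0) (0, 1) := by
    have h6 := (hf.smooth.contDiffAt hm).isSymmSndFDerivAt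
      (by rw [minSmoothness_of_isRCLikeNormedField]; exact ENat.LEInfty.out) (1, 0) (0, 1)
    rw [h6, ← h4.deriv]
    congr 1
    exact funext fun y => hf.deriv'_eq_fderiv hO h0 y
  rw [h5]
  refine h2.congr_of_eventuallyEq ?_
  filter_upwards [hO.mem_nhds h0] with t ht
  exact hf.deriv_eq_fderiv hO ht x

end Fam

/-- Smooth one-parameter families of test functions which are constant on `R ≤ |x|`. -/
structure VFam (O : Set ℝ) (R : ℝ) (a : ℝ → ℝ → Fin N → ℝ) (a' : ℝ → Fin N → ℝ) : Prop where
  fam : ∀ i, Fam O (fun t x => a t x i) (fun x => a' x i)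
  const : ∀ t ∈ O, ∀ x y, R ≤ |x| → R ≤ |y| → a t x = a t y

namespace VFam

variable {O : Set ℝ} {R : ℝ} {a : ℝ → ℝ → Fin N → ℝ} {a' : ℝ → Fin N → ℝ}

theorem mono {O' : Set ℝ} {R' : ℝ} (ha : VFam O R a a') (hO : O' ⊆ O) (hR : R ≤ R') :
    VFam O' R' a a' :=
  ⟨fun i => (ha.fam i).mono hO, fun t ht x y hx hy =>
    ha.const t (hO ht) x y (hR.trans hx) (hR.trans hy)⟩

theorem isTest (ha : VFam O R a a') {t : ℝ} (ht : t ∈ O) : IsTest (a t) :=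
  ⟨contDiff_pi.2 fun i => (ha.fam i).slice ht, R, ha.const t ht⟩

theorem isTest_deriv (hO : IsOpen O) (h0 : 0 ∈ O) (ha : VFam O R a a') : IsTest a' := by
  refine ⟨contDiff_pi.2 fun i => (ha.fam i).smooth_deriv' hO h0, R, fun x y hx hy => ?_⟩
  funext i
  refine ((ha.fam i).deriv x).unique (((ha.fam i).deriv y).congr_of_eventuallyEq ?_)
  filter_upwards [hO.mem_nhds h0] with t ht
  rw [ha.const t ht x y hx hy]

theorem famDD (hO : IsOpen O) (h0 : 0 ∈ O) (ha : VFam O R a a') (i : Fin N) :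
    Fam O (fun t x => dd (a t) x i) (fun x => dd a' x i) := (ha.fam i).dx hO h0

theorem dd_eq_zero (ha : VFam O R a a') {t : ℝ} (ht : t ∈ O) {x : ℝ} (hx : R < |x|) :
    dd (a t) x = 0 := dd_eq_zero_of_const (ha.const t ht) hx

theorem famComp (h0 : 0 ∈ O) (hUo : IsOpen U) {g : (Fin N → ℝ) → ℝ}
    (hg : ContDiffOn ℝ ∞ g U) (ha : VFam O R a a') (haU : ∀ t ∈ O, ∀ x, a t x ∈ U) :
    Fam O (fun t x => g (a t x)) (fun x => fderiv ℝ g (a 0 x) (a' x)) := by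
  refine ⟨hg.comp (contDiffOn_pi.2 fun i => (ha.fam i).smooth) fun q hq => haU _ hq.1 _,
    fun x => ?_⟩
  have h1 : HasDerivAt (fun t => a t x) (a' x) 0 := hasDerivAt_pi.2 fun i => (ha.fam i).deriv x
  have h2 : HasFDerivAt g (fderiv ℝ g (a 0 x)) (a 0 x) :=
    ((hg.differentiableOn (by simp)).differentiableAt
      (hUo.mem_nhds (haU 0 h0 x))).hasFDerivAt
  exact h2.comp_hasDerivAt (f := fun t => a t x) 0 h1

end VFam

/-- The derivative of the bilinear form along smooth families of fields and test functions. -/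
theorem hasDerivAt_bil (hUo : IsOpen U) (hP : P.SmoothOn U) {O : Set ℝ} (hO : IsOpen O)
    (h0 : 0 ∈ O) {R : ℝ} {u a b : ℝ → ℝ → Fin N → ℝ} {u' a' b' : ℝ → Fin N → ℝ}
    (hu : VFam O R u u') (huU : ∀ t ∈ O, ∀ x, u t x ∈ U) (ha : VFam O R a a')
    (hb : VFam O R b b') :
    HasDerivAt (fun t => P.bil (u t) (a t) (b t))
      (P.bil (u 0) a' (b 0) + P.bil (u 0) (a 0) b' + P.tau (u 0) u' (a 0) (b 0)) 0 := by
  have hfield : ∀ t ∈ O, IsField U (u t) := fun t ht => (hu.isTest ht).isField (huU t ht)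
  have hu0 := hfield 0 h0
  have ha0 := ha.isTest h0
  have hb0 := hb.isTest h0
  have ha't := ha.isTest_deriv hO h0
  have hb't := hb.isTest_deriv hO h0
  have hu't := hu.isTest_deriv hO h0
  have hA : IsCompact (Set.Icc (-R) R) := isCompact_Icc
  have hnot : ∀ x ∉ Set.Icc (-R) R, R < |x| := fun x hx => by
    by_contra hn
    exact hx (abs_le.1 (not_lt.1 hn))
  have hloc : HasDerivAt (fun t => ∫ x, P.loc (u t) (a t) (b t) x)
      (∫ x, (P.loc (u 0) a' (b 0) x + P.loc (u 0) (a 0) b' x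
        + P.tauLoc (u 0) u' (a 0) (b 0) x)) 0 := by
    have hfam := Fam.sum (O := O) Finset.univ fun i _ => Fam.sum Finset.univ fun j _ =>
      ((hu.famComp h0 hUo (hP.g i j) huU).mul ((ha.fam i).mul (hb.famDD hO h0 j))).add
      (Fam.sum Finset.univ fun k _ => (hu.famComp h0 hUo (hP.b i j k) huU).mul
        ((hu.famDD hO h0 k).mul ((ha.fam i).mul (hb.fam j))))
    have h1 := hasDerivAt_integral_of_contDiffOn hO h0 (w := fun _ => 1)
      (hfam.smooth.of_le (by simp)) hA (by
        intro t ht x hx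
        refine Finset.sum_eq_zero fun i _ => Finset.sum_eq_zero fun j _ => ?_
        simp [hb.dd_eq_zero ht (hnot x hx), hu.dd_eq_zero ht (hnot x hx)])
      measurable_const (fun _ => by simp) hfam.deriv
    simp only [one_mul] at h1
    convert! h1 using 2
    funext x
    simp only [Coeffs.loc, Coeffs.tauLoc, ← Finset.sum_add_distrib]
    refine Finset.sum_congr rfl fun i _ => Finset.sum_congr rfl fun j _ => ?_
    have h2 : ∀ A₁ A₂ A₃ B₁ B₂ B₃ : ℝ, A₁ + B₁ + (A₂ + B₂) + (A₃ + B₃)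
      = A₁ + A₂ + A₃ + (B₁ + B₂ + B₃) := fun _ _ _ _ _ _ => by ring
    rw [h2, ← Finset.sum_add_distrib, ← Finset.sum_add_distrib]
    refine congrArg₂ _ (by ring) (Finset.sum_congr rfl fun k _ => by ring)
  have hnl : HasDerivAt (fun t => nl (dot (dd (u t)) (a t)) (dot (dd (u t)) (b t)))
      (nl (fun x => dot (dd u') (a 0) x + dot (dd (u 0)) a' x) (dot (dd (u 0)) (b 0))
        + nl (dot (dd (u 0)) (a 0)) (fun x => dot (dd u') (b 0) x + dot (dd (u 0)) b' x)) 0 := by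
    have hfam : ∀ {a : ℝ → ℝ → Fin N → ℝ} {a' : ℝ → Fin N → ℝ}, VFam O R a a' →
        Fam O (fun t x => dot (dd (u t)) (a t) x)
          (fun x => dot (dd u') (a 0) x + dot (dd (u 0)) a' x) := by
      intro a a' ha
      have := Fam.sum (O := O) Finset.univ fun i _ => (hu.famDD hO h0 i).mul (ha.fam i)
      simpa only [Finset.sum_add_distrib] using! this
    have hcc : ∀ {a : ℝ → ℝ → Fin N → ℝ} {a' : ℝ → Fin N → ℝ}, VFam O R a a' →
        CC (fun x => dot (dd u') (a 0) x + dot (dd (u 0)) a' x) := fun ha =>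
      (cc_dot_left hu't.isVariation_dd (ha.isTest h0)).add
        (cc_dot_left hu0.isTest.isVariation_dd (ha.isTest_deriv hO h0))
    have hz : ∀ {a : ℝ → ℝ → Fin N → ℝ}, ∀ t ∈ O, ∀ x ∉ Set.Icc (-R) R,
        dot (dd (u t)) (a t) x = 0 := fun t ht x hx => by
      simp [dot, hu.dd_eq_zero ht (hnot x hx)]
    exact hasDerivAt_nl hO h0 ((hfam ha).smooth.of_le (by simp)) ((hfam hb).smooth.of_le (by simp))
      hA hz hz (hcc ha) (hcc hb) (hfam ha).deriv (hfam hb).deriv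
  have h3 := hloc.add (hnl.const_mul P.K)
  -- The product rule gives local and nonlocal terms in which a, b or u is differentiated. Regrouped
  -- by the slot, they are two values of `bil` and one of `tau`.
  have hval : (∫ x, (P.loc (u 0) a' (b 0) x + P.loc (u 0) (a 0) b' x
        + P.tauLoc (u 0) u' (a 0) (b 0) x)) + P.K *
      (nl (fun x => dot (dd u') (a 0) x + dot (dd (u 0)) a' x) (dot (dd (u 0)) (b 0))
        + nl (dot (dd (u 0)) (a 0)) (fun x => dot (dd u') (b 0) x + dot (dd (u 0)) b' x))
      = P.bil (u 0) a' (b 0) + P.bil (u 0) (a 0) b' + P.tau (u 0) u' (a 0) (b 0) := by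
    have hv := hu0.isTest.isVariation_dd
    have hv' := hu't.isVariation_dd
    rw [bil_eq hP hu0 ha't hb0, bil_eq hP hu0 ha0 hb't, Coeffs.tau,
      integral_add ((cc_loc hP hu0 ha't hb0).add (cc_loc hP hu0 ha0 hb't)).integrable
        (cc_tauLoc hUo hP hu0 hu't ha0 hb0).integrable,
      integral_add (cc_loc hP hu0 ha't hb0).integrable (cc_loc hP hu0 ha0 hb't).integrable,
      nl_add_left (cc_dot_left hv' ha0) (cc_dot_left hv ha't) (cc_dot_left hv hb0),
      nl_add_right (cc_dot_left hv ha0) (cc_dot_left hv' hb0) (cc_dot_left hv hb't)]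
    ring
  rw [← hval]
  refine h3.congr_of_eventuallyEq ?_
  filter_upwards [hO.mem_nhds h0] with t ht
  exact bil_eq hP (hfield t ht) (ha.isTest ht) (hb.isTest ht)

/-! ### Perturbations of fields -/

theorem IsVariation.exists_bound {h : ℝ → Fin N → ℝ} (hh : IsVariation h) :
    ∃ C : ℝ, 0 ≤ C ∧ ∀ x, ‖h x‖ ≤ C := by
  obtain ⟨C, hC⟩ := hh.smooth.continuous.bounded_above_of_compact_support hh.compact
  exact ⟨C, (norm_nonneg _).trans (hC 0), hC⟩

theorem isVariation_zero : IsVariation (0 : ℝ → Fin N → ℝ) :=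
  ⟨contDiff_const, HasCompactSupport.zero⟩

theorem IsVariation.add {h k : ℝ → Fin N → ℝ} (hh : IsVariation h) (hk : IsVariation k) :
    IsVariation (h + k) := ⟨hh.smooth.add hk.smooth, hh.compact.add hk.compact⟩

theorem IsVariation.smul {h : ℝ → Fin N → ℝ} (c : ℝ) (hh : IsVariation h) :
    IsVariation (c • h) :=
  ⟨hh.smooth.const_smul c, hh.compact.smul_left (f := fun _ => c)⟩

theorem IsField.add {u h : ℝ → Fin N → ℝ} (hu : IsField U u) (hh : IsVariation h)
    (hU : ∀ x, u x + h x ∈ U) : IsField U (u + h) := by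
  obtain ⟨c, hc⟩ := hu.background
  refine ⟨hu.smooth.add hh.smooth, hU, c, ?_⟩
  have := hc.add hh.compact
  convert! this using 1
  funext x
  simp only [Pi.add_apply]
  abel

theorem IsTest.isCompact_range {a : ℝ → Fin N → ℝ} (ha : IsTest a) :
    IsCompact (Set.range a) := by
  obtain ⟨R, hR⟩ := ha.const
  have h1 : IsCompact (a '' Set.Icc (-|R|) |R|) :=
    isCompact_Icc.image ha.smooth.continuous
  convert! h1 using 1
  refine subset_antisymm ?_ (Set.image_subset_range _ _)
  rintro _ ⟨x, rfl⟩
  by_cases hx : x ∈ Set.Icc (-|R|) |R|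
  · exact ⟨x, hx, rfl⟩
  · refine ⟨|R|, ⟨by linarith [abs_nonneg R], le_rfl⟩, ?_⟩
    have h2 : |R| < |x| := by
      by_contra hn
      exact hx (abs_le.1 (not_lt.1 hn))
    exact hR _ _ (by rw [abs_abs]; exact le_abs_self R) ((le_abs_self R).trans h2.le)

/-- A field has compact range, so some uniform tube around it lies in U. Small perturbations of
fields are then fields. -/
theorem IsField.exists_thickening (hUo : IsOpen U) {u : ℝ → Fin N → ℝ} (hu : IsField U u) :
    ∃ δ : ℝ, 0 < δ ∧ ∀ x, ∀ v : Fin N → ℝ, ‖v‖ < δ → u x + v ∈ U := by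
  obtain ⟨δ, hδ, h⟩ := hu.isTest.isCompact_range.exists_thickening_subset_open hUo
    (Set.range_subset_iff.2 hu.mem)
  refine ⟨δ, hδ, fun x v hv => h (Metric.mem_thickening_iff.2 ⟨u x, ⟨x, rfl⟩, ?_⟩)⟩
  simpa [dist_eq_norm] using hv

theorem exists_isOpen_isField (hUo : IsOpen U) {u h k : ℝ → Fin N → ℝ} (hu : IsField U u)
    (hh : IsVariation h) (hk : IsVariation k) :
    ∃ O : Set (ℝ × ℝ), IsOpen O ∧ (0, 0) ∈ O ∧
      ∀ p ∈ O, IsField U (u + p.1 • h + p.2 • k) := by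
  obtain ⟨δ, hδ, hU⟩ := hu.exists_thickening hUo
  obtain ⟨C, hC0, hC⟩ := hh.exists_bound
  obtain ⟨D, hD0, hD⟩ := hk.exists_bound
  refine ⟨{p | |p.1| * C + |p.2| * D < δ}, isOpen_lt (by fun_prop) continuous_const,
    by simpa using hδ, fun p hp => ?_⟩
  have : IsField U (u + (p.1 • h + p.2 • k)) :=
    hu.add ((hh.smul p.1).add (hk.smul p.2)) fun x => hU x _ ?_
  · rwa [← add_assoc] at this
  · refine lt_of_le_of_lt (norm_add_le _ _) (lt_of_le_of_lt ?_ hp)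
    simp only [Pi.smul_apply, norm_smul, Real.norm_eq_abs]
    exact add_le_add (mul_le_mul_of_nonneg_left (hC x) (abs_nonneg _))
      (mul_le_mul_of_nonneg_left (hD x) (abs_nonneg _))

theorem vfam_line {u h : ℝ → Fin N → ℝ} (hu : IsTest u) (hh : IsTest h) :
    ∃ R, VFam Set.univ R (fun t : ℝ => u + t • h) h := by
  obtain ⟨R, hR⟩ := hu.const
  obtain ⟨S, hS⟩ := hh.const
  refine ⟨max R S, fun i => ⟨?_, fun x => ?_⟩, fun t _ x y hx hy => ?_⟩
  · have h1 := hu.comp i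
    have h2 := hh.comp i
    simp only [Pi.add_apply, Pi.smul_apply, smul_eq_mul]
    exact ((h1.comp contDiff_snd).add (contDiff_fst.mul (h2.comp contDiff_snd))).contDiffOn
  · simpa using! ((hasDerivAt_id (0 : ℝ)).mul_const (h x i)).const_add (u x i)
  · simp only [Pi.add_apply, Pi.smul_apply]
    rw [hR x y ((le_max_left _ _).trans hx) ((le_max_left _ _).trans hy),
      hS x y ((le_max_right _ _).trans hx) ((le_max_right _ _).trans hy)]

theorem vfam_const {a : ℝ → Fin N → ℝ} (ha : IsTest a) :
    ∃ R, VFam Set.univ R (fun _ : ℝ => a) 0 := by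
  obtain ⟨R, hR⟩ := ha.const
  exact ⟨R, fun i => ⟨((ha.comp i).comp contDiff_snd).contDiffOn, fun x => hasDerivAt_const _ _⟩,
    fun t _ => hR⟩

/-! ### Second variations of functionals -/

/-- The derivative of the variational derivative in the direction `h`. -/
def Functional.hess (I : Functional U) (u h : ℝ → Fin N → ℝ) (x : ℝ) (i : Fin N) : ℝ :=
  deriv (fun t : ℝ => I.varDeriv (u + t • h) x i) 0

/-- Smoothness is postulated only at the parameters (0, 0). Taking the field at the parameter p as
new base point moves it to p. -/
theorem Functional.contDiffAt (I : Functional U) {u h k : ℝ → Fin N → ℝ} {p : ℝ × ℝ}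
    (hu : IsField U (u + p.1 • h + p.2 • k)) (hh : IsVariation h) (hk : IsVariation k) (x : ℝ) :
    ContDiffAt ℝ ∞
      (fun q : (ℝ × ℝ) × ℝ => I.varDeriv (u + q.1.1 • h + q.1.2 • k) q.2) (p, x) := by
  have h1 := I.smooth _ h k hu hh hk x
  have h2 : ContDiffAt ℝ ∞ (fun q : (ℝ × ℝ) × ℝ => (q.1 - p, q.2)) (p, x) := by fun_prop
  have h3 := ContDiffAt.comp (g := fun q : (ℝ × ℝ) × ℝ =>
    I.varDeriv (u + p.1 • h + p.2 • k + q.1.1 • h + q.1.2 • k) q.2) (p, x)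
    (by simpa [Prod.zero_eq_mk] using! h1) h2
  convert! h3 using 1
  funext q
  simp only [Function.comp, Prod.fst_sub, Prod.snd_sub]
  congr 1
  module

theorem Functional.exists_vfam (I : Functional U) (hUo : IsOpen U) {u h : ℝ → Fin N → ℝ}
    (hu : IsField U u) (hh : IsVariation h) :
    ∃ O : Set ℝ, IsOpen O ∧ 0 ∈ O ∧ (∀ t ∈ O, IsField U (u + t • h)) ∧
      ∃ R, VFam O R (fun t => I.varDeriv (u + t • h)) (I.hess u h) := by
  -- The second direction is a dummy: its parameter is kept equal to 0.
  obtain ⟨O₂, hO₂, h0, hf⟩ := exists_isOpen_isField hUo hu hh hh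
  obtain ⟨R, hR⟩ := I.const_at_infinity u h h hu hh hh
  obtain ⟨V, hV, hVo, hV0⟩ := eventually_nhds_iff.1 hR
  have hc : Continuous (fun t : ℝ => (t, (0 : ℝ))) := by fun_prop
  have hsm : ∀ t : ℝ, (t, (0 : ℝ)) ∈ O₂ → ∀ x, ContDiffAt ℝ ∞
      (fun q : ℝ × ℝ => I.varDeriv (u + q.1 • h) q.2) (t, x) := by
    intro t ht x
    have h1 := I.contDiffAt (p := (t, 0)) (hf _ ht) hh hh x
    have h2 := ContDiffAt.comp (f := fun q : ℝ × ℝ => ((q.1, (0 : ℝ)), q.2)) (t, x) h1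
      (by fun_prop)
    simpa [Function.comp_def] using! h2
  refine ⟨(fun t : ℝ => (t, (0 : ℝ))) ⁻¹' (O₂ ∩ V), (hO₂.inter hVo).preimage hc, ⟨h0, hV0⟩,
    fun t ht => by simpa using hf _ ht.1, R, fun i => ⟨?_, fun x => ?_⟩, fun t ht => ?_⟩
  · exact fun q hq => ((contDiffAt_pi.1 (hsm q.1 hq.1.1 q.2)) i).contDiffWithinAt
  · have h1 := contDiffAt_pi.1 (hsm 0 h0 x) i
    have h2 := ContDiffAt.comp (f := fun t : ℝ => (t, x)) 0 h1 (by fun_prop)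
    exact (h2.differentiableAt (by simp)).hasDerivAt
  · simpa using hV _ ht.2

theorem Functional.isTest_varDeriv (I : Functional U) (hUo : IsOpen U) {u : ℝ → Fin N → ℝ}
    (hu : IsField U u) : IsTest (I.varDeriv u) := by
  obtain ⟨O, hO, h0, -, R, hv⟩ := I.exists_vfam hUo hu isVariation_zero
  simpa using! hv.isTest h0

theorem Functional.isTest_hess (I : Functional U) (hUo : IsOpen U) {u h : ℝ → Fin N → ℝ}
    (hu : IsField U u) (hh : IsVariation h) : IsTest (I.hess u h) := by
  obtain ⟨O, hO, h0, -, R, hv⟩ := I.exists_vfam hUo hu hh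
  exact hv.isTest_deriv hO h0

/-- The second variation of a functional is symmetric. -/
theorem Functional.hess_symm (I : Functional U) (hUo : IsOpen U) {u h k : ℝ → Fin N → ℝ}
    (hu : IsField U u) (hh : IsVariation h) (hk : IsVariation k) :
    ∫ x, dot (I.hess u k) h x = ∫ x, dot (I.hess u h) k x := by
  obtain ⟨O, hO, h0, hf⟩ := exists_isOpen_isField hUo hu hh hk
  set v : ℝ × ℝ → ℝ → Fin N → ℝ := fun p => I.varDeriv (u + p.1 • h + p.2 • k) with hv
  have hvs : ∀ p ∈ O, ∀ x, ContDiffAt ℝ ∞ (fun q : (ℝ × ℝ) × ℝ => v q.1 q.2) (p, x) :=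
    fun p hp x => I.contDiffAt (hf p hp) hh hk x
  have hA : ∀ m : ℝ → Fin N → ℝ, IsVariation m → ∀ p ∈ O,
      Integrable (fun x => fderiv ℝ (fun p => dot (v p) m x) p) ∧
      HasFDerivAt (fun p => ∫ x, dot (v p) m x) (∫ x, fderiv ℝ (fun p => dot (v p) m x) p) p := by
    intro m hm p hp
    have h1 := hasFDerivAt_integral_of_contDiffOn hO hp (Φ := fun p x => dot (v p) m x)
      (w := fun _ => 1) (fun q hq => ?_) hm.compact.isCompact (fun p _ x hx => ?_)
      measurable_const (fun _ => by simp)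
    · simpa using h1
    · refine ContDiffAt.contDiffWithinAt (ContDiffAt.sum fun i _ => ?_)
      have h2 := contDiffAt_pi.1 ((hvs q.1 hq.1 q.2).of_le (by simp : (1 : WithTop ℕ∞) ≤ ∞)) i
      exact h2.mul (((hm.isTest.comp i).of_le (by simp)).comp contDiff_snd).contDiffAt
    · simp [dot, image_eq_zero_of_notMem_tsupport hx]
  -- The partial derivatives of `φ` are the pairings of the variational derivative with h and with
  -- k. They are differentiable, so `φ` has a symmetric second derivative at the origin, and its
  -- mixed entries are the two sides of the claim.
  set φ : ℝ → ℝ → ℝ := fun s t => I.val (u + s • h + t • k) with hφ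
  have hd1 : ∀ p ∈ O, HasDerivAt (fun s => φ s p.2) (∫ x, dot (v p) h x) p.1 := by
    intro p hp
    have h1 := I.hasVarDeriv _ h (hf p hp) hh
    have h2 := HasDerivAt.comp_sub_const (x := p.1) (a := p.1)
      (f := fun ε : ℝ => I.val (u + p.1 • h + p.2 • k + ε • h)) (by simpa using! h1)
    convert! h2 using 1
    funext s
    simp only [hφ]
    congr 1
    module
  have hd2 : ∀ p ∈ O, HasDerivAt (fun t => φ p.1 t) (∫ x, dot (v p) k x) p.2 := by
    intro p hp
    have h1 := I.hasVarDeriv _ k (hf p hp) hk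
    have h2 := HasDerivAt.comp_sub_const (x := p.2) (a := p.2)
      (f := fun ε : ℝ => I.val (u + p.1 • h + p.2 • k + ε • k)) (by simpa using! h1)
    convert! h2 using 1
    funext s
    simp only [hφ]
    congr 1
    module
  set A : ℝ × ℝ → ℝ := fun p => ∫ x, dot (v p) h x with hAdef
  set B : ℝ × ℝ → ℝ := fun p => ∫ x, dot (v p) k x with hBdef
  have hφd : ∀ p ∈ O, HasFDerivAt (fun p : ℝ × ℝ => φ p.1 p.2)
      (A p • ContinuousLinearMap.fst ℝ ℝ ℝ + B p • ContinuousLinearMap.snd ℝ ℝ ℝ) p := by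
    intro p hp
    have h1 := hasStrictFDerivAt_uncurry_coprod (𝕜 := ℝ) (u := p) (f := φ)
      (f₁ := fun s t => A (s, t) • ContinuousLinearMap.id ℝ ℝ)
      (f₂ := fun s t => B (s, t) • ContinuousLinearMap.id ℝ ℝ) ?_ ?_ ?_ ?_
    · convert! h1.hasFDerivAt using 1
    · filter_upwards [hO.mem_nhds hp] with q hq
      have := (hd1 q hq).hasFDerivAt
      convert! this using 1
      ext; simp [Function.HasUncurry.uncurry, A]
    · filter_upwards [hO.mem_nhds hp] with q hq
      have := (hd2 q hq).hasFDerivAt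
      convert! this using 1
      ext; simp [Function.HasUncurry.uncurry, B]
    · exact ((hA h hh p hp).2.continuousAt).smul continuousAt_const
    · exact ((hA k hk p hp).2.continuousAt).smul continuousAt_const
  have hA0 := hA h hh _ h0
  have hB0 := hA k hk _ h0
  have hsec := second_derivative_symmetric_of_eventually_of_real
    (f := fun p : ℝ × ℝ => φ p.1 p.2) (x := ((0 : ℝ), (0 : ℝ)))
    (by filter_upwards [hO.mem_nhds h0] with p hp using hφd p hp)
    ((hA0.2.smul_const (ContinuousLinearMap.fst ℝ ℝ ℝ)).add
      (hB0.2.smul_const (ContinuousLinearMap.snd ℝ ℝ ℝ))) (0, 1) (1, 0)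
  simp only [add_apply, ContinuousLinearMap.smulRight_apply,
    smul_apply, ContinuousLinearMap.coe_fst', ContinuousLinearMap.coe_snd',
    smul_eq_mul, mul_one, mul_zero, add_zero, zero_add] at hsec
  rw [ContinuousLinearMap.integral_apply hA0.1, ContinuousLinearMap.integral_apply hB0.1] at hsec
  have hdiff : ∀ m : ℝ → Fin N → ℝ, ∀ x, DifferentiableAt ℝ (fun p => dot (v p) m x) (0, 0) := by
    intro m x
    refine DifferentiableAt.fun_sum fun i _ => DifferentiableAt.mul_const ?_ _
    have h1 := contDiffAt_pi.1 (hvs _ h0 x) i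
    have h2 := ContDiffAt.comp (f := fun p : ℝ × ℝ => (p, x)) (0, 0) h1 (by fun_prop)
    exact h2.differentiableAt (by simp)
  have hk' : ∀ x, fderiv ℝ (fun p => dot (v p) h x) (0, 0) (0, 1) = dot (I.hess u k) h x := by
    intro x
    have h1 := HasFDerivAt.comp_hasDerivAt (f := fun t : ℝ => ((0 : ℝ), t)) 0
      (hdiff h x).hasFDerivAt ((hasDerivAt_const 0 0).prodMk (hasDerivAt_id 0))
    obtain ⟨O', hO', h0', -, R, hvf⟩ := I.exists_vfam hUo hu hk
    refine h1.unique ?_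
    have h2 := HasDerivAt.fun_sum (u := Finset.univ) fun i _ =>
      ((hvf.fam i).deriv x).mul_const (h x i)
    simpa [Function.comp_def, dot, v] using! h2
  have hh' : ∀ x, fderiv ℝ (fun p => dot (v p) k x) (0, 0) (1, 0) = dot (I.hess u h) k x := by
    intro x
    have h1 := HasFDerivAt.comp_hasDerivAt (f := fun t : ℝ => (t, (0 : ℝ))) 0
      (hdiff k x).hasFDerivAt ((hasDerivAt_id 0).prodMk (hasDerivAt_const 0 0))
    obtain ⟨O', hO', h0', -, R, hvf⟩ := I.exists_vfam hUo hu hh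
    refine h1.unique ?_
    have h2 := HasDerivAt.fun_sum (u := Finset.univ) fun i _ =>
      ((hvf.fam i).deriv x).mul_const (k x i)
    simpa [Function.comp_def, dot, v] using! h2
  simpa only [hk', hh'] using hsec

/-! ### Linear functionals -/

/-- The linear functional `∫ a_i(x) (u^i(x) - u^i(∞)) dx`. -/
def linFunctional (U : Set (Fin N → ℝ)) {a : ℝ → Fin N → ℝ} (ha : IsTest a) : Functional U where
  val u := ∫ x, dot a (fun x => u x - backgroundValue u) x
  varDeriv _ := a
  hasVarDeriv u h hu hh := by
    obtain ⟨c, hc⟩ := hu.background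
    have hcv : IsVariation (fun x => u x - c) := ⟨hu.smooth.sub contDiff_const, hc⟩
    have h1 : (fun ε : ℝ => ∫ x, dot a (fun x => (u + ε • h) x - backgroundValue (u + ε • h)) x)
        = fun ε : ℝ => (∫ x, dot (fun x => u x - c) a x) + ε * ∫ x, dot h a x := by
      funext ε
      rw [backgroundValue_eq (compact_add_smul hc hh.compact ε), ← integral_const_mul,
        ← integral_add (cc_dot_left hcv ha).integrable ((cc_dot_left hh ha).integrable.const_mul ε)]
      congr 1
      funext x
      simp only [dot, Finset.mul_sum, ← Finset.sum_add_distrib]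
      refine Finset.sum_congr rfl fun i _ => ?_
      simp only [Pi.sub_apply, Pi.add_apply, Pi.smul_apply, smul_eq_mul]
      ring
    rw [h1]
    have h2 : ∫ x, ∑ i, a x i * h x i = ∫ x, dot h a x := by rw [dot_comm]; rfl
    rw [h2]
    simpa using! ((hasDerivAt_id (0 : ℝ)).mul_const (∫ x, dot h a x)).const_add
      (∫ x, dot (fun x => u x - c) a x)
  smooth _ _ _ _ _ _ x := (ha.smooth.comp contDiff_snd).contDiffAt
  const_at_infinity _ _ _ _ _ _ := by
    obtain ⟨R, hR⟩ := ha.const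
    exact ⟨R, Eventually.of_forall fun _ => hR⟩

/-! ### Hamiltonian vector fields and the Jacobi identity -/

/-- The factor (d/dx)⁻¹(u_x a) need not decay, but it is multiplied by u_x. The other terms contain
u_x or a_x, so the whole field has compact support and is an admissible variation. -/
theorem isVariation_apply (hP : P.SmoothOn U) {u a : ℝ → Fin N → ℝ} (hu : IsField U u)
    (ha : IsTest a) : IsVariation (P.apply u a) := by
  have hcc := cc_dot_left hu.isTest.isVariation_dd ha
  have hsm : ContDiff ℝ ∞ (dot (dd u) a) := ContDiff.sum fun i _ =>
    (hu.isTest.isVariation_dd.isTest.comp i).mul (ha.comp i)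
  constructor
  · refine contDiff_pi.2 fun i => ContDiff.add (ContDiff.add ?_ ?_) ?_
    · exact ContDiff.sum fun j _ => (contDiff_comp_field (hP.g i j) hu).mul
        (contDiff_pi.1 (contDiff_dd ha.smooth) j)
    · exact ContDiff.sum fun j _ => ContDiff.sum fun k _ =>
        ((contDiff_comp_field (hP.b i j k) hu).mul
          (contDiff_pi.1 (contDiff_dd hu.smooth) k)).mul (ha.comp j)
    · exact (contDiff_const.mul (contDiff_pi.1 (contDiff_dd hu.smooth) i)).mul
        (hcc.contDiff_invD hsm)
  · obtain ⟨R, hR⟩ := ha.const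
    obtain ⟨S, hS⟩ := hu.isTest.const
    refine hasCompactSupport_of_abs (R := max R S) fun x hx => ?_
    have h1 : ∀ j, deriv (fun y => a y j) x = 0 := fun j =>
      congrFun (dd_eq_zero_of_const hR ((le_max_left _ _).trans_lt hx)) j
    have h2 : ∀ j, deriv (fun y => u y j) x = 0 := fun j =>
      congrFun (dd_eq_zero_of_const hS ((le_max_right _ _).trans_lt hx)) j
    funext i
    simp [Coeffs.apply, h1, h2]

theorem isBracketWith_bracket (hUo : IsOpen U) (hP : P.SmoothOn U) (I J L : Functional U)
    {u : ℝ → Fin N → ℝ} (hu : IsField U u) :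
    P.IsBracketWith (P.bracket I J) L u
      (P.bil u (I.hess u (P.hamField L u)) (J.varDeriv u)
        + P.bil u (I.varDeriv u) (J.hess u (P.hamField L u))
        + P.tau u (P.hamField L u) (I.varDeriv u) (J.varDeriv u)) := by
  have hX : IsVariation (P.hamField L u) := isVariation_apply hP hu (L.isTest_varDeriv hUo hu)
  obtain ⟨O₁, hO₁, h1, hf, R₁, hI⟩ := I.exists_vfam hUo hu hX
  obtain ⟨O₂, hO₂, h2, -, R₂, hJ⟩ := J.exists_vfam hUo hu hX
  obtain ⟨R₃, hL⟩ := vfam_line hu.isTest hX.isTest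
  have := hasDerivAt_bil hUo hP (hO₁.inter hO₂) ⟨h1, h2⟩ (R := max (max R₁ R₂) R₃)
    (hL.mono (Set.subset_univ _) (le_max_right _ _)) (fun t ht x => (hf t ht.1).mem x)
    (hI.mono Set.inter_subset_left ((le_max_left _ _).trans (le_max_left _ _)))
    (hJ.mono Set.inter_subset_right ((le_max_right _ _).trans (le_max_left _ _)))
  simpa using! this

/-- The trilinear form whose vanishing is the Jacobi identity: the operator `P` is varied along the
vector fields of the operator `Q`. -/
def Coeffs.jac (P Q : Coeffs N) (u a b c : ℝ → Fin N → ℝ) : ℝ :=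
  P.tau u (Q.apply u c) a b + P.tau u (Q.apply u a) b c + P.tau u (Q.apply u b) c a

/-- For a skew-symmetric bracket, the Jacobi identity only involves the variation of the operator. -/
theorem jacobi_iff (hUo : IsOpen U) (hP : P.SmoothOn U) {u : ℝ → Fin N → ℝ} (hu : IsField U u)
    (hskew : ∀ a b, IsTest a → IsTest b → P.bil u a b = - P.bil u b a) (I J L : Functional U) :
    (∃ a b c : ℝ, P.IsBracketWith (P.bracket I J) L u a ∧
      P.IsBracketWith (P.bracket J L) I u b ∧
      P.IsBracketWith (P.bracket L I) J u c ∧ a + b + c = 0) ↔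
    P.jac P u (I.varDeriv u) (J.varDeriv u) (L.varDeriv u) = 0 := by
  have hI := I.isTest_varDeriv hUo hu
  have hJ := J.isTest_varDeriv hUo hu
  have hL := L.isTest_varDeriv hUo hu
  have hXI : IsVariation (P.hamField I u) := isVariation_apply hP hu hI
  have hXJ : IsVariation (P.hamField J u) := isVariation_apply hP hu hJ
  have hXL : IsVariation (P.hamField L u) := isVariation_apply hP hu hL
  have e1 := isBracketWith_bracket hUo hP I J L hu
  have e2 := isBracketWith_bracket hUo hP J L I hu
  have e3 := isBracketWith_bracket hUo hP L I J hu
  -- Six terms contain second variations. Skewness moves each second variation to the left slot,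
  -- where it is paired with a Hamiltonian field; its symmetry then cancels the six terms in pairs.
  have key : (P.bil u (I.hess u (P.hamField L u)) (J.varDeriv u)
        + P.bil u (I.varDeriv u) (J.hess u (P.hamField L u))
        + P.tau u (P.hamField L u) (I.varDeriv u) (J.varDeriv u))
      + (P.bil u (J.hess u (P.hamField I u)) (L.varDeriv u)
        + P.bil u (J.varDeriv u) (L.hess u (P.hamField I u))
        + P.tau u (P.hamField I u) (J.varDeriv u) (L.varDeriv u))
      + (P.bil u (L.hess u (P.hamField J u)) (I.varDeriv u)
        + P.bil u (L.varDeriv u) (I.hess u (P.hamField J u))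
        + P.tau u (P.hamField J u) (L.varDeriv u) (I.varDeriv u))
      = P.jac P u (I.varDeriv u) (J.varDeriv u) (L.varDeriv u) := by
    have s1 : P.bil u (I.hess u (P.hamField L u)) (J.varDeriv u)
        = P.bil u (I.hess u (P.hamField J u)) (L.varDeriv u) := I.hess_symm hUo hu hXJ hXL
    have s2 : P.bil u (J.hess u (P.hamField I u)) (L.varDeriv u)
        = P.bil u (J.hess u (P.hamField L u)) (I.varDeriv u) := J.hess_symm hUo hu hXL hXI
    have s3 : P.bil u (L.hess u (P.hamField J u)) (I.varDeriv u)
        = P.bil u (L.hess u (P.hamField I u)) (J.varDeriv u) := L.hess_symm hUo hu hXI hXJ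
    rw [hskew _ _ hI (J.isTest_hess hUo hu hXL), hskew _ _ hJ (L.isTest_hess hUo hu hXI),
      hskew _ _ hL (I.isTest_hess hUo hu hXJ), s1, s2, s3]
    unfold Coeffs.jac Coeffs.hamField
    ring
  constructor
  · rintro ⟨a, b, c, ha, hb, hc, habc⟩
    rw [← key, ← ha.unique e1, ← hb.unique e2, ← hc.unique e3, habc]
  · intro h
    exact ⟨_, _, _, e1, e2, e3, by rw [key, h]⟩

/-! ### Linear combinations of operators -/

theorem IsTest.hasDerivAt {a : ℝ → Fin N → ℝ} (ha : IsTest a) (x : ℝ) (i : Fin N) :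
    HasDerivAt (fun y => a y i) (dd a x i) x :=
  (((ha.comp i).differentiable (by simp)) x).hasDerivAt

theorem dd_add_smul {a b : ℝ → Fin N → ℝ} (ha : IsTest a) (hb : IsTest b) (α β : ℝ) :
    dd (α • a + β • b) = α • dd a + β • dd b := by
  funext x i
  exact (((ha.hasDerivAt x i).const_mul α).add ((hb.hasDerivAt x i).const_mul β)).deriv

theorem dot_add_smul_left (a b c : ℝ → Fin N → ℝ) (α β : ℝ) :
    dot (α • a + β • b) c = fun x => α * dot a c x + β * dot b c x := by
  funext x
  simp only [dot, Finset.mul_sum, ← Finset.sum_add_distrib, Pi.add_apply, Pi.smul_apply,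
    smul_eq_mul]
  exact Finset.sum_congr rfl fun i _ => by ring

theorem dot_zero_left (a : ℝ → Fin N → ℝ) : dot 0 a = fun _ => 0 := by
  funext x; simp [dot]

theorem nl_zero_left (f : ℝ → ℝ) : nl (fun _ => 0) f = 0 := by simp [nl]

theorem nl_zero_right (f : ℝ → ℝ) : nl f (fun _ => 0) = 0 := by simp [nl, invD]

theorem apply_lincomb (α β : ℝ) (P Q : Coeffs N) (u a : ℝ → Fin N → ℝ) :
    (Coeffs.lincomb α P β Q).apply u a = α • P.apply u a + β • Q.apply u a := by
  funext x i
  have h1 : ∀ j k, (α * P.b (u x) i j k + β * Q.b (u x) i j k) * deriv (fun y => u y k) x * a x j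
      = α * (P.b (u x) i j k * deriv (fun y => u y k) x * a x j)
        + β * (Q.b (u x) i j k * deriv (fun y => u y k) x * a x j) := fun j k => by ring
  have h2 : ∀ j, (α * P.g (u x) i j + β * Q.g (u x) i j) * deriv (fun y => a y j) x
      = α * (P.g (u x) i j * deriv (fun y => a y j) x)
        + β * (Q.g (u x) i j * deriv (fun y => a y j) x) := fun j => by ring
  simp only [Coeffs.apply, Coeffs.lincomb, Pi.add_apply, Pi.smul_apply, smul_eq_mul, h1, h2,
    Finset.sum_add_distrib, ← Finset.mul_sum]
  ring

theorem bil_lincomb {Q : Coeffs N} (hP : P.SmoothOn U) (hQ : Q.SmoothOn U) (α β : ℝ)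
    {u a b : ℝ → Fin N → ℝ} (hu : IsField U u) (ha : IsTest a) (hb : IsTest b) :
    (Coeffs.lincomb α P β Q).bil u a b = α * P.bil u a b + β * Q.bil u a b := by
  have h1 := (cc_dot_left (isVariation_apply hP hu hb) ha).integrable
  have h2 := (cc_dot_left (isVariation_apply hQ hu hb) ha).integrable
  unfold Coeffs.bil
  rw [apply_lincomb, dot_comm, dot_add_smul_left, integral_add (h1.const_mul α) (h2.const_mul β),
    integral_const_mul, integral_const_mul, dot_comm a, dot_comm a]

theorem smoothOn_const (η : Matrix (Fin N) (Fin N) ℝ) : (Coeffs.const η).SmoothOn U :=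
  ⟨fun _ _ => contDiffOn_const, fun _ _ _ => contDiffOn_const⟩

theorem SmoothOn.lincomb {Q : Coeffs N} (hP : P.SmoothOn U) (hQ : Q.SmoothOn U) (α β : ℝ) :
    (Coeffs.lincomb α P β Q).SmoothOn U :=
  ⟨fun i j => (contDiffOn_const.mul (hP.g i j)).add (contDiffOn_const.mul (hQ.g i j)),
    fun i j k => (contDiffOn_const.mul (hP.b i j k)).add (contDiffOn_const.mul (hQ.b i j k))⟩

theorem apply_const (η : Matrix (Fin N) (Fin N) ℝ) (u a : ℝ → Fin N → ℝ) :
    (Coeffs.const η).apply u a = fun x => η.mulVec (dd a x) := by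
  funext x i
  simp [Coeffs.apply, Coeffs.const, Matrix.mulVec, dotProduct, dd]

theorem integral_deriv_eq_zero_of_const {f : ℝ → ℝ} (hf : ContDiff ℝ ∞ f) {R : ℝ}
    (h : ∀ x y, R ≤ |x| → R ≤ |y| → f x = f y) : ∫ x, deriv f x = 0 := by
  have h1 : HasCompactSupport (fun x => f x - f |R|) := by
    refine hasCompactSupport_of_abs (R := R) fun x hx => ?_
    rw [h x |R| hx.le (by rw [abs_abs]; exact le_abs_self R), sub_self]
  have h2 := integral_deriv_eq_zero ((hf.sub contDiff_const).of_le (by simp)) h1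
  simpa using h2

/-- The two forms add up to the integral of d/dx(η^{ij} a_i b_j), which is zero because test
functions have equal values at both ends. -/
theorem bil_const_skew {η : Matrix (Fin N) (Fin N) ℝ} (hη : η.IsSymm) {u a b : ℝ → Fin N → ℝ}
    (hu : IsField U u) (ha : IsTest a) (hb : IsTest b) :
    (Coeffs.const η).bil u a b = - (Coeffs.const η).bil u b a := by
  have h1 := (cc_dot_left (isVariation_apply (smoothOn_const η) hu hb) ha).integrable
  have h2 := (cc_dot_left (isVariation_apply (smoothOn_const η) hu ha) hb).integrable
  rw [← add_eq_zero_iff_eq_neg]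
  unfold Coeffs.bil
  rw [dot_comm a, dot_comm b, ← integral_add h1 h2]
  obtain ⟨R, hR⟩ := ha.const
  obtain ⟨S, hS⟩ := hb.const
  have hsm : ContDiff ℝ ∞ (fun x => ∑ i, ∑ j, η i j * (a x i * b x j)) :=
    ContDiff.sum fun i _ => ContDiff.sum fun j _ =>
      contDiff_const.mul ((ha.comp i).mul (hb.comp j))
  rw [← integral_deriv_eq_zero_of_const hsm (R := max R S) fun x y hx hy => by
    rw [hR x y ((le_max_left _ _).trans hx) ((le_max_left _ _).trans hy),
      hS x y ((le_max_right _ _).trans hx) ((le_max_right _ _).trans hy)]]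
  congr 1
  funext x
  have h3 := HasDerivAt.fun_sum (u := Finset.univ) fun i _ => HasDerivAt.fun_sum
    (u := Finset.univ) fun j _ => ((ha.hasDerivAt x i).mul (hb.hasDerivAt x j)).const_mul (η i j)
  refine Eq.trans ?_ h3.deriv.symm
  simp only [dot, apply_const, Matrix.mulVec, dotProduct, mul_add, Finset.sum_add_distrib,
    Finset.sum_mul]
  rw [add_comm]
  refine congrArg₂ _ ?_ ?_
  · rw [Finset.sum_comm]
    refine Finset.sum_congr rfl fun i _ => Finset.sum_congr rfl fun j _ => ?_
    rw [hη.apply i j]; ring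
  · exact Finset.sum_congr rfl fun i _ => Finset.sum_congr rfl fun j _ => by ring

theorem bil_zero_left (u b : ℝ → Fin N → ℝ) : P.bil u 0 b = 0 := by
  simp [Coeffs.bil, dot]

theorem bil_zero_right (u a : ℝ → Fin N → ℝ) : P.bil u a 0 = 0 := by
  simp [Coeffs.bil, dot, Coeffs.apply, invD]

/-- This characterises `tau` as a derivative, so that some identities for it follow from uniqueness
of derivatives. -/
theorem hasDerivAt_bil_line (hUo : IsOpen U) (hP : P.SmoothOn U) {u h a b : ℝ → Fin N → ℝ}
    (hu : IsField U u) (hh : IsVariation h) (ha : IsTest a) (hb : IsTest b) :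
    HasDerivAt (fun t : ℝ => P.bil (u + t • h) a b) (P.tau u h a b) 0 := by
  obtain ⟨O, hO, h0, hf⟩ := exists_isOpen_isField hUo hu hh isVariation_zero
  obtain ⟨R₁, h1⟩ := vfam_line hu.isTest hh.isTest
  obtain ⟨R₂, h2⟩ := vfam_const ha
  obtain ⟨R₃, h3⟩ := vfam_const hb
  have h4 := hasDerivAt_bil hUo hP (O := (fun t : ℝ => (t, (0 : ℝ))) ⁻¹' O) (R := max R₁ (max R₂ R₃))
    (hO.preimage (by fun_prop)) h0 (h1.mono (Set.subset_univ _) (le_max_left _ _))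
    (fun t ht x => by simpa using! (hf _ ht).mem x)
    (h2.mono (Set.subset_univ _) ((le_max_left _ _).trans (le_max_right _ _)))
    (h3.mono (Set.subset_univ _) ((le_max_right _ _).trans (le_max_right _ _)))
  simpa [bil_zero_left, bil_zero_right] using h4

theorem bil_const_eq (η : Matrix (Fin N) (Fin N) ℝ) (u v a b : ℝ → Fin N → ℝ) :
    (Coeffs.const η).bil u a b = (Coeffs.const η).bil v a b := by
  simp only [Coeffs.bil, apply_const]

/-- The form of the constant operator does not depend on the field, so it adds only a constant to
the function being differentiated. -/
theorem tau_lincomb_const (hUo : IsOpen U) (hP : P.SmoothOn U) (η : Matrix (Fin N) (Fin N) ℝ)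
    (α β : ℝ) {u h a b : ℝ → Fin N → ℝ} (hu : IsField U u) (hh : IsVariation h)
    (ha : IsTest a) (hb : IsTest b) :
    (Coeffs.lincomb α P β (Coeffs.const η)).tau u h a b = α * P.tau u h a b := by
  have h1 := hasDerivAt_bil_line hUo (SmoothOn.lincomb hP (smoothOn_const η) α β) hu hh ha hb
  have h2 := ((hasDerivAt_bil_line hUo hP hu hh ha hb).const_mul α).add_const
    (β * (Coeffs.const η).bil u a b)
  refine h1.unique (h2.congr_of_eventuallyEq ?_)
  obtain ⟨O, hO, h0, hf⟩ := exists_isOpen_isField hUo hu hh isVariation_zero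
  have hc : Continuous (fun t : ℝ => (t, (0 : ℝ))) := by fun_prop
  filter_upwards [hc.continuousAt.eventually (hO.mem_nhds h0)] with t ht
  have hut : IsField U (u + t • h) := by simpa using hf _ ht
  rw [bil_lincomb hP (smoothOn_const η) α β hut ha hb, bil_const_eq η _ u]

theorem tau_add_smul (hUo : IsOpen U) (hP : P.SmoothOn U) {u h k a b : ℝ → Fin N → ℝ}
    (hu : IsField U u) (hh : IsVariation h) (hk : IsVariation k) (ha : IsTest a)
    (hb : IsTest b) (α β : ℝ) :
    P.tau u (α • h + β • k) a b = α * P.tau u h a b + β * P.tau u k a b := by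
  have hloc : ∀ x, P.tauLoc u (α • h + β • k) a b x
      = α * P.tauLoc u h a b x + β * P.tauLoc u k a b x := by
    intro x
    simp only [Coeffs.tauLoc, dd_add_smul hh.isTest hk.isTest, Pi.add_apply, Pi.smul_apply,
      map_add, map_smul, Finset.mul_sum, ← Finset.sum_add_distrib, smul_eq_mul]
    refine Finset.sum_congr rfl fun i _ => Finset.sum_congr rfl fun j _ => ?_
    simp only [mul_add, Finset.mul_sum, Finset.sum_add_distrib, add_mul]
    have : ∀ A₁ A₂ B₁ B₂ C₁ C₂ D₁ D₂ E₁ E₂ F₁ F₂ : ℝ, A₁ = A₂ → B₁ = B₂ → C₁ = C₂ → D₁ = D₂ →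
      E₁ = E₂ → F₁ = F₂ → A₁ + B₁ + (C₁ + D₁ + (E₁ + F₁)) = A₂ + (C₂ + E₂) + (B₂ + (D₂ + F₂)) := by
      intros; subst_vars; ring
    refine this _ _ _ _ _ _ _ _ _ _ _ _ ?_ ?_ ?_ ?_ ?_ ?_
    all_goals first | ring1 | exact Finset.sum_congr rfl fun k _ => by ring
  have hv := hu.isTest.isVariation_dd
  have hv1 := hh.isTest.isVariation_dd
  have hv2 := hk.isTest.isVariation_dd
  unfold Coeffs.tau
  simp only [hloc]
  rw [integral_add ((cc_tauLoc hUo hP hu hh.isTest ha hb).integrable.const_mul α)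
    ((cc_tauLoc hUo hP hu hk.isTest ha hb).integrable.const_mul β), integral_const_mul,
    integral_const_mul, dd_add_smul hh.isTest hk.isTest, dot_add_smul_left, dot_add_smul_left,
    nl_add_left ((cc_dot_left hv1 ha).const_mul α) ((cc_dot_left hv2 ha).const_mul β)
      (cc_dot_left hv hb),
    nl_add_right (cc_dot_left hv ha) ((cc_dot_left hv1 hb).const_mul α)
      ((cc_dot_left hv2 hb).const_mul β), nl_const_mul_left, nl_const_mul_left,
    nl_const_mul_right, nl_const_mul_right]
  ring

theorem tau_zero (u a b : ℝ → Fin N → ℝ) : P.tau u 0 a b = 0 := by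
  have h1 : dd (0 : ℝ → Fin N → ℝ) = 0 := dd_const 0
  simp [Coeffs.tau, Coeffs.tauLoc, h1, dot_zero_left, nl_zero_left, nl_zero_right]

/-- The outer α comes from the operator being varied, where η drops out. The inner combination comes
from the Hamiltonian vector fields. -/
theorem jac_lincomb_const (hUo : IsOpen U) (hP : P.SmoothOn U) (η : Matrix (Fin N) (Fin N) ℝ)
    (α β : ℝ) {u a b c : ℝ → Fin N → ℝ} (hu : IsField U u) (ha : IsTest a) (hb : IsTest b)
    (hc : IsTest c) :
    (Coeffs.lincomb α P β (Coeffs.const η)).jac (Coeffs.lincomb α P β (Coeffs.const η)) u a b c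
      = α * (α * P.jac P u a b c + β * P.jac (Coeffs.const η) u a b c) := by
  have key : ∀ a b c, IsTest a → IsTest b → IsTest c →
      (Coeffs.lincomb α P β (Coeffs.const η)).tau u
        ((Coeffs.lincomb α P β (Coeffs.const η)).apply u c) a b
      = α * (α * P.tau u (P.apply u c) a b + β * P.tau u ((Coeffs.const η).apply u c) a b) := by
    intro a b c ha hb hc
    have h1 := isVariation_apply hP hu hc
    have h2 := isVariation_apply (smoothOn_const η) hu hc
    rw [apply_lincomb, tau_lincomb_const hUo hP η α β hu ((h1.smul α).add (h2.smul β)) ha hb,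
      tau_add_smul hUo hP hu h1 h2 ha hb]
  simp only [Coeffs.jac]
  rw [key a b c ha hb hc, key b c a hb hc ha, key c a b hc ha hb]
  ring

/-- A linear functional has a prescribed test function as variational derivative, so an axiom about
functionals becomes a statement about arbitrary test functions. -/
theorem bil_skew_of_isPoisson (h : P.IsPoisson U) {u a b : ℝ → Fin N → ℝ} (hu : IsField U u)
    (ha : IsTest a) (hb : IsTest b) : P.bil u a b = - P.bil u b a :=
  h.skew (linFunctional U ha) (linFunctional U hb) u hu

theorem jac_eq_zero_of_isPoisson (hUo : IsOpen U) (hP : P.SmoothOn U) (h : P.IsPoisson U)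
    {u a b c : ℝ → Fin N → ℝ} (hu : IsField U u) (ha : IsTest a) (hb : IsTest b)
    (hc : IsTest c) : P.jac P u a b c = 0 :=
  (jacobi_iff hUo hP hu (fun _ _ ha hb => bil_skew_of_isPoisson h hu ha hb)
    (linFunctional U ha) (linFunctional U hb) (linFunctional U hc)).1 (h.jacobi _ _ _ u hu)

/-- Compatibility of a Poisson bracket with a constant one, expressed on test functions. -/
theorem compatible_const_iff (hUo : IsOpen U) (hP : P.SmoothOn U) (h : P.IsPoisson U)
    {η : Matrix (Fin N) (Fin N) ℝ} (hη : η.IsSymm) :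
    Coeffs.Compatible U P (Coeffs.const η) ↔ ∀ u a b c, IsField U u → IsTest a → IsTest b →
      IsTest c → P.jac (Coeffs.const η) u a b c = 0 := by
  constructor
  · intro hc u a b c hu ha hb hc'
    -- The sum of the two operators suffices: the term of P with itself vanishes, which isolates the
    -- mixed term.
    have h1 := jac_eq_zero_of_isPoisson hUo (SmoothOn.lincomb hP (smoothOn_const η) 1 1) (hc 1 1)
      hu ha hb hc'
    rw [jac_lincomb_const hUo hP η 1 1 hu ha hb hc',
      jac_eq_zero_of_isPoisson hUo hP h hu ha hb hc'] at h1
    simpa using h1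
  · intro hj α β
    have hR := SmoothOn.lincomb hP (smoothOn_const η) α β
    have hskew : ∀ u a b, IsField U u → IsTest a → IsTest b →
        (Coeffs.lincomb α P β (Coeffs.const η)).bil u a b
          = - (Coeffs.lincomb α P β (Coeffs.const η)).bil u b a := by
      intro u a b hu ha hb
      rw [bil_lincomb hP (smoothOn_const η) α β hu ha hb,
        bil_lincomb hP (smoothOn_const η) α β hu hb ha, bil_skew_of_isPoisson h hu ha hb,
        bil_const_skew hη hu ha hb]
      ring
    refine ⟨fun I J u hu => hskew u _ _ hu (I.isTest_varDeriv hUo hu)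
      (J.isTest_varDeriv hUo hu), fun I J L u hu => ?_⟩
    have hI := I.isTest_varDeriv hUo hu
    have hJ := J.isTest_varDeriv hUo hu
    have hL := L.isTest_varDeriv hUo hu
    refine (jacobi_iff hUo hR hu (fun _ _ ha hb => hskew u _ _ hu ha hb) I J L).2 ?_
    rw [jac_lincomb_const hUo hP η α β hu hI hJ hL,
      jac_eq_zero_of_isPoisson hUo hP h hu hI hJ hL, hj u _ _ _ hu hI hJ hL]
    ring

/-! ### Integration by parts in the variation of the operator -/

/-- `∂_l b^{ij}_k - ∂_k b^{ij}_l + K (δ^i_k δ^j_l - δ^i_l δ^j_k)`. -/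
def Coeffs.curv (P : Coeffs N) (p : Fin N → ℝ) (i j k l : Fin N) : ℝ :=
  fderiv ℝ (fun p => P.b p i j k) p (Pi.single l 1)
    - fderiv ℝ (fun p => P.b p i j l) p (Pi.single k 1)
    + P.K * ((if i = k then 1 else 0) * (if j = l then 1 else 0)
      - (if i = l then 1 else 0) * (if j = k then 1 else 0))

/-- The part of the variation without derivatives of `h`, of second order in the test functions. -/
def Coeffs.symmPart (P : Coeffs N) (u h a b : ℝ → Fin N → ℝ) (x : ℝ) : ℝ :=
  ∑ i, ∑ j, (fderiv ℝ (fun p => P.g p i j) (u x) (h x) * (a x i * dd b x j)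
    - ∑ k, P.b (u x) i j k * (h x k * (dd a x i * b x j + a x i * dd b x j)))

/-- The part of the variation with the curvature. -/
def Coeffs.curvPart (P : Coeffs N) (u h a b : ℝ → Fin N → ℝ) (x : ℝ) : ℝ :=
  ∑ i, ∑ j, ∑ k, ∑ l, P.curv (u x) i j k l * (h x l * (dd u x k * (a x i * b x j)))

theorem clm_eq_sum (L : (Fin N → ℝ) →L[ℝ] ℝ) (v : Fin N → ℝ) :
    L v = ∑ l, L (Pi.single l 1) * v l := by
  have h1 := LinearMap.pi_apply_eq_sum_univ L.toLinearMap v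
  simp only [ContinuousLinearMap.coe_coe, smul_eq_mul] at h1
  rw [h1]
  refine Finset.sum_congr rfl fun i _ => ?_
  rw [mul_comm]
  congr 2
  funext j
  simp [Pi.single_apply, eq_comm]

/-- Contracting the Kronecker deltas leaves a local term in K. In `tau_eq` it is matched with the
local terms produced by the nonlocal part. -/
theorem curv_sum (P : Coeffs N) (p h v : Fin N → ℝ) (i j : Fin N) (c : ℝ) :
    ∑ k, ∑ l, P.curv p i j k l * (h l * (v k * c))
      = (∑ k, fderiv ℝ (fun p => P.b p i j k) p h * (v k * c))
        - (∑ k, fderiv ℝ (fun p => P.b p i j k) p v * (h k * c))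
        + P.K * ((v i * c) * h j - (h i * c) * v j) := by
  have h1 : (∑ k, fderiv ℝ (fun p => P.b p i j k) p h * (v k * c))
      = ∑ k, ∑ l, fderiv ℝ (fun p => P.b p i j k) p (Pi.single l 1) * (h l * (v k * c)) := by
    refine Finset.sum_congr rfl fun k _ => ?_
    rw [clm_eq_sum _ h, Finset.sum_mul]
    exact Finset.sum_congr rfl fun l _ => by ring
  have h2 : (∑ k, fderiv ℝ (fun p => P.b p i j k) p v * (h k * c))
      = ∑ k, ∑ l, fderiv ℝ (fun p => P.b p i j l) p (Pi.single k 1) * (h l * (v k * c)) := by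
    rw [Finset.sum_comm]
    refine Finset.sum_congr rfl fun k _ => ?_
    rw [clm_eq_sum _ v, Finset.sum_mul]
    exact Finset.sum_congr rfl fun l _ => by ring
  have h3 : P.K * ((v i * c) * h j - (h i * c) * v j)
      = ∑ k, ∑ l, P.K * ((if i = k then 1 else 0) * (if j = l then 1 else 0)
      - (if i = l then 1 else 0) * (if j = k then 1 else 0)) * (h l * (v k * c)) := by
    have h4 : ∀ k l, P.K * ((if i = k then (1 : ℝ) else 0) * (if j = l then 1 else 0)
      - (if i = l then 1 else 0) * (if j = k then 1 else 0)) * (h l * (v k * c))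
      = (if i = k then (if j = l then P.K * (h l * (v k * c)) else 0) else 0)
        - (if j = k then (if i = l then P.K * (h l * (v k * c)) else 0) else 0) := by
      intro k l
      split_ifs <;> ring
    simp only [h4, Finset.sum_sub_distrib, Finset.sum_ite_irrel, Finset.sum_const_zero,
      Finset.sum_ite_eq, Finset.mem_univ, if_true]
    ring
  rw [h1, h2, h3, ← Finset.sum_sub_distrib, ← Finset.sum_add_distrib]
  refine Finset.sum_congr rfl fun k _ => ?_
  rw [← Finset.sum_sub_distrib, ← Finset.sum_add_distrib]
  refine Finset.sum_congr rfl fun l _ => ?_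
  unfold Coeffs.curv
  ring

theorem hasDerivAt_comp_field (hUo : IsOpen U) {g : (Fin N → ℝ) → ℝ} (hg : ContDiffOn ℝ ∞ g U)
    {u : ℝ → Fin N → ℝ} (hu : IsField U u) (x : ℝ) :
    HasDerivAt (fun y => g (u y)) (fderiv ℝ g (u x) (dd u x)) x := by
  have h1 : HasDerivAt u (dd u x) x := hasDerivAt_pi.2 fun i => hu.isTest.hasDerivAt x i
  have h2 : HasFDerivAt g (fderiv ℝ g (u x)) (u x) :=
    ((hg.differentiableOn (by simp)).differentiableAt (hUo.mem_nhds (hu.mem x))).hasFDerivAt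
  exact h2.comp_hasDerivAt x h1

theorem cc_symmPart (hUo : IsOpen U) (hP : P.SmoothOn U) {u h a b : ℝ → Fin N → ℝ}
    (hu : IsField U u) (hh : IsVariation h) (ha : IsTest a) (hb : IsTest b) :
    CC (P.symmPart u h a b) :=
  CC.sum _ fun i _ => CC.sum _ fun j _ =>
    (CC.mul_left (continuous_fderiv_field hUo (hP.g i j) hu hh.smooth.continuous)
      (CC.mul_left (ha.continuous i) (hb.cc_dd j))).sub
    (CC.sum _ fun k _ => CC.mul_left (hP.continuous_b hu i j k) ((hh.cc k).mul_right
      (((ha.cc_dd i).cont.mul (hb.continuous j)).add ((ha.continuous i).mul (hb.cc_dd j).cont))))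

theorem continuousOn_curv (hUo : IsOpen U) (hP : P.SmoothOn U) (i j k l : Fin N) :
    ContinuousOn (fun p => P.curv p i j k l) U := by
  have h1 : ∀ k l, ContinuousOn (fun p => fderiv ℝ (fun p => P.b p i j k) p (Pi.single l 1)) U :=
    fun k l => ((hP.b i j k).continuousOn_fderiv_of_isOpen hUo (by simp)).clm_apply
      continuousOn_const
  exact ((h1 k l).sub (h1 l k)).add continuousOn_const

theorem cc_curvPart (hUo : IsOpen U) (hP : P.SmoothOn U) {u h a b : ℝ → Fin N → ℝ}
    (hu : IsField U u) (hh : IsVariation h) (ha : IsTest a) (hb : IsTest b) :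
    CC (P.curvPart u h a b) :=
  CC.sum _ fun i _ => CC.sum _ fun j _ => CC.sum _ fun k _ => CC.sum _ fun l _ =>
    CC.mul_left (continuousOn_univ.1 ((continuousOn_curv hUo hP i j k l).comp
      hu.smooth.continuous.continuousOn fun x _ => hu.mem x)) ((hh.cc l).mul_right
      ((hu.isTest.cc_dd k).cont.mul ((ha.continuous i).mul (hb.continuous j))))

theorem contDiff_dot {h a : ℝ → Fin N → ℝ} (hh : IsTest h) (ha : IsTest a) :
    ContDiff ℝ ∞ (dot h a) := ContDiff.sum fun i _ => (hh.comp i).mul (ha.comp i)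

theorem deriv_dot {h a : ℝ → Fin N → ℝ} (hh : IsTest h) (ha : IsTest a) :
    deriv (dot h a) = fun x => dot (dd h) a x + dot (dd a) h x := by
  funext x
  have h1 := HasDerivAt.fun_sum (u := Finset.univ) fun i _ =>
    (hh.hasDerivAt x i).mul (ha.hasDerivAt x i)
  refine h1.deriv.trans ?_
  simp only [dot, ← Finset.sum_add_distrib]
  exact Finset.sum_congr rfl fun i _ => by ring

/-- Integration by parts under (d/dx)⁻¹: the operator undoes the derivative of h·a and leaves a
local term. -/
theorem nl_dd_dot {h a : ℝ → Fin N → ℝ} (hh : IsVariation h) (ha : IsTest a) {f : ℝ → ℝ}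
    (hf : CC f) : nl f (dot (dd h) a) = (∫ x, f x * dot h a x) - nl f (dot (dd a) h) := by
  rw [← nl_deriv_right f ((contDiff_dot hh.isTest ha).of_le (by simp)) (cc_dot_left hh ha).supp,
    deriv_dot hh.isTest ha, nl_add_right hf (cc_dot_left hh.isTest.isVariation_dd ha)
      (cc_dot_left ha.isVariation_dd hh.isTest)]
  ring

/-- The variation of the bilinear form, after integration by parts. -/
theorem tau_eq (hUo : IsOpen U) (hP : P.SmoothOn U) {u h a b : ℝ → Fin N → ℝ}
    (hu : IsField U u) (hh : IsVariation h) (ha : IsTest a) (hb : IsTest b) :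
    P.tau u h a b = (∫ x, P.symmPart u h a b x) + (∫ x, P.curvPart u h a b x)
      + P.K * (nl (dot (dd u) b) (dot (dd a) h) - nl (dot (dd u) a) (dot (dd b) h)) := by
  -- Subtracting the total derivative of `W` removes h_x from the local part.
  set W : ℝ → ℝ := fun x => ∑ i, ∑ j, ∑ k, P.b (u x) i j k * (h x k * (a x i * b x j)) with hW
  have hWs : ContDiff ℝ ∞ W := ContDiff.sum fun i _ => ContDiff.sum fun j _ =>
    ContDiff.sum fun k _ => (contDiff_comp_field (hP.b i j k) hu).mul
      ((hh.isTest.comp k).mul ((ha.comp i).mul (hb.comp j)))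
  have hWc : CC W := CC.sum _ fun i _ => CC.sum _ fun j _ => CC.sum _ fun k _ =>
    CC.mul_left (hP.continuous_b hu i j k) ((hh.cc k).mul_right
      ((ha.continuous i).mul (hb.continuous j)))
  have hua := cc_dot_left hu.isTest.isVariation_dd ha
  have hub := cc_dot_left hu.isTest.isVariation_dd hb
  have hha := cc_dot_left hh ha
  have hhb := cc_dot_left hh hb
  -- Completing the antisymmetrised derivatives of b to `curv` costs the last term. Its integral is
  -- cancelled by the local terms that `nl_dd_dot` produces.
  have hpt : ∀ x, P.tauLoc u h a b x = deriv W x + P.symmPart u h a b x + P.curvPart u h a b x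
      - P.K * (dot (dd u) a x * dot h b x - dot (dd u) b x * dot h a x) := by
    intro x
    have h1 := HasDerivAt.fun_sum (u := Finset.univ) fun i _ => HasDerivAt.fun_sum
      (u := Finset.univ) fun j _ => HasDerivAt.fun_sum (u := Finset.univ) fun k _ =>
      (hasDerivAt_comp_field hUo (hP.b i j k) hu x).mul ((hh.isTest.hasDerivAt x k).mul
        ((ha.hasDerivAt x i).mul (hb.hasDerivAt x j)))
    have h2 : dot (dd u) a x * dot h b x - dot (dd u) b x * dot h a x
        = ∑ i, ∑ j, ((dd u x i * (a x i * b x j)) * h x j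
          - (h x i * (a x i * b x j)) * dd u x j) := by
      simp only [dot, Finset.sum_sub_distrib]
      rw [Finset.sum_mul_sum, mul_comm (∑ i, dd u x i * b x i), Finset.sum_mul_sum]
      refine congrArg₂ _ ?_ ?_ <;>
      exact Finset.sum_congr rfl fun i _ => Finset.sum_congr rfl fun j _ => by ring
    rw [show deriv W x = _ from h1.deriv, h2]
    simp only [Pi.mul_apply, Coeffs.tauLoc, Coeffs.symmPart, Coeffs.curvPart, curv_sum, Finset.mul_sum,
      ← Finset.sum_add_distrib, ← Finset.sum_sub_distrib]
    refine Finset.sum_congr rfl fun i _ => Finset.sum_congr rfl fun j _ => ?_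
    simp only [Finset.sum_add_distrib, mul_add, Finset.sum_sub_distrib]
    ring
  have hsp := cc_symmPart hUo hP hu hh ha hb
  have hcp := cc_curvPart hUo hP hu hh ha hb
  have hWd := CC.deriv (hWs.of_le (by simp)) hWc.supp
  have h1 := hua.mul_right hhb.cont
  have h2 := hub.mul_right hha.cont
  unfold Coeffs.tau
  simp only [hpt]
  rw [integral_sub ((hWd.add hsp).add hcp).integrable ((h1.sub h2).integrable.const_mul _),
    integral_add (hWd.add hsp).integrable hcp.integrable,
    integral_add hWd.integrable hsp.integrable,
    integral_deriv_eq_zero (hWs.of_le (by simp)) hWc.supp, integral_const_mul,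
    integral_sub h1.integrable h2.integrable, nl_antisymm (cc_dot_left hh.isTest.isVariation_dd ha) hub,
    nl_dd_dot hh ha hub, nl_dd_dot hh hb hua]
  ring

/-! ### Localization -/

/-- A fixed bump function. -/
def bump : ContDiffBump (0 : ℝ) := ⟨1, 2, one_pos, one_lt_two⟩

theorem contDiff_bump : ContDiff ℝ ∞ (fun x => bump x) := bump.contDiff

theorem cc_deriv_bump : CC (deriv fun x => bump x) :=
  CC.deriv (bump.contDiff) bump.hasCompactSupport

theorem contDiff_deriv_bump : ContDiff ℝ ∞ (deriv fun x => bump x) :=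
  (contDiff_infty_iff_deriv.1 contDiff_bump).2

theorem hasDerivAt_bump (x : ℝ) : HasDerivAt (fun x => bump x) (deriv (fun x => bump x) x) x :=
  (contDiff_bump.differentiable (by simp) x).hasDerivAt

theorem exists_deriv_bump_ne_zero : ∃ x, deriv (fun x => bump x) x ≠ 0 := by
  by_contra! h
  -- The point 3 lies beyond the outer radius 2 of the bump, while its value at 0 is 1.
  have h1 := is_const_of_deriv_eq_zero (contDiff_bump.differentiable (by simp)) h 0 3
  have h2 : bump (0 : ℝ) = 1 := bump.one_of_mem_closedBall (by simp [bump])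
  have h3 : bump (3 : ℝ) = 0 := bump.zero_of_le_dist (by simp [bump]; norm_num)
  simp [h2, h3] at h1

/-- The field `p + ε φ(x) v`, where `φ` is the bump function. -/
def bumpField (p v : Fin N → ℝ) (ε : ℝ) (x : ℝ) : Fin N → ℝ := p + (ε * bump x) • v

theorem isVariation_bump (v : Fin N → ℝ) : IsVariation (fun x => bump x • v) :=
  ⟨contDiff_bump.smul contDiff_const, bump.hasCompactSupport.smul_right⟩

theorem isVariation_deriv_bump (v : Fin N → ℝ) :
    IsVariation (fun x => deriv (fun x => bump x) x • v) :=
  ⟨contDiff_deriv_bump.smul contDiff_const, cc_deriv_bump.supp.smul_right⟩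

theorem dd_bump (v : Fin N → ℝ) :
    dd (fun x => bump x • v) = fun x => deriv (fun x => bump x) x • v := by
  funext x i
  exact ((hasDerivAt_bump x).mul_const (v i)).deriv

theorem isTest_bumpField (p v : Fin N → ℝ) (ε : ℝ) : IsTest (bumpField p v ε) := by
  have h1 := (vfam_line (isTest_const p) (isVariation_bump v).isTest).choose_spec.isTest
    (Set.mem_univ ε)
  convert! h1 using 1
  funext x
  simp [bumpField, mul_smul]

theorem dd_bumpField (p v : Fin N → ℝ) (ε : ℝ) :
    dd (bumpField p v ε) = fun x => (ε * deriv (fun x => bump x) x) • v := by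
  funext x i
  exact (((((hasDerivAt_bump x).const_mul ε)).mul_const (v i)).const_add (p i)).deriv

/-- A continuous function on an open set vanishes at `p` if its integrals along small bumps at `p` do. -/
theorem eq_zero_of_integral_bump (hUo : IsOpen U) {C : (Fin N → ℝ) → ℝ} (hC : ContinuousOn C U)
    {p : Fin N → ℝ} (hp : p ∈ U) (v : Fin N → ℝ)
    (h : ∀ ε : ℝ, ε ≠ 0 → IsField U (bumpField p v ε) →
      ∫ x, C (bumpField p v ε x) * deriv (fun x => bump x) x ^ 2 = 0) : C p = 0 := by
  by_contra hne
  -- The factor `C p` fixes the sign: near `p` the product with `C` is positive, so the integral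
  -- against a square cannot vanish.
  have hpos : 0 < C p * C p := mul_self_pos.2 hne
  have hcont : ContinuousAt (fun q => C p * C q) p :=
    continuousAt_const.mul (hC.continuousAt (hUo.mem_nhds hp))
  obtain ⟨δ, hδ, hball⟩ := Metric.eventually_nhds_iff.1
    ((hcont.eventually (lt_mem_nhds hpos)).and (hUo.mem_nhds hp))
  -- The bump is at most 1, so the field stays within δ/2 of `p`. The added 1 allows v = 0.
  set ε : ℝ := δ / (2 * (‖v‖ + 1)) with hε
  have hv : 0 < ‖v‖ + 1 := by positivity
  have hε0 : 0 < ε := by positivity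
  have hin : ∀ x, 0 < C p * C (bumpField p v ε x) ∧ bumpField p v ε x ∈ U := by
    intro x
    refine hball ?_
    rw [bumpField, dist_eq_norm, add_sub_cancel_left, norm_smul, Real.norm_eq_abs,
      abs_of_nonneg (mul_nonneg hε0.le bump.nonneg)]
    have h1 : ε * bump x * ‖v‖ ≤ ε * 1 * (‖v‖ + 1) := by
      gcongr
      · exact bump.le_one
      · linarith
    have h2 : ε * (‖v‖ + 1) = δ / 2 := by rw [hε]; field_simp
    linarith
  have hf : IsField U (bumpField p v ε) := (isTest_bumpField p v ε).isField fun x => (hin x).2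
  have hcc : Continuous (fun x => C (bumpField p v ε x)) :=
    continuousOn_univ.1 (hC.comp hf.smooth.continuous.continuousOn fun x _ => hf.mem x)
  have hc2 : CC (fun x => C p * C (bumpField p v ε x) * deriv (fun x => bump x) x ^ 2) := by
    have := CC.mul_left (continuous_const.mul hcc) (f := fun x => C p * C (bumpField p v ε x))
      (cc_deriv_bump.mul_right cc_deriv_bump.cont)
    simpa only [sq] using this
  obtain ⟨x₀, hx₀⟩ := exists_deriv_bump_ne_zero
  have h3 := hc2.cont.integral_pos_of_hasCompactSupport_nonneg_nonzero (μ := volume) hc2.supp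
    (fun x => mul_nonneg (hin x).1.le (sq_nonneg _)) (x := x₀)
    (mul_pos (hin x₀).1 (pow_pos (abs_pos.2 hx₀) 2 |>.trans_eq (sq_abs _))).ne'
  have h4 := h ε hε0.ne' hf
  simp only [mul_assoc] at h3
  rw [integral_const_mul, h4, mul_zero] at h3
  exact lt_irrefl _ h3

/-- Skew-symmetry of the bracket: the coefficients `b` are the Christoffel symbols of a metric connection. -/
theorem fderiv_g_eq (hUo : IsOpen U) (hP : P.SmoothOn U)
    (hskew : ∀ u a b, IsField U u → IsTest a → IsTest b → P.bil u a b = - P.bil u b a)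
    {p : Fin N → ℝ} (hp : p ∈ U) (i j k : Fin N) :
    fderiv ℝ (fun p => P.g p i j) p (Pi.single k 1) = P.b p i j k + P.b p j i k := by
  have hC : ContinuousOn (fun p => P.b p j i k + P.b p i j k
      - fderiv ℝ (fun p => P.g p i j) p (Pi.single k 1)) U :=
    ((hP.b j i k).continuousOn.add (hP.b i j k).continuousOn).sub
      (((hP.g i j).continuousOn_fderiv_of_isOpen hUo (by simp)).clm_apply continuousOn_const)
  have h0 := eq_zero_of_integral_bump hUo hC hp (Pi.single k 1) (fun ε hε hu => ?_)
  · linarith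
  set u := bumpField p (Pi.single k 1) ε with hu'
  -- With φ the bump, a = φ' e_j, b = e_i and u_x = ε φ' e_k, every b-term carries φ'². The g-term
  -- is g^{ij} φ'', which an integration by parts turns into ∂_k g^{ij} φ'².
  set a : ℝ → Fin N → ℝ := fun x => deriv (fun x => bump x) x • Pi.single j 1 with ha'
  set b : ℝ → Fin N → ℝ := fun _ => Pi.single i 1 with hb'
  have ha : IsTest a := (isVariation_deriv_bump _).isTest
  have hb : IsTest b := isTest_const _
  have hsk := hskew u a b hu ha hb
  have hdu := dd_bumpField p (Pi.single k 1) ε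
  -- The nonlocal pairing is itself antisymmetric, so K drops out of the skewness relation.
  rw [bil_eq hP hu ha hb, bil_eq hP hu hb ha,
    nl_antisymm (cc_dot_left hu.isTest.isVariation_dd ha)
      (cc_dot_left hu.isTest.isVariation_dd hb)] at hsk
  have hda : ∀ x, dd a x j = deriv (deriv fun x => bump x) x := by
    intro x
    simp [dd, ha']
  have hda' : ∀ x l, l ≠ j → dd a x l = 0 := by
    intro x l hl
    simp [dd, ha', hl]
  have l1 : ∀ x, P.loc u a b x = ε * (P.b (u x) j i k * deriv (fun x => bump x) x ^ 2) := by
    intro x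
    rw [Coeffs.loc, Finset.sum_eq_single j, Finset.sum_eq_single i, Finset.sum_eq_single k]
    · simp [hb', ha', dd_const, hu', hdu]; ring
    · intro l _ hl; simp [hu', hdu, hl]
    · simp
    · intro l _ hl; simp [hb', dd_const, hl]
    · simp
    · intro l _ hl; simp [ha', hl]
    · simp
  have l2 : ∀ x, P.loc u b a x = P.g (u x) i j * deriv (deriv fun x => bump x) x
      + ε * (P.b (u x) i j k * deriv (fun x => bump x) x ^ 2) := by
    intro x
    rw [Coeffs.loc, Finset.sum_eq_single i, Finset.sum_eq_single j, Finset.sum_eq_single k]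
    · rw [hda]; simp [hb', ha', hu', hdu]; ring
    · intro l _ hl; simp [hu', hdu, hl]
    · simp
    · intro l _ hl; rw [hda' x l hl]; simp [ha', hl]
    · simp
    · intro l _ hl; simp [hb', hl]
    · simp
  have hg : ContDiff ℝ ∞ (fun x => P.g (u x) i j * deriv (fun x => bump x) x) :=
    (contDiff_comp_field (hP.g i j) hu).mul contDiff_deriv_bump
  have l3 : ∀ x, deriv (fun x => P.g (u x) i j * deriv (fun x => bump x) x) x
      = ε * (fderiv ℝ (fun p => P.g p i j) (u x) (Pi.single k 1) * deriv (fun x => bump x) x ^ 2)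
        + P.g (u x) i j * deriv (deriv fun x => bump x) x := by
    intro x
    have h1 := (hasDerivAt_comp_field hUo (hP.g i j) hu x).mul
      ((contDiff_deriv_bump.differentiable (by simp)) x).hasDerivAt
    refine h1.deriv.trans ?_
    rw [hu', hdu, map_smul, smul_eq_mul]
    ring
  have hi0 := integral_deriv_eq_zero (hg.of_le (by simp))
    (CC.mul_left (contDiff_comp_field (hP.g i j) hu).continuous cc_deriv_bump).supp
  have hsq : ∀ {c : ℝ → ℝ}, Continuous c → CC (fun x => c x * deriv (fun x => bump x) x ^ 2) := by
    intro c hc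
    have := CC.mul_left hc (cc_deriv_bump.mul_right cc_deriv_bump.cont)
    simpa only [sq] using this
  have c1 := hsq (hP.continuous_b hu j i k)
  have c2 := hsq (hP.continuous_b hu i j k)
  have c3 := hsq (continuous_fderiv_field hUo (hP.g i j) hu
    (h := fun _ => Pi.single k 1) continuous_const)
  have c4 : CC (fun x => P.g (u x) i j * deriv (deriv fun x => bump x) x) :=
    CC.mul_left (contDiff_comp_field (hP.g i j) hu).continuous
      (CC.deriv (contDiff_deriv_bump.of_le (by simp)) cc_deriv_bump.supp)
  simp only [l3] at hi0
  rw [integral_add (c3.integrable.const_mul ε) c4.integrable, integral_const_mul] at hi0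
  simp only [l1, l2] at hsk
  rw [integral_add c4.integrable (c2.integrable.const_mul ε), integral_const_mul,
    integral_const_mul] at hsk
  simp only [sub_mul, add_mul]
  rw [integral_sub (c1.add c2).integrable c3.integrable, integral_add c1.integrable c2.integrable]
  refine mul_left_cancel₀ hε ?_
  linear_combination hsk - hi0

/-! ### The curvature and symmetry conditions -/

/-- In `tau_eq` all terms except the curvature contain a derivative of a test function. -/
theorem tau_const (hUo : IsOpen U) (hP : P.SmoothOn U) {u h : ℝ → Fin N → ℝ}
    (hu : IsField U u) (hh : IsVariation h) (v w : Fin N → ℝ) :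
    P.tau u h (fun _ => v) (fun _ => w) = ∫ x, P.curvPart u h (fun _ => v) (fun _ => w) x := by
  rw [tau_eq hUo hP hu hh (isTest_const v) (isTest_const w)]
  simp [Coeffs.symmPart, dd_const, dot_zero_left, nl_zero_right]

theorem curvPart_single (u h : ℝ → Fin N → ℝ) (i j : Fin N) (x : ℝ) :
    P.curvPart u h (fun _ => Pi.single i 1) (fun _ => Pi.single j 1) x
      = ∑ k, ∑ l, P.curv (u x) i j k l * (h x l * dd u x k) := by
  rw [Coeffs.curvPart, Finset.sum_eq_single i, Finset.sum_eq_single j]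
  · simp
  · intro l _ hl; simp [hl]
  · simp
  · intro l _ hl; simp [hl]
  · simp

/-- The vanishing of the variations between constant test functions implies that of the curvature. -/
theorem curv_eq_zero (hUo : IsOpen U) (hP : P.SmoothOn U) (i j : Fin N)
    (h : ∀ u h, IsField U u → IsVariation h →
      P.tau u (dd h) (fun _ => Pi.single i 1) (fun _ => Pi.single j 1) = 0)
    {p : Fin N → ℝ} (hp : p ∈ U) (k l : Fin N) : P.curv p i j k l = 0 := by
  refine eq_zero_of_integral_bump hUo (continuousOn_curv hUo hP i j k l) hp (Pi.single k 1)
    fun ε hε hu => ?_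
  -- The directions at hand are x-derivatives, like the Hamiltonian fields η c_x. Here the direction
  -- is φ' e_l and u_x = ε φ' e_k, so the integrand is ε times the curvature times φ'².
  have h1 := h _ _ hu (isVariation_bump (Pi.single l 1))
  rw [tau_const hUo hP hu (isVariation_bump _).isTest.isVariation_dd] at h1
  have h2 : ∀ x, P.curvPart (bumpField p (Pi.single k 1) ε) (dd fun x => bump x • Pi.single l 1)
      (fun _ => Pi.single i 1) (fun _ => Pi.single j 1) x
      = ε * (P.curv (bumpField p (Pi.single k 1) ε x) i j k l * deriv (fun x => bump x) x ^ 2) := by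
    intro x
    rw [curvPart_single, Finset.sum_eq_single k, Finset.sum_eq_single l, dd_bump, dd_bumpField]
    · simp; ring
    · intro m _ hm; simp [dd_bump, hm]
    · simp
    · intro m _ hm; simp [dd_bumpField, hm]
    · simp
  simp only [h2] at h1
  rw [integral_const_mul] at h1
  exact (mul_eq_zero.1 h1).resolve_left hε

theorem dd_mulVec (m : Matrix (Fin N) (Fin N) ℝ) {a : ℝ → Fin N → ℝ} (ha : IsTest a) :
    dd (fun x => m.mulVec (a x)) = fun x => m.mulVec (dd a x) := by
  funext x i
  exact (HasDerivAt.fun_sum (u := Finset.univ) fun j _ =>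
    (ha.hasDerivAt x j).const_mul (m i j)).deriv

theorem IsTest.mulVec (m : Matrix (Fin N) (Fin N) ℝ) {a : ℝ → Fin N → ℝ} (ha : IsTest a) :
    IsTest (fun x => m.mulVec (a x)) := by
  obtain ⟨R, hR⟩ := ha.const
  refine ⟨contDiff_pi.2 fun i => ?_, R, fun x y hx hy => ?_⟩
  · change ContDiff ℝ ∞ fun x => ∑ j, m i j * a x j
    exact ContDiff.sum fun j _ => contDiff_const.mul (ha.comp j)
  simp only [hR x y hx hy]

theorem IsVariation.mulVec (m : Matrix (Fin N) (Fin N) ℝ) {a : ℝ → Fin N → ℝ}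
    (ha : IsVariation a) : IsVariation (fun x => m.mulVec (a x)) :=
  ⟨(ha.isTest.mulVec m).smooth,
    ha.compact.comp_left (g := fun v : Fin N → ℝ => m.mulVec v) (by simp)⟩

/-- Inserting ∂_k g^{ij} = b^{ij}_k + b^{ji}_k cancels the terms b^{ij}_k h^k a_i (b_j)_x and leaves
an expression antisymmetric in the two test functions. -/
theorem symmPart_eq {u h a b : ℝ → Fin N → ℝ} {x : ℝ}
    (hg : ∀ i j k, fderiv ℝ (fun p => P.g p i j) (u x) (Pi.single k 1)
      = P.b (u x) i j k + P.b (u x) j i k) :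
    P.symmPart u h a b x = (∑ i, ∑ j, ∑ k, P.b (u x) j i k * (h x k * (a x i * dd b x j)))
      - ∑ i, ∑ j, ∑ k, P.b (u x) j i k * (h x k * (b x i * dd a x j)) := by
  rw [Finset.sum_comm (s := Finset.univ) (t := Finset.univ)
    (f := fun i j => ∑ k, P.b (u x) j i k * (h x k * (b x i * dd a x j)))]
  simp only [Coeffs.symmPart, ← Finset.sum_sub_distrib]
  refine Finset.sum_congr rfl fun i _ => Finset.sum_congr rfl fun j _ => ?_
  rw [clm_eq_sum, Finset.sum_mul, ← Finset.sum_sub_distrib]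
  refine Finset.sum_congr rfl fun k _ => ?_
  rw [hg]
  ring

/-- The symmetry condition `η^{ls} b^{ji}_l = η^{lj} b^{si}_l`. -/
def Coeffs.SymmCond (P : Coeffs N) (η : Matrix (Fin N) (Fin N) ℝ) (p : Fin N → ℝ) : Prop :=
  ∀ i j s, ∑ l, η l s * P.b p j i l = ∑ l, η l j * P.b p s i l

/-- At a constant field the curvature and nonlocal parts vanish. With the test functions e_i, φ e_j
and φ e_s, what is left of the Jacobi sum is the defect of the symmetry condition times ∫ φ'². -/
theorem symmCond_of_jac (hUo : IsOpen U) (hP : P.SmoothOn U)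
    (hg : ∀ p ∈ U, ∀ i j k, fderiv ℝ (fun p => P.g p i j) p (Pi.single k 1)
      = P.b p i j k + P.b p j i k) {η : Matrix (Fin N) (Fin N) ℝ}
    (h : ∀ u a b c, IsField U u → IsTest a → IsTest b → IsTest c →
      P.jac (Coeffs.const η) u a b c = 0) {p : Fin N → ℝ} (hp : p ∈ U) : P.SymmCond η p := by
  intro i j s
  have hu : IsField U (fun _ => p) := (isTest_const p).isField fun _ => hp
  have hj := h (fun _ => p) (fun _ => Pi.single i 1) (fun x => bump x • Pi.single j 1)
    (fun x => bump x • Pi.single s 1) hu (isTest_const _) (isVariation_bump _).isTest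
    (isVariation_bump _).isTest
  have h0 : (fun _ : ℝ => η.mulVec (0 : Fin N → ℝ)) = 0 := by funext x; simp
  have hv : ∀ s, IsVariation (fun x => η.mulVec (deriv (fun x => bump x) x • Pi.single s 1)) :=
    fun s => (isVariation_deriv_bump _).mulVec η
  simp only [Coeffs.jac, apply_const, dd_const, dd_bump, Pi.zero_apply, h0, tau_zero] at hj
  rw [tau_eq hUo hP hu (hv s) (isTest_const _) (isVariation_bump _).isTest,
    tau_eq hUo hP hu (hv j) (isVariation_bump _).isTest (isTest_const _)] at hj
  have hs : ∀ x h a b, P.symmPart (fun _ => p) h a b x = _ := fun x h a b =>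
    symmPart_eq (P := P) (u := fun _ => p) (x := x) (h := h) (a := a) (b := b) (hg p hp)
  have hmv : ∀ x k s, η.mulVec (deriv (fun x => bump x) x • Pi.single s 1) k
      = η k s * deriv (fun x => bump x) x := by
    intro x k s
    rw [Matrix.mulVec_smul, Pi.smul_apply, Matrix.mulVec_single_one, smul_eq_mul, mul_comm]
    rfl
  have e1 : ∀ (x : ℝ) (j s : Fin N), (∑ i', ∑ j', ∑ k, P.b p j' i' k
      * (η.mulVec (deriv (fun x => bump x) x • Pi.single s 1) k * ((Pi.single i 1 : Fin N → ℝ) i'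
        * (deriv (fun x => bump x) x • (Pi.single j 1 : Fin N → ℝ)) j')))
      = (∑ l, η l s * P.b p j i l) * deriv (fun x => bump x) x ^ 2 := by
    intro x j s
    rw [Finset.sum_eq_single i, Finset.sum_eq_single j, Finset.sum_mul]
    · refine Finset.sum_congr rfl fun k _ => ?_
      rw [hmv]; simp; ring
    · intro l _ hl; simp [hl]
    · simp
    · intro l _ hl; simp [hl]
    · simp
  simp only [hs, dd_const, dd_bump, Coeffs.curvPart, dot_zero_left, nl_zero_left, Pi.zero_apply,
    mul_zero, zero_mul, Finset.sum_const_zero, sub_zero, integral_zero, add_zero, zero_sub,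
    e1, integral_neg, integral_const_mul] at hj
  have hne : ∫ x, deriv (fun x => bump x) x ^ 2 ≠ 0 := by
    obtain ⟨x₀, hx₀⟩ := exists_deriv_bump_ne_zero
    have hcc := cc_deriv_bump.mul_right cc_deriv_bump.cont
    simp only [← sq] at hcc
    exact (hcc.cont.integral_pos_of_hasCompactSupport_nonneg_nonzero (μ := volume) hcc.supp
      (fun x => sq_nonneg _) (x := x₀) (pow_ne_zero 2 hx₀)).ne'
  have hfin : ((∑ l, η l s * P.b p j i l) - ∑ l, η l j * P.b p s i l)
      * ∫ x, deriv (fun x => bump x) x ^ 2 = 0 := by linear_combination hj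
  exact sub_eq_zero.1 ((mul_eq_zero.1 hfin).resolve_right hne)

/-- The local part is M(a, b, c) - M(b, a, c) with M symmetric in its last two arguments by the
symmetry condition, so its cyclic sum telescopes to zero. -/
theorem jac_const_eq_zero (hUo : IsOpen U) (hP : P.SmoothOn U)
    (hg : ∀ p ∈ U, ∀ i j k, fderiv ℝ (fun p => P.g p i j) p (Pi.single k 1)
      = P.b p i j k + P.b p j i k) {η : Matrix (Fin N) (Fin N) ℝ} (hη : η.IsSymm)
    (hcurv : ∀ p ∈ U, ∀ i j k l, P.curv p i j k l = 0) (hsymm : ∀ p ∈ U, P.SymmCond η p)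
    {u a b c : ℝ → Fin N → ℝ} (hu : IsField U u) (ha : IsTest a) (hb : IsTest b)
    (hc : IsTest c) : P.jac (Coeffs.const η) u a b c = 0 := by
  have hcp : ∀ h a b x, P.curvPart u h a b x = 0 := fun h a b x => by
    simp [Coeffs.curvPart, hcurv _ (hu.mem x)]
  have hv : ∀ {a}, IsTest a → IsVariation (fun x => η.mulVec (dd a x)) := fun ha =>
    ha.isVariation_dd.mulVec η
  -- The density a_x · η c_x is symmetric in a and c, which cancels the six nonlocal terms in pairs.
  have hdot : ∀ a c : ℝ → Fin N → ℝ, dot (dd a) (fun x => η.mulVec (dd c x))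
      = dot (dd c) (fun x => η.mulVec (dd a x)) := by
    intro a c
    funext x
    change dd a x ⬝ᵥ η.mulVec (dd c x) = dd c x ⬝ᵥ η.mulVec (dd a x)
    rw [Matrix.dotProduct_mulVec, ← Matrix.mulVec_transpose, hη.eq, dotProduct_comm]
  set M : (ℝ → Fin N → ℝ) → (ℝ → Fin N → ℝ) → (ℝ → Fin N → ℝ) → ℝ → ℝ := fun a b c x =>
    ∑ i, ∑ j, ∑ k, P.b (u x) j i k * (η.mulVec (dd c x) k * (a x i * dd b x j)) with hM
  have hMs : ∀ a b c x, M a b c x = M a c b x := by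
    intro a b c x
    have h1 : ∀ b c, M a b c x = ∑ i, ∑ j, ∑ s, (∑ k, η k s * P.b (u x) j i k)
        * (a x i * dd b x j * dd c x s) := by
      intro b c
      refine Finset.sum_congr rfl fun i _ => Finset.sum_congr rfl fun j _ => ?_
      simp only [Matrix.mulVec, dotProduct, Finset.sum_mul, Finset.mul_sum]
      rw [Finset.sum_comm]
      exact Finset.sum_congr rfl fun s _ => Finset.sum_congr rfl fun k _ => by ring
    rw [h1, h1]
    refine Finset.sum_congr rfl fun i _ => ?_
    rw [Finset.sum_comm]
    refine Finset.sum_congr rfl fun s _ => Finset.sum_congr rfl fun j _ => ?_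
    rw [hsymm _ (hu.mem x) i j s]
    ring
  have hsp : ∀ a b c x, P.symmPart u (fun x => η.mulVec (dd c x)) a b x = M a b c x - M b a c x :=
    fun a b c x => symmPart_eq (hg _ (hu.mem x))
  have ccs : ∀ {a b c}, IsTest a → IsTest b → IsTest c →
      CC (P.symmPart u (fun x => η.mulVec (dd c x)) a b) := fun ha hb hc =>
    cc_symmPart hUo hP hu (hv hc) ha hb
  have hint : (∫ x, P.symmPart u (fun x => η.mulVec (dd c x)) a b x)
      + (∫ x, P.symmPart u (fun x => η.mulVec (dd a x)) b c x)
      + (∫ x, P.symmPart u (fun x => η.mulVec (dd b x)) c a x) = 0 := by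
    rw [← integral_add (ccs ha hb hc).integrable (ccs hb hc ha).integrable,
      ← integral_add ((ccs ha hb hc).add (ccs hb hc ha)).integrable (ccs hc ha hb).integrable]
    rw [← integral_zero ℝ ℝ]
    congr 1
    funext x
    simp only [hsp]
    rw [hMs a b c, hMs b a c, hMs c a b]
    ring
  simp only [Coeffs.jac, apply_const]
  rw [tau_eq hUo hP hu (hv hc) ha hb, tau_eq hUo hP hu (hv ha) hb hc,
    tau_eq hUo hP hu (hv hb) hc ha, hdot a c, hdot b a, hdot c b]
  simp only [hcp, integral_zero]
  linear_combination hint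

/-! ### Integrals of closed forms along fields -/

/-- The integral of the 1-form `θ_k du^k` along a field. -/
def formInt (θ : (Fin N → ℝ) → Fin N → ℝ) (u : ℝ → Fin N → ℝ) : ℝ :=
  ∫ x, ∑ k, θ (u x) k * dd u x k

/-- Closedness of a 1-form on `U`. -/
def ClosedForm (U : Set (Fin N → ℝ)) (θ : (Fin N → ℝ) → Fin N → ℝ) : Prop :=
  ∀ p ∈ U, ∀ k l, fderiv ℝ (fun p => θ p k) p (Pi.single l 1)
    = fderiv ℝ (fun p => θ p l) p (Pi.single k 1)

/-- The operator with `b^{ij}_k = θ_k` and all other coefficients zero. -/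
def formCoeffs (θ : (Fin N → ℝ) → Fin N → ℝ) : Coeffs N where
  g := fun _ _ _ => 0
  b := fun p _ _ k => θ p k
  K := 0

theorem smoothOn_formCoeffs {θ : (Fin N → ℝ) → Fin N → ℝ}
    (hθ : ∀ k, ContDiffOn ℝ ∞ (fun p => θ p k) U) : (formCoeffs θ).SmoothOn U :=
  ⟨fun _ _ => contDiffOn_const, fun _ _ k => hθ k⟩

theorem loc_single (P : Coeffs N) (u b : ℝ → Fin N → ℝ) (i : Fin N) (x : ℝ) :
    P.loc u (fun _ => Pi.single i 1) b x
      = ∑ j, (P.g (u x) i j * dd b x j + ∑ k, P.b (u x) i j k * (dd u x k * b x j)) := by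
  rw [Coeffs.loc, Finset.sum_eq_single i]
  · simp
  · intro l _ hl; simp [hl]
  · simp

theorem loc_single_single (P : Coeffs N) (u : ℝ → Fin N → ℝ) (i j : Fin N) (x : ℝ) :
    P.loc u (fun _ => Pi.single i 1) (fun _ => Pi.single j 1) x
      = ∑ k, P.b (u x) i j k * dd u x k := by
  rw [loc_single, Finset.sum_eq_single j]
  · simp [dd_const]
  · intro l _ hl; simp [hl, dd_const]
  · simp

theorem bil_formCoeffs {θ : (Fin N → ℝ) → Fin N → ℝ}
    (hθ : ∀ k, ContDiffOn ℝ ∞ (fun p => θ p k) U) {u : ℝ → Fin N → ℝ} (hu : IsField U u)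
    (i : Fin N) : (formCoeffs θ).bil u (fun _ => Pi.single i 1) (fun _ => Pi.single i 1)
      = formInt θ u := by
  rw [bil_eq (smoothOn_formCoeffs hθ) hu (isTest_const _) (isTest_const _)]
  simp [loc_single_single, formCoeffs, formInt]

/-- For K = 0 the curvature is an exterior derivative. The variation formula for `bil` thus doubles
as the first variation of the integral of a 1-form. -/
theorem curv_formCoeffs (θ : (Fin N → ℝ) → Fin N → ℝ) (p : Fin N → ℝ) (i j k l : Fin N) :
    (formCoeffs θ).curv p i j k l = fderiv ℝ (fun p => θ p k) p (Pi.single l 1)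
      - fderiv ℝ (fun p => θ p l) p (Pi.single k 1) := by
  simp [Coeffs.curv, formCoeffs]

/-- A form whose integrals along all fields vanish is closed. -/
theorem closedForm_of_formInt_eq_zero (hUo : IsOpen U) {θ : (Fin N → ℝ) → Fin N → ℝ}
    (hθ : ∀ k, ContDiffOn ℝ ∞ (fun p => θ p k) U)
    (h : ∀ u, IsField U u → formInt θ u = 0) : ClosedForm U θ := by
  intro p hp k l
  have h1 := curv_eq_zero hUo (smoothOn_formCoeffs hθ) k k (fun u v hu hv => ?_) hp k l
  · rw [curv_formCoeffs] at h1
    exact sub_eq_zero.1 h1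
  · have hd := hasDerivAt_bil_line hUo (smoothOn_formCoeffs hθ) hu hv.isTest.isVariation_dd
      (isTest_const (Pi.single k 1)) (isTest_const (Pi.single k 1))
    refine hd.unique ((hasDerivAt_const (0 : ℝ) (0 : ℝ)).congr_of_eventuallyEq ?_)
    obtain ⟨O, hO, h0, hf⟩ := exists_isOpen_isField hUo hu hv.isTest.isVariation_dd
      isVariation_zero
    have hc : Continuous (fun t : ℝ => (t, (0 : ℝ))) := by fun_prop
    filter_upwards [hc.continuousAt.eventually (hO.mem_nhds h0)] with t ht
    have hut : IsField U (u + t • dd v) := by simpa using hf _ ht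
    rw [bil_formCoeffs hθ hut, h _ hut]

/-- The integral of a closed form does not change along straight segments of fields. -/
theorem formInt_eq_of_segment (hUo : IsOpen U) {θ : (Fin N → ℝ) → Fin N → ℝ}
    (hθ : ∀ k, ContDiffOn ℝ ∞ (fun p => θ p k) U) (hcl : ClosedForm U θ)
    {u h : ℝ → Fin N → ℝ} (hu : IsField U u) (hh : IsVariation h)
    (hseg : ∀ t ∈ Set.Icc (0 : ℝ) 1, ∀ x, u x + t • h x ∈ U) :
    formInt θ (u + h) = formInt θ u := by
  -- Reading the form integral off `bil` needs an index `i`; for N = 0 the sum is empty.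
  rcases isEmpty_or_nonempty (Fin N) with hN | ⟨⟨i⟩⟩
  · simp [formInt]
  have hP := smoothOn_formCoeffs hθ
  have hf : ∀ t ∈ Set.Icc (0 : ℝ) 1, IsField U (u + t • h) := fun t ht =>
    hu.add (hh.smul t) (hseg t ht)
  set e : ℝ → Fin N → ℝ := fun _ => Pi.single i 1 with he
  have hd : ∀ t ∈ Set.Icc (0 : ℝ) 1,
      HasDerivAt (fun t : ℝ => (formCoeffs θ).bil (u + t • h) e e) 0 t := by
    intro t ht
    have h1 := hasDerivAt_bil_line hUo hP (hf t ht) hh (isTest_const (Pi.single i 1))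
      (isTest_const (Pi.single i 1))
    have h2 : (formCoeffs θ).tau (u + t • h) h e e = 0 := by
      have hz : ∀ x k l, (formCoeffs θ).curv ((u + t • h) x) i i k l = 0 := fun x k l => by
        rw [curv_formCoeffs, hcl _ ((hf t ht).mem x) k l, sub_self]
      rw [he, tau_const hUo hP (hf t ht) hh]
      simp only [curvPart_single, hz, zero_mul, Finset.sum_const_zero, integral_zero]
    rw [← he, h2] at h1
    have h3 := HasDerivAt.comp_sub_const (x := t) (a := t)
      (f := fun ε : ℝ => (formCoeffs θ).bil (u + t • h + ε • h) e e) (by simpa using! h1)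
    convert! h3 using 1
    funext s
    congr 1
    module
  -- The derivative vanishes along the whole segment, so the mean value inequality with constant 0
  -- gives equality at the ends.
  have h4 := (convex_Icc (0 : ℝ) 1).norm_image_sub_le_of_norm_hasDerivWithin_le (C := 0)
    (fun t ht => (hd t ht).hasDerivWithinAt) (fun t _ => by simp)
    (Set.left_mem_Icc.2 zero_le_one) (Set.right_mem_Icc.2 zero_le_one)
  simp only [zero_mul, norm_le_zero_iff, sub_eq_zero, zero_smul, one_smul, add_zero] at h4
  have h5 : IsField U (u + h) := by simpa using hf 1 (Set.right_mem_Icc.2 zero_le_one)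
  rwa [he, bil_formCoeffs hθ h5, bil_formCoeffs hθ hu] at h4

/-- Uniform smooth approximation of a continuous curve which is constant near infinity. -/
theorem exists_smooth_approx {w : ℝ → Fin N → ℝ} (hw : Continuous w) {c : Fin N → ℝ} {R : ℝ}
    (hc : ∀ x, R ≤ |x| → w x = c) {δ : ℝ} (hδ : 0 < δ) :
    ∃ g : ℝ → Fin N → ℝ, ContDiff ℝ ∞ g ∧ (∀ x, dist (g x) (w x) ≤ δ) ∧
      HasCompactSupport (fun x => g x - c) := by
  have hcs : HasCompactSupport (fun x => w x - c) :=
    hasCompactSupport_of_abs (R := R) fun x hx => by rw [hc x hx.le, sub_self]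
  have huc : UniformContinuous w := by
    have h1 : UniformContinuous (fun x => w x - c) :=
      hcs.uniformContinuous_of_continuous (hw.sub continuous_const)
    simpa using! h1.add (uniformContinuous_const (b := c))
  obtain ⟨ε, hε, hεw⟩ := Metric.uniformContinuous_iff.1 huc δ hδ
  obtain ⟨g, hg, hgd⟩ := hw.exists_contDiff_dist_le_of_forall_mem_ball_dist_le (E := ℝ) hε
  refine ⟨g, hg, fun x => hgd x δ fun y hy => (hεw hy).le, ?_⟩
  refine hasCompactSupport_of_abs (R := R + ε) fun x hx => ?_
  -- Beyond R + ε the curve is constant on the ε-ball around `x`, so the approximation error there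
  -- is 0 and the background is kept exactly.
  have h1 := hgd x 0 fun y hy => ?_
  · rw [sub_eq_zero, dist_le_zero.1 h1, hc x (by linarith)]
  · have h2 : |x - y| < ε := by rw [← Real.dist_eq, dist_comm]; exact hy
    have h3 : |x| - |y| ≤ |x - y| := abs_sub_abs_le_abs_sub x y
    rw [hc y (by linarith), hc x (by linarith), dist_self]

open scoped unitInterval in
/-- Integrals of closed forms along fields vanish if `U` is simply connected. -/
theorem formInt_eq_zero (hUo : IsOpen U) (hUs : IsSimplyConnected U)
    {θ : (Fin N → ℝ) → Fin N → ℝ} (hθ : ∀ k, ContDiffOn ℝ ∞ (fun p => θ p k) U)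
    (hcl : ClosedForm U θ) {u : ℝ → Fin N → ℝ} (hu : IsField U u) : formInt θ u = 0 := by
  obtain ⟨R₀, hR₀⟩ := hu.isTest.const
  set R : ℝ := |R₀| + 1 with hR
  have hRpos : 0 < R := by positivity
  set c := u R with hcdef
  have hRabs : R₀ ≤ |R| := by
    rw [abs_of_pos hRpos]; linarith [le_abs_self R₀]
  have huc : ∀ x, R ≤ |x| → u x = c := fun x hx =>
    hR₀ x R (by linarith [le_abs_self R₀]) hRabs
  let γ : Path c c :=
    { toFun := fun t => u (-R + 2 * R * (t : ℝ))
      continuous_toFun := hu.smooth.continuous.comp (by fun_prop)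
      source' := by simpa using huc (-R) (by rw [abs_neg]; exact le_abs_self R)
      target' := by
        have : -R + 2 * R * ((1 : I) : ℝ) = R := by simp; ring
        rw [this] }
  obtain ⟨F, hF⟩ := (isSimplyConnected_iff_exists_homotopy_refl_forall_mem.1 hUs).2 c γ
    fun t => hu.mem _
  -- This undoes the parametrisation of the loop on [-R, R]. Clamping outside extends each stage of
  -- the homotopy by its base point `c`.
  let T : ℝ → I := fun x => Set.projIcc 0 1 zero_le_one ((x + R) / (2 * R))
  have hT : Continuous T := continuous_projIcc.comp (by fun_prop)
  let w : I → ℝ → Fin N → ℝ := fun s x => F (s, T x)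
  have hwc : ∀ s, Continuous (w s) := fun s => F.continuous.comp (by fun_prop)
  have hw_far : ∀ s x, R ≤ |x| → w s x = c := by
    intro s x hx
    rcases le_abs'.1 hx with h | h
    · have h1 : T x = 0 := Set.projIcc_of_le_left _
        (div_nonpos_of_nonpos_of_nonneg (by linarith) (by linarith))
      simp only [w, h1]
      exact F.source s
    · have h1 : T x = 1 := Set.projIcc_of_right_le _
        (by rw [le_div_iff₀ (by linarith)]; linarith)
      simp only [w, h1]
      exact F.target s
  have hw0 : ∀ x, w 0 x = u x := by
    intro x
    rcases le_or_gt R |x| with h | h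
    · rw [hw_far 0 x h, huc x h]
    · have h2 := abs_lt.1 h
      have h1 : T x = ⟨(x + R) / (2 * R), div_nonneg (by linarith) (by linarith),
          by rw [div_le_one (by linarith)]; linarith⟩ := Set.projIcc_of_mem _ _
      simp only [w, h1, ContinuousMap.HomotopyWith.apply_zero]
      change u (-R + 2 * R * ((x + R) / (2 * R))) = u x
      congr 1
      field_simp
      ring
  have hw1 : ∀ x, w 1 x = c := fun x => by
    simp only [w, ContinuousMap.HomotopyWith.apply_one]
    rfl
  obtain ⟨δ, hδ, hthick⟩ := (isCompact_range F.continuous).exists_thickening_subset_open hUo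
    (Set.range_subset_iff.2 hF)
  have hnear : ∀ s x v, dist v (w s x) < δ → v ∈ U := fun s x v hv =>
    hthick (Metric.mem_thickening_iff.2 ⟨w s x, ⟨_, rfl⟩, hv⟩)
  -- The segments used below start within d of the homotopy and have length at most 3d, so they stay
  -- within 4d < δ and hence in U.
  set d := δ / 5 with hd
  have hdpos : 0 < d := by positivity
  have hunif := CompactSpace.uniformContinuous_of_continuous F.continuous
  obtain ⟨ρ, hρ, hFρ⟩ := Metric.uniformContinuous_iff.1 hunif d hdpos
  -- the property propagated along the homotopy
  let A : Set I := {s | ∀ g : ℝ → Fin N → ℝ, ContDiff ℝ ∞ g → (∀ x, dist (g x) (w s x) ≤ d) →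
    HasCompactSupport (fun x => g x - c) → formInt θ g = 0}
  -- The stages of the homotopy are only continuous, so the form is integrated along smooth
  -- approximations, which are compared through straight segments.
  have hconn : ∀ g g' : ℝ → Fin N → ℝ, ContDiff ℝ ∞ g → ContDiff ℝ ∞ g' →
      HasCompactSupport (fun x => g x - c) → HasCompactSupport (fun x => g' x - c) →
      ∀ s, (∀ x, dist (g x) (w s x) ≤ d) → (∀ x, dist (g x) (g' x) ≤ 3 * d) →
      formInt θ g = formInt θ g' := by
    intro g g' hg hg' hgc hgc' s hgs hgg
    have hgf : IsField U g := ⟨hg, fun x => hnear s x _ (by linarith [hgs x]), c, hgc⟩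
    have hv : IsVariation (g' - g) := by
      refine ⟨hg'.sub hg, ?_⟩
      have := hgc'.sub hgc
      convert! this using 1
      funext x
      simp
    have h1 := formInt_eq_of_segment hUo hθ hcl hgf hv fun t ht x => ?_
    · rw [← h1]; congr 1; funext x; simp
    · refine hnear s x _ ?_
      have h2 : dist (g x + t • (g' - g) x) (g x) ≤ 3 * d := by
        rw [dist_eq_norm, add_sub_cancel_left, norm_smul, Real.norm_eq_abs, abs_of_nonneg ht.1,
          Pi.sub_apply, ← dist_eq_norm, dist_comm]
        calc t * dist (g x) (g' x) ≤ 1 * dist (g x) (g' x) :=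
              mul_le_mul_of_nonneg_right ht.2 dist_nonneg
          _ ≤ 3 * d := by rw [one_mul]; exact hgg x
      linarith [dist_triangle (g x + t • (g' - g) x) (g x) (w s x), hgs x]
  -- The bound 3d is d for each of the two approximations plus d for the change of stage. As ρ is
  -- uniform, `A` is both open and closed.
  have hstep : ∀ s s' : I, dist s s' < ρ → s' ∈ A → s ∈ A := by
    intro s s' hss hs' g hg hgs hgc
    obtain ⟨g', hg', hgs', hgc'⟩ := exists_smooth_approx (hwc s') (hw_far s') hdpos
    rw [hconn g g' hg hg' hgc hgc' s hgs fun x => ?_]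
    · exact hs' g' hg' hgs' hgc'
    · have h1 : dist (w s x) (w s' x) < d := hFρ (by
        rw [Prod.dist_eq, dist_self, max_eq_left dist_nonneg]; exact hss)
      have h2 := dist_triangle4 (g x) (w s x) (w s' x) (g' x)
      rw [dist_comm (w s' x)] at h2
      linarith [hgs x, hgs' x]
  have hA1 : (1 : I) ∈ A := by
    intro g hg hgs hgc
    rw [hconn g (fun _ => c) hg contDiff_const hgc (by simp only [sub_self]; exact HasCompactSupport.zero) 1 hgs
      fun x => ?_]
    · simp [formInt, dd_const]
    · have := hgs x
      rw [hw1] at this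
      linarith
  have hAo : IsOpen A := Metric.isOpen_iff.2 fun s' hs' =>
    ⟨ρ, hρ, fun s hs => hstep s s' hs hs'⟩
  have hAc : IsClosed A := by
    rw [← isOpen_compl_iff]
    exact Metric.isOpen_iff.2 fun s hs =>
      ⟨ρ, hρ, fun s' hs' hA => hs (hstep s s' (by rw [dist_comm]; exact hs') hA)⟩
  have hAu : A = Set.univ := IsClopen.eq_univ ⟨hAc, hAo⟩ ⟨1, hA1⟩
  have h0 : (0 : I) ∈ A := by rw [hAu]; trivial
  refine h0 u hu.smooth (fun x => by rw [hw0, dist_self]; exact hdpos.le) ?_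
  exact hasCompactSupport_of_abs (R := R) fun x hx => by rw [huc x hx.le, sub_self]

/-! ### The brackets of the coordinates and of the quadratic functional -/

/-- The form `(b^{ij}_k + K δ^i_k u^j) du^k`. -/
def coordForm (P : Coeffs N) (i j : Fin N) (p : Fin N → ℝ) (k : Fin N) : ℝ :=
  P.b p i j k + P.K * ((if i = k then 1 else 0) * p j)

/-- The form `(g^{ij} m_{jk} + b^{ij}_k m_{js} u^s + ½ K δ^i_k m_{js} u^j u^s) du^k`. -/
def quadForm (P : Coeffs N) (m : Matrix (Fin N) (Fin N) ℝ) (i : Fin N) (p : Fin N → ℝ)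
    (k : Fin N) : ℝ :=
  (∑ j, P.g p i j * m j k) + (∑ j, P.b p i j k * m.mulVec p j)
    + P.K / 2 * ((if i = k then 1 else 0) * ∑ j, p j * m.mulVec p j)

theorem dot_single (f : ℝ → Fin N → ℝ) (i : Fin N) :
    dot f (fun _ => Pi.single i 1) = fun x => f x i := by
  funext x
  simp [dot, Pi.single_apply]

/-- Here f may be a nonzero constant at infinity. Subtracting it makes `invD` invert the derivative,
and it contributes nothing because ∫ u^i_x dx = 0. -/
theorem nl_dd_deriv {u : ℝ → Fin N → ℝ} (hu : IsTest u) (i : Fin N) {f : ℝ → ℝ}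
    (hf : ContDiff ℝ ∞ f) {R : ℝ} (h : ∀ x y, R ≤ |x| → R ≤ |y| → f x = f y) :
    nl (fun x => dd u x i) (deriv f) = ∫ x, dd u x i * f x := by
  have h1 : HasCompactSupport (fun x => f x - f |R|) := by
    refine hasCompactSupport_of_abs (R := R) fun x hx => ?_
    rw [h x |R| hx.le (by rw [abs_abs]; exact le_abs_self R), sub_self]
  have h2 := nl_deriv_right (fun x => dd u x i)
    ((hf.sub (contDiff_const (c := f |R|))).of_le (by simp)) h1
  obtain ⟨S, hS⟩ := hu.const
  have h3 : ∫ x, dd u x i = 0 := integral_deriv_eq_zero_of_const (hu.comp i) (R := S)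
    fun x y hx hy => by rw [hS x y hx hy]
  rw [deriv_sub_const_fun] at h2
  rw [h2]
  simp only [mul_sub]
  rw [integral_sub ((hu.cc_dd i).mul_right hf.continuous).integrable
    ((hu.cc_dd i).integrable.mul_const _), integral_mul_const, h3]
  ring

theorem bil_coord (hP : P.SmoothOn U) {u : ℝ → Fin N → ℝ} (hu : IsField U u) (i j : Fin N) :
    P.bil u (fun _ => Pi.single i 1) (fun _ => Pi.single j 1) = formInt (coordForm P i j) u := by
  rw [bil_eq hP hu (isTest_const _) (isTest_const _), dot_single, dot_single]
  obtain ⟨R, hR⟩ := hu.isTest.const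
  have h1 : nl (fun x => dd u x i) (fun x => dd u x j) = ∫ x, dd u x i * u x j :=
    nl_dd_deriv hu.isTest i (hu.isTest.comp j) (R := R) fun x y hx hy => by rw [hR x y hx hy]
  rw [h1, ← integral_const_mul, ← integral_add (cc_loc hP hu (isTest_const _)
    (isTest_const _)).integrable
    (((hu.isTest.cc_dd i).mul_right (hu.isTest.continuous j)).integrable.const_mul _)]
  unfold formInt
  congr 1
  funext x
  rw [loc_single_single]
  simp only [coordForm, add_mul, Finset.sum_add_distrib]
  congr 1
  rw [Finset.sum_eq_single i]
  · simp; ring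
  · intro k _ hk; simp [hk.symm]
  · simp

/-- Symmetry of m makes u_x · m u the derivative of ½ u · m u, so the nonlocal term becomes local.
-/
theorem bil_quad (hP : P.SmoothOn U) {m : Matrix (Fin N) (Fin N) ℝ} (hm : m.IsSymm)
    {u : ℝ → Fin N → ℝ} (hu : IsField U u) (i : Fin N) :
    P.bil u (fun _ => Pi.single i 1) (fun x => m.mulVec (u x)) = formInt (quadForm P m i) u := by
  have hb := hu.isTest.mulVec m
  rw [bil_eq hP hu (isTest_const _) hb, dot_single]
  obtain ⟨R, hR⟩ := hu.isTest.const
  have h1 : dot (dd u) (fun x => m.mulVec (u x))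
      = deriv (fun x => (1 / 2) * dot u (fun x => m.mulVec (u x)) x) := by
    funext x
    rw [deriv_const_mul_field, deriv_dot hu.isTest hb, dd_mulVec m hu.isTest]
    have h2 : dot (fun x => m.mulVec (dd u x)) u x = dot (dd u) (fun x => m.mulVec (u x)) x := by
      change m.mulVec (dd u x) ⬝ᵥ u x = dd u x ⬝ᵥ m.mulVec (u x)
      rw [Matrix.dotProduct_mulVec, ← Matrix.mulVec_transpose, hm.eq]
    simp only [h2]
    ring
  have h3 := nl_dd_deriv hu.isTest i (contDiff_const.mul (contDiff_dot hu.isTest hb))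
    (f := fun x => (1 / 2) * dot u (fun x => m.mulVec (u x)) x) (R := R)
    fun x y hx hy => by simp only [dot, hR x y hx hy]
  rw [h1, h3, ← integral_const_mul, ← integral_add (cc_loc hP hu (isTest_const _) hb).integrable
    (((hu.isTest.cc_dd i).mul_right
      (contDiff_const.mul (contDiff_dot hu.isTest hb)).continuous).integrable.const_mul _)]
  unfold formInt
  congr 1
  funext x
  rw [loc_single, dd_mulVec m hu.isTest]
  simp only [quadForm, add_mul, Finset.sum_add_distrib]
  congr 1
  · congr 1
    · simp only [Finset.sum_mul]
      rw [Finset.sum_comm]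
      refine Finset.sum_congr rfl fun j _ => ?_
      simp only [Matrix.mulVec, dotProduct, Finset.mul_sum]
      exact Finset.sum_congr rfl fun k _ => by ring
    · simp only [Finset.sum_mul]
      rw [Finset.sum_comm]
      exact Finset.sum_congr rfl fun j _ => Finset.sum_congr rfl fun k _ => by ring
  · rw [Finset.sum_eq_single i]
    · simp only [dot, if_true]; ring
    · intro k _ hk; simp [hk.symm]
    · simp

/-! ### Closedness of the forms in terms of the coefficients -/

theorem contDiffOn_coordForm (hP : P.SmoothOn U) (i j k : Fin N) :
    ContDiffOn ℝ ∞ (fun p => coordForm P i j p k) U :=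
  (hP.b i j k).add (contDiffOn_const.mul (contDiffOn_const.mul
    (contDiff_apply ℝ ℝ j).contDiffOn))

theorem contDiff_mulVec (m : Matrix (Fin N) (Fin N) ℝ) (j : Fin N) :
    ContDiff ℝ ∞ (fun p : Fin N → ℝ => m.mulVec p j) := by
  change ContDiff ℝ ∞ (fun p : Fin N → ℝ => ∑ k, m j k * p k)
  fun_prop

theorem contDiffOn_quadForm (hP : P.SmoothOn U) (m : Matrix (Fin N) (Fin N) ℝ) (i k : Fin N) :
    ContDiffOn ℝ ∞ (fun p => quadForm P m i p k) U := by
  refine ContDiffOn.add (ContDiffOn.add ?_ ?_) ?_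
  · exact ContDiffOn.sum fun j _ => (hP.g i j).mul contDiffOn_const
  · exact ContDiffOn.sum fun j _ => (hP.b i j k).mul (contDiff_mulVec m j).contDiffOn
  · exact contDiffOn_const.mul (contDiffOn_const.mul (ContDiffOn.sum fun j _ =>
      (contDiff_apply ℝ ℝ j).contDiffOn.mul (contDiff_mulVec m j).contDiffOn))

theorem hasFDerivAt_of_smooth (hUo : IsOpen U) {f : (Fin N → ℝ) → ℝ} (hf : ContDiffOn ℝ ∞ f U)
    {p : Fin N → ℝ} (hp : p ∈ U) : HasFDerivAt f (fderiv ℝ f p) p :=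
  ((hf.differentiableOn (by simp)).differentiableAt (hUo.mem_nhds hp)).hasFDerivAt

theorem hasDerivAt_line (hUo : IsOpen U) {f : (Fin N → ℝ) → ℝ} (hf : ContDiffOn ℝ ∞ f U)
    {p : Fin N → ℝ} (hp : p ∈ U) (v : Fin N → ℝ) :
    HasDerivAt (fun t : ℝ => f (p + t • v)) (fderiv ℝ f p v) 0 := by
  have h1 : HasDerivAt (fun t : ℝ => p + t • v) v 0 := by
    simpa using ((hasDerivAt_id (0 : ℝ)).smul_const v).const_add p
  have h2 : HasFDerivAt f (fderiv ℝ f p) (p + (0 : ℝ) • v) := by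
    simpa using hasFDerivAt_of_smooth hUo hf hp
  exact h2.comp_hasDerivAt 0 h1

theorem hasDerivAt_line_apply (p : Fin N → ℝ) (l j : Fin N) :
    HasDerivAt (fun t : ℝ => (p + t • Pi.single l (1 : ℝ) : Fin N → ℝ) j)
      (if j = l then 1 else 0) 0 := by
  simpa [Pi.single_apply] using!
    ((hasDerivAt_id (0 : ℝ)).mul_const ((Pi.single l (1 : ℝ) : Fin N → ℝ) j)).const_add (p j)

theorem hasDerivAt_line_mulVec (m : Matrix (Fin N) (Fin N) ℝ) (p : Fin N → ℝ) (l j : Fin N) :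
    HasDerivAt (fun t : ℝ => m.mulVec (p + t • Pi.single l (1 : ℝ)) j) (m j l) 0 := by
  have h1 := HasDerivAt.fun_sum (u := Finset.univ) fun k _ =>
    (hasDerivAt_line_apply p l k).const_mul (m j k)
  simpa using! h1

theorem fderiv_coordForm (hUo : IsOpen U) (hP : P.SmoothOn U) {p : Fin N → ℝ} (hp : p ∈ U)
    (i j k l : Fin N) : fderiv ℝ (fun p => coordForm P i j p k) p (Pi.single l 1)
      = fderiv ℝ (fun p => P.b p i j k) p (Pi.single l 1)
        + P.K * ((if i = k then 1 else 0) * (if j = l then 1 else 0)) :=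
  (hasDerivAt_line hUo (contDiffOn_coordForm hP i j k) hp _).unique
    ((hasDerivAt_line hUo (hP.b i j k) hp _).add
      (((hasDerivAt_line_apply p l j).const_mul _).const_mul _))

/-- The summand K δ^i_k u^j of the form supplies exactly the K-term of the curvature. -/
theorem closedForm_coordForm_iff (hUo : IsOpen U) (hP : P.SmoothOn U) (i j : Fin N) :
    ClosedForm U (coordForm P i j) ↔ ∀ p ∈ U, ∀ k l, P.curv p i j k l = 0 := by
  refine forall₂_congr fun p hp => forall₂_congr fun k l => ?_
  rw [fderiv_coordForm hUo hP hp, fderiv_coordForm hUo hP hp, ← sub_eq_zero]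
  unfold Coeffs.curv
  refine Eq.congr_left ?_
  ring

theorem fderiv_quadForm (hUo : IsOpen U) (hP : P.SmoothOn U) {m : Matrix (Fin N) (Fin N) ℝ}
    (hm : m.IsSymm) {p : Fin N → ℝ} (hp : p ∈ U) (i k l : Fin N) :
    fderiv ℝ (fun p => quadForm P m i p k) p (Pi.single l 1)
      = (∑ j, fderiv ℝ (fun p => P.g p i j) p (Pi.single l 1) * m j k)
        + (∑ j, (fderiv ℝ (fun p => P.b p i j k) p (Pi.single l 1) * m.mulVec p j
          + P.b p i j k * m j l))
        + P.K * ((if i = k then 1 else 0) * m.mulVec p l) := by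
  have h1 := ((HasDerivAt.fun_sum (u := Finset.univ) fun j _ =>
    (hasDerivAt_line hUo (hP.g i j) hp (Pi.single l 1)).mul_const (m j k)).add
    (HasDerivAt.fun_sum (u := Finset.univ) fun j _ =>
    (hasDerivAt_line hUo (hP.b i j k) hp (Pi.single l 1)).mul
      (hasDerivAt_line_mulVec m p l j))).add
    (((HasDerivAt.fun_sum (u := Finset.univ) fun j _ => (hasDerivAt_line_apply p l j).mul
      (hasDerivAt_line_mulVec m p l j)).const_mul (if i = k then (1 : ℝ) else 0)).const_mul
        (P.K / 2))
  refine ((hasDerivAt_line hUo (contDiffOn_quadForm hP m i k) hp _).unique h1).trans ?_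
  have h2 : ∑ j, p j * m j l = m.mulVec p l := by
    simp only [Matrix.mulVec, dotProduct]
    exact Finset.sum_congr rfl fun j _ => by rw [← hm.apply j l, mul_comm]
  simp only [zero_smul, add_zero]
  congr 1
  simp only [ite_mul, one_mul, zero_mul, Finset.sum_add_distrib, h2, Finset.sum_ite_eq',
    Finset.mem_univ, if_true]
  split_ifs <;> ring

/-- The derivatives of b and the K-terms assemble into the curvature contracted with m u, which is
zero. With ∂_l g^{ij} = b^{ij}_l + b^{ji}_l, the remaining b^{ij}-terms are symmetric in k and l and
cancel, leaving the antisymmetric part of m_{kj} b^{ji}_l. -/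
theorem closedForm_quadForm_iff (hUo : IsOpen U) (hP : P.SmoothOn U)
    {m : Matrix (Fin N) (Fin N) ℝ} (hm : m.IsSymm)
    (hg : ∀ p ∈ U, ∀ i j k, fderiv ℝ (fun p => P.g p i j) p (Pi.single k 1)
      = P.b p i j k + P.b p j i k) (hcurv : ∀ p ∈ U, ∀ i j k l, P.curv p i j k l = 0)
    (i : Fin N) : ClosedForm U (quadForm P m i) ↔
      ∀ p ∈ U, ∀ k l, ∑ j, m k j * P.b p j i l = ∑ j, m l j * P.b p j i k := by
  refine forall₂_congr fun p hp => forall₂_congr fun k l => ?_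
  rw [fderiv_quadForm hUo hP hm hp, fderiv_quadForm hUo hP hm hp, ← sub_eq_zero,
    ← sub_eq_zero (a := ∑ j, m k j * P.b p j i l)]
  refine Eq.congr_left ?_
  have h1 : ∑ j, P.curv p i j k l * m.mulVec p j = 0 := by simp [hcurv p hp]
  have h2 : ∑ j, P.curv p i j k l * m.mulVec p j
      = (∑ j, fderiv ℝ (fun p => P.b p i j k) p (Pi.single l 1) * m.mulVec p j)
        - (∑ j, fderiv ℝ (fun p => P.b p i j l) p (Pi.single k 1) * m.mulVec p j)
        + P.K * ((if i = k then 1 else 0) * m.mulVec p l)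
        - P.K * ((if i = l then 1 else 0) * m.mulVec p k) := by
    have h3 : ∀ q : Fin N, m.mulVec p q = ∑ j, (if j = q then 1 else 0) * m.mulVec p j := by
      intro q; simp
    rw [h3 l, h3 k]
    simp only [Finset.mul_sum, ← Finset.sum_add_distrib, ← Finset.sum_sub_distrib]
    refine Finset.sum_congr rfl fun j _ => ?_
    unfold Coeffs.curv
    ring
  have h4 : ∀ k l, ∑ j, m k j * P.b p j i l = ∑ j, P.b p j i l * m j k := fun k l =>
    Finset.sum_congr rfl fun j _ => by rw [← hm.apply j k, mul_comm]
  simp only [hg p hp, Finset.sum_add_distrib, add_mul, h4]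
  linear_combination h1 - h2

/-- For fixed i let B = (b^{ji}_l). Since η⁻¹B = η⁻¹(Bη)η⁻¹ is a congruence by a symmetric matrix,
Bη and η⁻¹B are symmetric together. -/
theorem symmCond_iff {η : Matrix (Fin N) (Fin N) ℝ} (hη : η.IsSymm) (hd : η.det ≠ 0)
    (p : Fin N → ℝ) : P.SymmCond η p ↔
      ∀ i k l, ∑ j, η⁻¹ k j * P.b p j i l = ∑ j, η⁻¹ l j * P.b p j i k := by
  have hu : IsUnit η.det := isUnit_iff_ne_zero.2 hd
  refine forall_congr' fun i => ?_
  set B : Matrix (Fin N) (Fin N) ℝ := Matrix.of fun j l => P.b p j i l with hB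
  have h1 : (∀ j s, ∑ l, η l s * P.b p j i l = ∑ l, η l j * P.b p s i l)
      ↔ (B * η).transpose = B * η := by
    rw [← Matrix.ext_iff, forall_comm]
    refine forall₂_congr fun s j => ?_
    simp only [Matrix.transpose_apply, Matrix.mul_apply, hB, Matrix.of_apply]
    simp only [mul_comm (P.b p _ _ _)]
  have h2 : (∀ k l, ∑ j, η⁻¹ k j * P.b p j i l = ∑ j, η⁻¹ l j * P.b p j i k)
      ↔ (η⁻¹ * B).transpose = η⁻¹ * B := by
    rw [← Matrix.ext_iff, forall_comm]
    refine forall₂_congr fun s j => ?_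
    simp only [Matrix.transpose_apply, Matrix.mul_apply, hB, Matrix.of_apply]
  have hηi : η⁻¹.transpose = η⁻¹ := by rw [Matrix.transpose_nonsing_inv, hη.eq]
  rw [h1, h2]
  constructor
  · intro h
    have h3 : η⁻¹ * B = η⁻¹ * (B * η) * η⁻¹ := by
      rw [Matrix.mul_assoc, Matrix.mul_assoc, Matrix.mul_nonsing_inv _ hu, Matrix.mul_one]
    rw [h3, Matrix.transpose_mul, Matrix.transpose_mul, h, hηi]
    simp only [Matrix.mul_assoc]
  · intro h
    have h3 : B * η = η * (η⁻¹ * B) * η := by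
      rw [← Matrix.mul_assoc, Matrix.mul_nonsing_inv _ hu, Matrix.one_mul]
    rw [h3, Matrix.transpose_mul, Matrix.transpose_mul, h, hη.eq]
    simp only [Matrix.mul_assoc]

/-! ### Brackets of the coordinates and the quadratic functional as form integrals -/

theorem varDeriv_coordFunctional (i : Fin N) (u : ℝ → Fin N → ℝ) :
    (coordFunctional U i).varDeriv u = fun _ => Pi.single i 1 := by
  funext x k
  have h1 : HasFDerivAt (fun p : Fin N → ℝ => p i)
    (ContinuousLinearMap.proj (R := ℝ) (φ := fun _ : Fin N => ℝ) i) (u x) := hasFDerivAt_apply i _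
  change fderiv ℝ (fun p : Fin N → ℝ => p i) (u x) (Pi.single k 1) = _
  rw [h1.fderiv]
  simp [Pi.single_apply, eq_comm]

theorem varDeriv_quadFunctional {m : Matrix (Fin N) (Fin N) ℝ} (hm : m.IsSymm)
    (u : ℝ → Fin N → ℝ) :
    (quadFunctional U m).varDeriv u = (2 : ℝ) • fun x => m.mulVec (u x) := by
  funext x l
  change fderiv ℝ (fun p : Fin N → ℝ => ∑ i, ∑ j, m i j * p i * p j) (u x) (Pi.single l 1) = _
  have hs : ContDiffOn ℝ ∞ (fun p : Fin N → ℝ => ∑ i, ∑ j, m i j * p i * p j) Set.univ := by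
    fun_prop
  have h1 := HasDerivAt.fun_sum (u := Finset.univ) fun i _ => HasDerivAt.fun_sum
    (u := Finset.univ) fun j _ => ((hasDerivAt_line_apply (u x) l i).const_mul (m i j)).mul
      (hasDerivAt_line_apply (u x) l j)
  refine ((hasDerivAt_line isOpen_univ hs (Set.mem_univ _) _).unique h1).trans ?_
  have h2 : ∑ i, m i l * u x i = ∑ j, m l j * u x j :=
    Finset.sum_congr rfl fun j _ => by rw [← hm.apply j l]
  simp only [Finset.sum_add_distrib, zero_smul, add_zero, mul_ite, mul_one, mul_zero, ite_mul,
    zero_mul, Finset.sum_ite_eq', Finset.mem_univ, if_true]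
  rw [Finset.sum_comm]
  simp only [Finset.sum_ite_eq', Finset.mem_univ, if_true, h2]
  simp only [Pi.smul_apply, smul_eq_mul, Matrix.mulVec, dotProduct]
  ring

/-- Scalars leave the left argument by linearity of the integral alone; skewness carries this over
to the right one. -/
theorem bil_smul_right {u a b : ℝ → Fin N → ℝ} (hu : IsField U u)
    (ha : IsTest a) (hb : IsTest b) (c : ℝ)
    (hskew : ∀ u a b, IsField U u → IsTest a → IsTest b → P.bil u a b = - P.bil u b a)
    (hcb : IsTest (c • b)) : P.bil u a (c • b) = c * P.bil u a b := by
  rw [hskew u a _ hu ha hcb, hskew u a b hu ha hb]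
  unfold Coeffs.bil
  rw [mul_neg, ← integral_const_mul]
  congr 2
  funext x
  simp only [dot, Finset.mul_sum, Pi.smul_apply, smul_eq_mul, mul_assoc]

/-- Involution, expressed through the integrals of forms along fields. -/
theorem inInvolution_iff (hUo : IsOpen U) (hP : P.SmoothOn U) (h : P.IsPoisson U)
    {m : Matrix (Fin N) (Fin N) ℝ} (hm : m.IsSymm) :
    P.InInvolution (Set.range (coordFunctional U) ∪ {quadFunctional U m}) ↔
      ∀ u, IsField U u → (∀ i j, formInt (coordForm P i j) u = 0) ∧
        ∀ i, formInt (quadForm P m i) u = 0 := by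
  have hskew : ∀ u a b, IsField U u → IsTest a → IsTest b → P.bil u a b = - P.bil u b a :=
    fun _ _ _ hu ha hb => bil_skew_of_isPoisson h hu ha hb
  have e1 : ∀ u, IsField U u → ∀ i j, P.bracket (coordFunctional U i) (coordFunctional U j) u
      = formInt (coordForm P i j) u := by
    intro u hu i j
    rw [← bil_coord hP hu, ← varDeriv_coordFunctional (U := U) i u,
      ← varDeriv_coordFunctional (U := U) j u]
    rfl
  have e2 : ∀ u, IsField U u → ∀ i, P.bracket (coordFunctional U i) (quadFunctional U m) u
      = 2 * formInt (quadForm P m i) u := by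
    intro u hu i
    have h1 : P.bracket (coordFunctional U i) (quadFunctional U m) u
        = P.bil u ((coordFunctional U i).varDeriv u) ((quadFunctional U m).varDeriv u) := rfl
    have h2 := (quadFunctional U m).isTest_varDeriv hUo hu
    rw [varDeriv_quadFunctional hm] at h2
    rw [h1, varDeriv_coordFunctional, varDeriv_quadFunctional hm,
      bil_smul_right hu (isTest_const _) (hu.isTest.mulVec m) 2 hskew h2, bil_quad hP hm hu]
  constructor
  · intro hI u hu
    refine ⟨fun i j => ?_, fun i => ?_⟩
    · rw [← e1 u hu]
      exact hI _ (Or.inl ⟨i, rfl⟩) _ (Or.inl ⟨j, rfl⟩) u hu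
    · have h1 := hI _ (Or.inl ⟨i, rfl⟩) _ (Or.inr rfl) u hu
      rw [e2 u hu] at h1
      linarith
  · rintro hF I (⟨i, rfl⟩ | rfl) J (⟨j, rfl⟩ | rfl) u hu
    · rw [e1 u hu, (hF u hu).1]
    · rw [e2 u hu, (hF u hu).2, mul_zero]
    · rw [h.skew _ _ u hu, e2 u hu, (hF u hu).2, mul_zero, neg_zero]
    -- The bracket of the quadratic functional with itself equals its own negative.
    · have := h.skew (quadFunctional U m) (quadFunctional U m) u hu
      linarith

end

end HydroBracket

end

theorem mainTheorem3 {N : ℕ} (U : Set (Fin N → ℝ)) (hUo : IsOpen U)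
    (hUs : IsSimplyConnected U)
    (η : Matrix (Fin N) (Fin N) ℝ) (hηs : η.IsSymm) (hηd : η.det ≠ 0)
    (P : HydroBracket.Coeffs N) (hP : P.SmoothOn U) (hPoisson : P.IsPoisson U) :
    HydroBracket.Coeffs.Compatible U P (HydroBracket.Coeffs.const η) ↔
      P.InInvolution
        (Set.range (HydroBracket.coordFunctional U) ∪ {HydroBracket.quadFunctional U η⁻¹}) := by
  open HydroBracket in
  have hm : (η⁻¹).IsSymm := by
    change η⁻¹.transpose = η⁻¹
    rw [Matrix.transpose_nonsing_inv, hηs.eq]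
  have hu : IsUnit η.det := isUnit_iff_ne_zero.2 hηd
  have hg : ∀ p ∈ U, ∀ i j k, fderiv ℝ (fun p => P.g p i j) p (Pi.single k 1)
      = P.b p i j k + P.b p j i k := fun p hp i j k => fderiv_g_eq hUo hP
    (fun _ _ _ hu ha hb => bil_skew_of_isPoisson hPoisson hu ha hb) hp i j k
  rw [compatible_const_iff hUo hP hPoisson hηs, inInvolution_iff hUo hP hPoisson hm]
  constructor
  · intro hj
    have hcurv : ∀ p ∈ U, ∀ i j k l, P.curv p i j k l = 0 := by
      intro p hp i j k l
      refine curv_eq_zero hUo hP i j (fun u h hu' hh => ?_) hp k l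
      -- Constant test functions have zero Hamiltonian field for the constant bracket, so a single
      -- term survives. The choice c = η⁻¹ h makes its direction η c_x = h_x arbitrary among
      -- derivatives.
      have h1 := hj u (fun _ => Pi.single i 1) (fun _ => Pi.single j 1)
        (fun x => η⁻¹.mulVec (h x)) hu' (isTest_const _) (isTest_const _)
        (hh.mulVec η⁻¹).isTest
      have h0 : (fun _ : ℝ => η.mulVec (0 : Fin N → ℝ)) = 0 := by funext x; simp
      have h2 : (fun x => η.mulVec (η⁻¹.mulVec (dd h x))) = dd h := by
        funext x
        rw [Matrix.mulVec_mulVec, Matrix.mul_nonsing_inv _ hu, Matrix.one_mulVec]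
      simpa only [Coeffs.jac, apply_const, dd_const, Pi.zero_apply, h0, tau_zero, add_zero,
        dd_mulVec _ hh.isTest, h2] using h1
    have hsymm : ∀ p ∈ U, P.SymmCond η p := fun p hp => symmCond_of_jac hUo hP hg hj hp
    -- Simple connectedness enters only in this direction, to pass from closed forms to vanishing
    -- loop integrals.
    refine fun u hu' => ⟨fun i j => formInt_eq_zero hUo hUs (contDiffOn_coordForm hP i j)
      ((closedForm_coordForm_iff hUo hP i j).2 fun p hp => hcurv p hp i j) hu', fun i =>
      formInt_eq_zero hUo hUs (contDiffOn_quadForm hP η⁻¹ i)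
      ((closedForm_quadForm_iff hUo hP hm hg hcurv i).2 fun p hp =>
        (symmCond_iff hηs hηd p).1 (hsymm p hp) i) hu'⟩
  · intro hF u a b c hu' ha hb hc
    have hcurv : ∀ p ∈ U, ∀ i j k l, P.curv p i j k l = 0 := fun p hp i j =>
      (closedForm_coordForm_iff hUo hP i j).1 (closedForm_of_formInt_eq_zero hUo
        (contDiffOn_coordForm hP i j) fun u hu' => (hF u hu').1 i j) p hp
    have hsymm : ∀ p ∈ U, P.SymmCond η p := fun p hp => (symmCond_iff hηs hηd p).2 fun i =>
      (closedForm_quadForm_iff hUo hP hm hg hcurv i).1 (closedForm_of_formInt_eq_zero hUo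
        (contDiffOn_quadForm hP η⁻¹ i) fun u hu' => (hF u hu').2 i) p hp
    exact jac_const_eq_zero hUo hP hg hηs hcurv hsymm hu' ha hb hc
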